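/- **Setting.** Fix $n,m\ge 0$ and $\ell\ge 1$. Let $\mathcal D=\mathbb C[x^i,u^\alpha_\mu]$ ($1\le i\le n$, $1\le\alpha\le m$, $\mu\in\mathbb N_0^n$) with the derivations $\delta_i$, $\delta_ix^j=\delta_{ij}$, $\delta_iu^\alpha_\mu=u^\alpha_{\mu+1_i}$, and let $\mathcal D_\ell\subset\mathcal D$ be the polynomial subring in the $x^i$ and the $u^\alpha_\mu$ with $|\mu|\le\ell$. It is the coordinate ring of the jet bundle $J_\ell\pi$ of $\pi:\mathbb C^n\times\mathbb C^m\to\mathbb C^n$, which is regarded as an affine space. Let $S=\{p_1=0,\dots,p_s=0,\ q_1\ne0,\dots,q_t\neq0\}$ be a differential system with $p_i,q_j\in\mathcal D$ (for example a simple one; simplicity is not needed). Put $\mathcal I_{\mathrm{diff}}(S)=\sqrt{\langle p_1,\dots,p_s\rangle_\Delta:(q_1\cdots q_t)^\infty}$ and $\mathcal I_\ell(S)=\mathcal I_{\mathrm{diff}}(S)\cap\mathcal D_\ell$. **Vessiot and symbol spaces.** Let $C_i^{(\ell)}=\partial_{x^i}+\sum_{|\mu|<\ell}\sum_\alpha u^\alpha_{\mu+1_i}\partial_{u^\alpha_\mu}$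 and $C^\mu_\alpha=\partial_{u^\alpha_\mu}$ ($|\mu|=\ell$). At a smooth point $\rho$ of a variety $V\subseteq J_\ell\pi$, the Vessiot space $\mathcal V_\rho[V]$ is the intersection of $T_\rho V$ with the span of all $C_i^{(\ell)}|_\rho,C^\mu_\alpha|_\rho$, and the symbol space $\mathcal N_\rho[V]$ is the part of $\mathcal V_\rho[V]$ that is vertical for $J_\ell\pi\to J_{\ell-1}\pi$. The set of non-smooth points of $V$ (algebraic singularities) is denoted by $\mathrm{ASing}(V)$. A locally Zariski closed set $Z\subseteq V$ is a *regular algebraic jet set in $V$* if $Z$ is a smooth manifold, all its points are smooth points of $V$, and the spaces $\mathcal V_\rho[V]$ and $\mathcal N_\rho[V]$, $\rho\in Z$, form smooth vector bundles over $Z$. A *regularity decomposition* of $V$ represents $V$ as the disjoint union of finitely many regular algebraic jet sets in $V$ and of $\mathrm{ASing}(V)$. **Simple systems.** Fix a total order of finitely many variables. The leader of a non-constant polynomial is the greatest variable in it, and its initial is the coefficient of the highest power of its leader. An algebraic system $T$ (a finite set of polynomial equations and inequations over $\mathbb C$) with solution set $\mathrm{Sol}(T)$ is *simple* if its members are non-constant,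 they have pairwise different leaders, and for each member $r$ with leader $v$ and each solution of the subsystem $T_{<v}$ of all members with leader less than $v$, the initial of $r$ does not vanish there and the univariate polynomial in $v$ obtained from $r$ by substituting this solution is square-free. A *Thomas decomposition* of a system consists of finitely many simple systems whose solution sets are pairwise disjoint and have the solution set of the given system as their union. **The algorithm.** Adjoin to $\mathcal D_\ell$ variables $a^i$, $d^i$ ($1\le i\le n$), $b^\alpha_\mu$ ($|\mu|=\ell$), $c^\alpha_\mu$ ($|\mu|\le\ell$). Fix a total order of all variables with $d>c>b>a>u>x$ (blockwise) that restricts to an orderly ranking on the $u^\alpha_\mu$ and orders the $b^\alpha_\mu$, and the $c^\alpha_\mu$, as the $u^\alpha_\mu$. 1. Compute a finite generating set of $\mathcal I_\ell(S)$. 2. Compute the prime components (minimal primes) $\mathcal I_{\ell,1},\dots,\mathcal I_{\ell,t}$ of $\mathcal I_\ell(S)$, and a finite generating set $\{p_{k,1},\dots,p_{k,s_k}\}$ of each. 3. For $k=1,\dots,t$, compute a Thomas decomposition $S^{\mathrm{ex}}_{k,1},\dots,S^{\mathrm{ex}}_{k,r_k}$ of the system $$\mathbf J(p_{k,j})=0,\quad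 \mathbf V(p_{k,j})=0,\quad p_{k,j}=0\qquad(j=1,\dots,s_k)$$ in which no inequation has its leader among $a,b,c,d$. Here $\mathbf V=\sum_ia^iC^{(\ell)}_i+\sum_{|\mu|=\ell}\sum_\alpha b^\alpha_\mu C^\mu_\alpha$ and $\mathbf J=\sum_{|\mu|\le\ell}\sum_\alpha c^\alpha_\mu\partial_{u^\alpha_\mu}+\sum_id^i\partial_{x^i}$. 4. Return the systems $S_{k,i}$ that consist of the equations and inequations of $S_{k,i}^{\mathrm{ex}}$ lying in $\mathcal D_\ell$. Mark $S_{k,i}$ as *singular* if fewer than $\operatorname{codim}\mathrm{Sol}(\mathcal I_{\ell,k})$ equations of $S^{\mathrm{ex}}_{k,i}$ have their leader among $c,d$. The computations in steps 1–3 are calls of subalgorithms, each of which may return any result of the described kind. **Theorem.** For every such $S$, every $\ell\ge1$ and every such order, the algorithm terminates and is correct: (a) There is no infinite execution, and no execution gets stuck before it returns an output (in particular, results as required in steps 1–3 always exist). (b) For every execution and every prime component $\mathcal I_{\ell,k}$ of $\mathcal I_\ell(S)$, put $V_k=\mathrm{Sol}(\mathcal I_{\ell,k})$. The returned systems $S_{k,1},\dots,S_{k,r_k}$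 are simple with respect to the induced order, and their solution sets are pairwise disjoint with union $V_k$. If $S_{k,i}$ is marked as singular, then $\mathrm{Sol}(S_{k,i})\subseteq\mathrm{ASing}(V_k)$; otherwise $\mathrm{Sol}(S_{k,i})$ is a regular algebraic jet set in $V_k$. The set $\mathrm{ASing}(V_k)$ is the union of the solution sets of the systems marked as singular, and the solution sets of the other systems form a regularity decomposition of $V_k$. -/

import Mathlib

open MvPolynomial

noncomputable section

namespace RegDec

/-! ### Differential polynomials -/

/-- The variables of the ring of differential polynomials with polynomial coefficients:
`inl i` is the independent variable `x^i`, and `inr (α, μ)` is the jet variable `u^α_μ`. -/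
abbrev DiffVar (n m : ℕ) : Type := Fin n ⊕ (Fin m × (Fin n → ℕ))

/-- The ring `𝒟 = ℂ[x^i, u^α_μ | all i, α, μ]`. -/
abbrev DiffRing (n m : ℕ) : Type := MvPolynomial (DiffVar n m) ℂ

/-- The derivation `δ_i` of `𝒟` with `δ_i x^j = δ_{ij}` and `δ_i u^α_μ = u^α_{μ + 1_i}`. -/
def totalDeriv {n m : ℕ} (i : Fin n) : Derivation ℂ (DiffRing n m) (DiffRing n m) :=
  mkDerivation ℂ fun
    | Sum.inl j => if j = i then 1 else 0
    | Sum.inr (α, μ) => X (Sum.inr (α, μ + Pi.single i 1))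

/-- The differential ideal `⟨P⟩_Δ` generated by `P`: the least ideal that contains `P` and is
closed under all the derivations `δ_i`. -/
def diffSpan {n m : ℕ} (P : Set (DiffRing n m)) : Ideal (DiffRing n m) :=
  sInf {I | P ⊆ I ∧ ∀ i : Fin n, ∀ f ∈ I, totalDeriv i f ∈ I}

/-- The saturation `I : Q^∞`. -/
def saturation {R : Type*} [CommRing R] (I : Ideal R) (Q : R) : Ideal R where
  carrier := {f | ∃ k : ℕ, Q ^ k * f ∈ I}
  zero_mem' := ⟨0, by simp⟩
  add_mem' := by
    rintro f g ⟨k, hk⟩ ⟨l, hl⟩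
    refine ⟨k + l, ?_⟩
    have h : Q ^ (k + l) * (f + g) = Q ^ l * (Q ^ k * f) + Q ^ k * (Q ^ l * g) := by ring
    rw [h]
    exact I.add_mem (I.mul_mem_left _ hk) (I.mul_mem_left _ hl)
  smul_mem' := by
    rintro c f ⟨k, hk⟩
    refine ⟨k, ?_⟩
    have h : Q ^ k * (c • f) = c * (Q ^ k * f) := by
      rw [smul_eq_mul]; ring
    rw [h]
    exact I.mul_mem_left _ hk

/-- A differential system: finitely many equations `p = 0` and inequations `q ≠ 0`. -/
structure DiffSystem (n m : ℕ) where
  eqs : Finset (DiffRing n m)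
  ineqs : Finset (DiffRing n m)

/-- The radical differential ideal `ℐ_diff(S) = √(⟨p_1, …, p_s⟩_Δ : (q_1 ⋯ q_t)^∞)`. -/
def diffIdeal {n m : ℕ} (S : DiffSystem n m) : Ideal (DiffRing n m) :=
  (saturation (diffSpan (S.eqs : Set (DiffRing n m))) (∏ q ∈ S.ineqs, q)).radical

/-! ### The jet bundle of order `ℓ` over `ℂⁿ × ℂᵐ → ℂⁿ` -/

/-- Multi-indices `μ` of length `n` with `|μ| ≤ ℓ`. -/
abbrev MultiIdx (n ℓ : ℕ) : Type := {μ : Fin n → ℕ // ∑ i, μ i ≤ ℓ}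

instance instFiniteMultiIdx (n ℓ : ℕ) : Finite (MultiIdx n ℓ) :=
  Set.Finite.to_subtype <| (Set.finite_Iic (fun _ : Fin n => ℓ)).subset fun μ hμ i =>
    le_trans (Finset.single_le_sum (f := μ) (fun _ _ => Nat.zero_le _) (Finset.mem_univ i)) hμ

instance instFintypeMultiIdx (n ℓ : ℕ) : Fintype (MultiIdx n ℓ) := Fintype.ofFinite _

/-- Multi-indices `μ` of length `n` with `|μ| = ℓ`. -/
abbrev TopIdx (n ℓ : ℕ) : Type := {μ : MultiIdx n ℓ // ∑ i, μ.1 i = ℓ}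

/-- Coordinates on the jet bundle of order `ℓ`: `inl i` is `x^i`, and `inr (α, μ)` is `u^α_μ`. -/
abbrev JetVar (n m ℓ : ℕ) : Type := Fin n ⊕ (Fin m × MultiIdx n ℓ)

/-- The points of the jet bundle of order `ℓ`, identified with an affine space. Tangent vectors
at a point are written with respect to the coordinate basis, so they have the same type. -/
abbrev JetSpace (n m ℓ : ℕ) : Type := JetVar n m ℓ → ℂ

/-- The coordinate ring `𝒟_ℓ` of the jet bundle of order `ℓ`. -/
abbrev JetRing (n m ℓ : ℕ) : Type := MvPolynomial (JetVar n m ℓ) ℂ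

/-- A coordinate of the jet bundle of order `ℓ` as a variable of `𝒟`. -/
def JetVar.toDiffVar {n m ℓ : ℕ} : JetVar n m ℓ → DiffVar n m
  | Sum.inl i => Sum.inl i
  | Sum.inr (α, μ) => Sum.inr (α, μ.1)

/-- The ideal `ℐ_ℓ(S) = ℐ_diff(S) ∩ 𝒟_ℓ`. -/
def jetIdeal {n m : ℕ} (S : DiffSystem n m) (ℓ : ℕ) : Ideal (JetRing n m ℓ) :=
  (diffIdeal S).comap (rename (JetVar.toDiffVar (n := n) (m := m) (ℓ := ℓ)))

/-- The coefficients, with respect to the coordinate vector fields, of the contact vector field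
`C_i^{(ℓ)} = ∂_{x^i} + ∑_{|μ| < ℓ} ∑_α u^α_{μ + 1_i} ∂_{u^α_μ}`. -/
def contactCoeff {n m ℓ : ℕ} (i : Fin n) : JetVar n m ℓ → JetRing n m ℓ
  | Sum.inl j => if j = i then 1 else 0
  | Sum.inr (α, μ) =>
      if h : ∑ j, μ.1 j < ℓ then
        X (Sum.inr (α, ⟨μ.1 + Pi.single i 1, by
          simp only [Pi.add_apply, Finset.sum_add_distrib, Finset.sum_pi_single',
            Finset.mem_univ, if_true]
          omega⟩))
      else 0

/-- `C_i^{(ℓ)}` as a derivation of `𝒟_ℓ`. -/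
def contactDeriv {n m ℓ : ℕ} (i : Fin n) :
    Derivation ℂ (JetRing n m ℓ) (JetRing n m ℓ) :=
  mkDerivation ℂ (contactCoeff i)

/-- The value at `ρ` of the contact distribution, spanned by the fields `C_i^{(ℓ)}` and
`C^μ_α = ∂_{u^α_μ}` with `|μ| = ℓ`. -/
def contactSpace {n m ℓ : ℕ} (ρ : JetSpace n m ℓ) : Submodule ℂ (JetSpace n m ℓ) :=
  Submodule.span ℂ
    (Set.range (fun (i : Fin n) (w : JetVar n m ℓ) => eval ρ (contactCoeff i w)) ∪
      Set.range (fun (k : Fin m × TopIdx n ℓ) =>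
        (Pi.single (Sum.inr (k.1, k.2.1)) 1 : JetSpace n m ℓ)))

/-- The vertical space of the projection to the jet bundle of order `ℓ - 1`, i.e. the kernel
of its tangent map. -/
def verticalSpace (n m ℓ : ℕ) : Submodule ℂ (JetSpace n m ℓ) where
  carrier := {v | (∀ i, v (Sum.inl i) = 0) ∧
    ∀ α μ, ∑ j, μ.1 j < ℓ → v (Sum.inr (α, μ)) = 0}
  zero_mem' := by simp
  add_mem' := by
    rintro v w ⟨hv, hv2⟩ ⟨hw, hw2⟩
    exact ⟨fun i => by simp [hv i, hw i], fun α μ h => by simp [hv2 α μ h, hw2 α μ h]⟩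
  smul_mem' := by
    rintro c v ⟨hv, hv2⟩
    exact ⟨fun i => by simp [hv i], fun α μ h => by simp [hv2 α μ h]⟩

/-! ### Algebraic geometry of subsets of affine space -/

section Geometry

variable {σ : Type*} [Fintype σ]

/-- A subset of affine space is locally Zariski closed if it is the difference of two
varieties. -/
def IsLocallyZariskiClosed (Z : Set (σ → ℂ)) : Prop :=
  ∃ A B : Ideal (MvPolynomial σ ℂ), Z = zeroLocus ℂ A \ zeroLocus ℂ B

/-- The Zariski tangent space of `V` at `ρ`: the vectors annihilated by the differentials at `ρ`
of all polynomials vanishing on `V`. -/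
def tangentSpace (V : Set (σ → ℂ)) (ρ : σ → ℂ) : Submodule ℂ (σ → ℂ) where
  carrier := {v | ∀ p ∈ vanishingIdeal ℂ V, ∑ w, eval ρ (pderiv w p) * v w = 0}
  zero_mem' := by simp
  add_mem' := by
    intro v w hv hw p hp
    simp only [Pi.add_apply, mul_add, Finset.sum_add_distrib, hv p hp, hw p hp, add_zero]
  smul_mem' := by
    intro c v hv p hp
    have h : ∀ w, eval ρ (pderiv w p) * (c • v) w = c * (eval ρ (pderiv w p) * v w) := by
      intro w
      simp only [Pi.smul_apply, smul_eq_mul]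
      ring
    simp only [h, ← Finset.mul_sum, hv p hp, mul_zero]

/-- The local dimension of `V` at `ρ`: the maximal dimension of an irreducible component (of the
Zariski closure) of `V` that passes through `ρ`. -/
def localDim (V : Set (σ → ℂ)) (ρ : σ → ℂ) : WithBot ℕ∞ :=
  ⨆ P ∈ {P ∈ (vanishingIdeal ℂ V).minimalPrimes | ρ ∈ zeroLocus ℂ P},
    ringKrullDim (MvPolynomial σ ℂ ⧸ P)

/-- `ρ` is a smooth point of the algebraic set `V`. -/
def IsSmoothPoint (V : Set (σ → ℂ)) (ρ : σ → ℂ) : Prop :=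
  ρ ∈ V ∧ ((Module.finrank ℂ (tangentSpace V ρ) : ℕ) : WithBot ℕ∞) = localDim V ρ

/-- The set `ASing(V)` of algebraic singularities, i.e. of non-smooth points, of `V`. -/
def algSing (V : Set (σ → ℂ)) : Set (σ → ℂ) := {ρ ∈ V | ¬ IsSmoothPoint V ρ}

/-- `Z` is an embedded complex submanifold of affine space, with the same dimension at each of
its points: near every point it is the zero set of `c` holomorphic functions with linearly
independent differentials. -/
def IsComplexSubmanifold (Z : Set (σ → ℂ)) : Prop :=
  ∃ c : ℕ, ∀ ρ ∈ Z, ∃ U : Set (σ → ℂ), IsOpen U ∧ ρ ∈ U ∧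
    ∃ g : (σ → ℂ) → (Fin c → ℂ), DifferentiableOn ℂ g U ∧
      Function.Surjective (fderiv ℂ g ρ) ∧ Z ∩ U = {ρ' ∈ U | g ρ' = 0}

/-- A family `F` of linear subspaces, indexed by the points of `Z`, is a smooth (i.e.
holomorphic) vector bundle over `Z`: it has constant rank, and near every point of `Z` it has a
frame consisting of restrictions of holomorphic vector fields. -/
def IsVectorBundleOver (Z : Set (σ → ℂ)) (F : (σ → ℂ) → Submodule ℂ (σ → ℂ)) : Prop :=
  ∃ r : ℕ, ∀ ρ ∈ Z, ∃ U : Set (σ → ℂ), IsOpen U ∧ ρ ∈ U ∧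
    ∃ s : Fin r → (σ → ℂ) → (σ → ℂ), (∀ i, DifferentiableOn ℂ (s i) U) ∧
      ∀ ρ' ∈ Z ∩ U, LinearIndependent ℂ (fun i => s i ρ') ∧
        Submodule.span ℂ (Set.range fun i => s i ρ') = F ρ'

end Geometry

/-- The Vessiot space of `V` at a (smooth) point `ρ`. -/
def vessiotSpace {n m ℓ : ℕ} (V : Set (JetSpace n m ℓ)) (ρ : JetSpace n m ℓ) :
    Submodule ℂ (JetSpace n m ℓ) :=
  tangentSpace V ρ ⊓ contactSpace ρ

/-- The symbol space of `V` at a (smooth) point `ρ`: the vertical part of the Vessiot space. -/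
def symbolSpace {n m ℓ : ℕ} (V : Set (JetSpace n m ℓ)) (ρ : JetSpace n m ℓ) :
    Submodule ℂ (JetSpace n m ℓ) :=
  vessiotSpace V ρ ⊓ verticalSpace n m ℓ

/-- The subset `Z` is a regular algebraic jet set in `V`: it is locally Zariski closed, it is a
smooth manifold all of whose points are smooth points of `V`, and the Vessiot spaces and the
symbol spaces of `V` at the points of `Z` form smooth vector bundles over `Z`. For `Z = V` this
says that `V` is a regular algebraic jet set. -/
structure IsRegularJetSetIn {n m ℓ : ℕ} (V Z : Set (JetSpace n m ℓ)) : Prop where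
  subset : Z ⊆ V
  locallyClosed : IsLocallyZariskiClosed Z
  smoothPoints : ∀ ρ ∈ Z, IsSmoothPoint V ρ
  manifold : IsComplexSubmanifold Z
  vessiotBundle : IsVectorBundleOver Z (vessiotSpace V)
  symbolBundle : IsVectorBundleOver Z (symbolSpace V)

/-- The sets in the list `L` form a regularity decomposition of `V`: they are regular algebraic
jet sets in `V`, and `V` is the disjoint union of them and of its set of algebraic
singularities. -/
def IsRegularityDecomposition {n m ℓ : ℕ} (V : Set (JetSpace n m ℓ))
    (L : List (Set (JetSpace n m ℓ))) : Prop :=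
  (∀ Z ∈ L, IsRegularJetSetIn V Z) ∧ L.Pairwise Disjoint ∧
    (∀ Z ∈ L, Disjoint Z (algSing V)) ∧ V = {ρ | ∃ Z ∈ L, ρ ∈ Z} ∪ algSing V

/-! ### Algebraic systems and Thomas decompositions -/

/-- An algebraic system: finitely many equations `p = 0` and inequations `q ≠ 0`. -/
structure AlgSystem (σ : Type*) where
  eqs : Finset (MvPolynomial σ ℂ)
  ineqs : Finset (MvPolynomial σ ℂ)

section Systems

variable {σ : Type*}

/-- `v` is the leader of the non-constant polynomial `p` with respect to the total order `lt`,
i.e. the greatest variable that appears in `p`. Constant polynomials have no leader. -/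
def IsLeader (lt : σ → σ → Prop) (p : MvPolynomial σ ℂ) (v : σ) : Prop :=
  v ∈ p.vars ∧ ∀ w ∈ p.vars, w ≠ v → lt w v

open Classical in
/-- The coefficient of the highest power of the variable `v` in `p`; this is the initial of `p`
if `v` is the leader of `p`. -/
def initialAt (p : MvPolynomial σ ℂ) (v : σ) : MvPolynomial σ ℂ :=
  ∑ s ∈ p.support with s v = p.degreeOf v, monomial (s.erase v) (p.coeff s)

/-- The solution set of an algebraic system. -/
def AlgSystem.sol (T : AlgSystem σ) : Set (σ → ℂ) :=
  {a | (∀ p ∈ T.eqs, eval a p = 0) ∧ ∀ q ∈ T.ineqs, eval a q ≠ 0}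

/-- The solution set of the subsystem `T_{<v}` of those equations and inequations of `T` whose
leader is less than `v`. -/
def AlgSystem.solBelow (lt : σ → σ → Prop) (T : AlgSystem σ) (v : σ) : Set (σ → ℂ) :=
  {a | (∀ p ∈ T.eqs, ∀ w, IsLeader lt p w → lt w v → eval a p = 0) ∧
    ∀ q ∈ T.ineqs, ∀ w, IsLeader lt q w → lt w v → eval a q ≠ 0}

/-- Simple algebraic systems with respect to the total order `lt` of the variables. The last two
conditions say that for every `r` in `T` with leader `v` and every solution of `T_{<v}`, the
univariate polynomial in `v` obtained from `r` by substituting that solution has the same degree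
in `v` as `r` and is square-free. -/
structure AlgSystem.IsSimple (lt : σ → σ → Prop) (T : AlgSystem σ) : Prop where
  nonconstant : ∀ r, r ∈ T.eqs ∨ r ∈ T.ineqs → ∃ v, IsLeader lt r v
  disjoint : Disjoint T.eqs T.ineqs
  triangular : ∀ r r', r ∈ T.eqs ∨ r ∈ T.ineqs → r' ∈ T.eqs ∨ r' ∈ T.ineqs →
    ∀ v, IsLeader lt r v → IsLeader lt r' v → r = r'
  initial_ne_zero : ∀ r, r ∈ T.eqs ∨ r ∈ T.ineqs → ∀ v, IsLeader lt r v →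
    ∀ a ∈ T.solBelow lt v, eval a (initialAt r v) ≠ 0
  squarefree : ∀ r, r ∈ T.eqs ∨ r ∈ T.ineqs → ∀ v, IsLeader lt r v →
    ∀ a ∈ T.solBelow lt v, eval a r = 0 → eval a (pderiv v r) ≠ 0

/-- `L` is an algebraic Thomas decomposition of `T` with respect to `lt`. -/
def IsThomasDecomposition (lt : σ → σ → Prop) (T : AlgSystem σ) (L : List (AlgSystem σ)) :
    Prop :=
  (∀ T' ∈ L, T'.IsSimple lt) ∧ L.Pairwise (fun A B => Disjoint A.sol B.sol) ∧
    T.sol = {a | ∃ T' ∈ L, a ∈ T'.sol}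

end Systems

/-! ### The extended polynomial ring and the admissible orders -/

/-- The variables of `𝒟_ℓ^ex = 𝒟_ℓ[a, b, c, d]`. -/
inductive ExVar (n m ℓ : ℕ) : Type
  | jet (v : JetVar n m ℓ)
  | a (i : Fin n)
  | b (α : Fin m) (μ : TopIdx n ℓ)
  | c (α : Fin m) (μ : MultiIdx n ℓ)
  | d (i : Fin n)

/-- The ring `𝒟_ℓ^ex`. -/
abbrev ExRing (n m ℓ : ℕ) : Type := MvPolynomial (ExVar n m ℓ) ℂ

theorem ExVar.jet_injective (n m ℓ : ℕ) :
    Function.Injective (ExVar.jet : JetVar n m ℓ → ExVar n m ℓ) := by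
  intro v w h
  cases h
  rfl

/-- The inclusion of `𝒟_ℓ` into `𝒟_ℓ^ex`. -/
def toEx {n m ℓ : ℕ} : JetRing n m ℓ →ₐ[ℂ] ExRing n m ℓ := rename ExVar.jet

theorem toEx_injective (n m ℓ : ℕ) :
    Function.Injective (toEx : JetRing n m ℓ →ₐ[ℂ] ExRing n m ℓ) :=
  rename_injective _ (ExVar.jet_injective n m ℓ)

/-- The position of the block of a variable in `x < u < a < b < c < d`. -/
def ExVar.block {n m ℓ : ℕ} : ExVar n m ℓ → ℕ
  | .jet (Sum.inl _) => 0
  | .jet (Sum.inr _) => 1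
  | .a _ => 2
  | .b _ _ => 3
  | .c _ _ => 4
  | .d _ => 5

/-- An orderly ranking of the jet variables `u^α_μ` of all orders. -/
structure IsOrderlyRanking {n m : ℕ}
    (R : Fin m × (Fin n → ℕ) → Fin m × (Fin n → ℕ) → Prop) : Prop where
  total : IsStrictTotalOrder _ R
  deriv : ∀ α i, R (α, 0) (α, Pi.single i 1)
  compat : ∀ α μ β ν i, R (α, μ) (β, ν) → R (α, μ + Pi.single i 1) (β, ν + Pi.single i 1)
  orderly : ∀ α μ β ν, ∑ j, μ j < ∑ j, ν j → R (α, μ) (β, ν)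

/-- The total orders allowed for the Thomas decomposition: `d > c > b > a > u > x`, an orderly
ranking on the variables `u`, and the same order among the `b` and among the `c` as among the
corresponding `u`. -/
structure IsAdmissibleOrder {n m ℓ : ℕ} (lt : ExVar n m ℓ → ExVar n m ℓ → Prop) : Prop where
  total : IsStrictTotalOrder _ lt
  blocks : ∀ v w : ExVar n m ℓ, v.block < w.block → lt v w
  orderly : ∃ R : Fin m × (Fin n → ℕ) → Fin m × (Fin n → ℕ) → Prop, IsOrderlyRanking R ∧
    ∀ α μ β ν, lt (.jet (Sum.inr (α, μ))) (.jet (Sum.inr (β, ν))) ↔ R (α, μ.1) (β, ν.1)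
  b_order : ∀ α μ β ν,
    lt (.b α μ) (.b β ν) ↔ lt (.jet (Sum.inr (α, μ.1))) (.jet (Sum.inr (β, ν.1)))
  c_order : ∀ α μ β ν,
    lt (.c α μ) (.c β ν) ↔ lt (.jet (Sum.inr (α, μ))) (.jet (Sum.inr (β, ν)))

/-- `V(p) = ∑_i a^i C_i^{(ℓ)}(p) + ∑_{|μ| = ℓ} ∑_α b^α_μ C^μ_α(p)`. -/
def vessiotForm {n m ℓ : ℕ} (p : JetRing n m ℓ) : ExRing n m ℓ :=
  ∑ i : Fin n, X (.a i) * toEx (contactDeriv i p) +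
    ∑ μ : TopIdx n ℓ, ∑ α : Fin m, X (.b α μ) * toEx (pderiv (Sum.inr (α, μ.1)) p)

/-- `J(p) = ∑_μ ∑_α c^α_μ ∂p/∂u^α_μ + ∑_i d^i ∂p/∂x^i`. -/
def jacobianForm {n m ℓ : ℕ} (p : JetRing n m ℓ) : ExRing n m ℓ :=
  ∑ μ : MultiIdx n ℓ, ∑ α : Fin m, X (.c α μ) * toEx (pderiv (Sum.inr (α, μ)) p) +
    ∑ i : Fin n, X (.d i) * toEx (pderiv (Sum.inl i) p)

open Classical in
/-- The algebraic system `J(p) = 0, V(p) = 0, p = 0`, where `p` ranges over `G`. -/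
def determiningSystem {n m ℓ : ℕ} (G : Finset (JetRing n m ℓ)) : AlgSystem (ExVar n m ℓ) where
  eqs := G.image jacobianForm ∪ G.image vessiotForm ∪ G.image toEx
  ineqs := ∅

/-- The order of the variables of `𝒟_ℓ` induced by an order of the variables of `𝒟_ℓ^ex`. -/
def restrictOrder {n m ℓ : ℕ} (lt : ExVar n m ℓ → ExVar n m ℓ → Prop)
    (v w : JetVar n m ℓ) : Prop :=
  lt (.jet v) (.jet w)

/-- The subsystem of those equations and inequations that lie in `𝒟_ℓ`. -/
def projectSystem {n m ℓ : ℕ} (T : AlgSystem (ExVar n m ℓ)) : AlgSystem (JetVar n m ℓ) where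
  eqs := T.eqs.preimage toEx (toEx_injective n m ℓ).injOn
  ineqs := T.ineqs.preimage toEx (toEx_injective n m ℓ).injOn

/-- No inequation of `T` has its leader among the auxiliary variables `a, b, c, d`. -/
def NoAuxInequations {n m ℓ : ℕ} (lt : ExVar n m ℓ → ExVar n m ℓ → Prop)
    (T : AlgSystem (ExVar n m ℓ)) : Prop :=
  ∀ q ∈ T.ineqs, ∀ v, IsLeader lt q v → v.block ≤ 1

/-- The number of equations of `T` with leader among the variables `c, d`. -/
def jacobianRank {n m ℓ : ℕ} (lt : ExVar n m ℓ → ExVar n m ℓ → Prop)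
    (T : AlgSystem (ExVar n m ℓ)) : ℕ :=
  Set.ncard {p | p ∈ T.eqs ∧ ∃ v, IsLeader lt p v ∧ 4 ≤ v.block}

/-! ### The algorithm -/

/-- A system in the output, with the mark telling whether the algorithm assigns its solution
set to the algebraic singularities (`singular`) or to the regularity components. -/
structure OutputSystem (n m ℓ : ℕ) where
  system : AlgSystem (JetVar n m ℓ)
  singular : Prop

/-- The output obtained from `T = S_{k,i}^ex`, where `G` generates the prime component: the
system is marked as singular if fewer than `codim Sol(G)` equations of `T` have their leader
among the variables `c, d`. -/
def outputOf {n m ℓ : ℕ} (lt : ExVar n m ℓ → ExVar n m ℓ → Prop) (G : Finset (JetRing n m ℓ))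
    (T : AlgSystem (ExVar n m ℓ)) : OutputSystem n m ℓ where
  system := projectSystem T
  singular := (jacobianRank lt T : WithBot ℕ∞) +
      ringKrullDim (JetRing n m ℓ ⧸ Ideal.span (G : Set (JetRing n m ℓ))) <
    (Fintype.card (JetVar n m ℓ) : WithBot ℕ∞)

/-- The output of the algorithm: for each prime component, a generating set of it together with
a list of simple systems. -/
abbrev Output (n m ℓ : ℕ) : Type :=
  List (Finset (JetRing n m ℓ) × List (OutputSystem n m ℓ))

/-- The states of an execution of the algorithm. -/
inductive State (n m ℓ : ℕ) : Type
  /-- before the first line -/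
  | start
  /-- after a generating set of `ℐ_ℓ(S)` has been computed -/
  | generated (G : Finset (JetRing n m ℓ))
  /-- inside the loop over the prime components: the components still to be treated, and those
  already treated together with the Thomas decompositions obtained for them -/
  | loop (todo : List (Finset (JetRing n m ℓ)))
      (done : List (Finset (JetRing n m ℓ) × List (AlgSystem (ExVar n m ℓ))))
  /-- after the last line -/
  | returned (out : Output n m ℓ)

/-- The finite sets in the list `Gs` generate the minimal primes of `I`, each of them once. -/
def IsPrimeDecomposition {R : Type*} [CommRing R] (I : Ideal R) (Gs : List (Finset R)) : Prop :=
  (Gs.map fun G => Ideal.span (G : Set R)).Nodup ∧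
    ∀ P : Ideal R, P ∈ I.minimalPrimes ↔ ∃ G ∈ Gs, Ideal.span (G : Set R) = P

/-- One step of the algorithm applied to the differential system `S` in order `ℓ`. Each of the
first three kinds of steps is a call of a subalgorithm (ideal generators, prime decomposition,
algebraic Thomas decomposition), which may return any result that meets its specification. -/
inductive Step {n m ℓ : ℕ} (S : DiffSystem n m) (lt : ExVar n m ℓ → ExVar n m ℓ → Prop) :
    State n m ℓ → State n m ℓ → Prop
  | generators (G : Finset (JetRing n m ℓ))
      (hG : Ideal.span (G : Set (JetRing n m ℓ)) = jetIdeal S ℓ) :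
      Step S lt .start (.generated G)
  | primes (G : Finset (JetRing n m ℓ)) (Gs : List (Finset (JetRing n m ℓ)))
      (hGs : IsPrimeDecomposition (Ideal.span (G : Set (JetRing n m ℓ))) Gs) :
      Step S lt (.generated G) (.loop Gs [])
  | thomas (G : Finset (JetRing n m ℓ)) (todo : List (Finset (JetRing n m ℓ)))
      (done : List (Finset (JetRing n m ℓ) × List (AlgSystem (ExVar n m ℓ))))
      (L : List (AlgSystem (ExVar n m ℓ)))
      (hL : IsThomasDecomposition lt (determiningSystem G) L)
      (hgood : ∀ T ∈ L, NoAuxInequations lt T) :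
      Step S lt (.loop (G :: todo) done) (.loop todo (done ++ [(G, L)]))
  | output (done : List (Finset (JetRing n m ℓ) × List (AlgSystem (ExVar n m ℓ)))) :
      Step S lt (.loop [] done)
        (.returned (done.map fun e => (e.1, e.2.map (outputOf lt e.1))))

/-- `s` is reached in some execution of the algorithm. -/
def Reachable {n m ℓ : ℕ} (S : DiffSystem n m) (lt : ExVar n m ℓ → ExVar n m ℓ → Prop)
    (s : State n m ℓ) : Prop :=
  Relation.ReflTransGen (Step S lt) .start s

/-- The algorithm terminates: there is no infinite execution, and no execution gets stuck before
an output has been returned. -/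
def Terminates {n m ℓ : ℕ} (S : DiffSystem n m) (lt : ExVar n m ℓ → ExVar n m ℓ → Prop) :
    Prop :=
  (¬ ∃ f : ℕ → State n m ℓ, f 0 = .start ∧ ∀ k, Step S lt (f k) (f (k + 1))) ∧
    ∀ s, Reachable S lt s → (∃ out, s = .returned out) ∨ ∃ s', Step S lt s s'

open Classical in
/-- The list `L` of systems is a correct output for the variety `V`, with respect to the total
order `lt` of the jet coordinates. -/
structure IsCorrectFor {n m ℓ : ℕ} (lt : JetVar n m ℓ → JetVar n m ℓ → Prop)
    (V : Set (JetSpace n m ℓ)) (L : List (OutputSystem n m ℓ)) : Prop where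
  simple : ∀ O ∈ L, O.system.IsSimple lt
  disjoint : L.Pairwise fun O O' => Disjoint O.system.sol O'.system.sol
  union : V = {ρ | ∃ O ∈ L, ρ ∈ O.system.sol}
  singular : ∀ O ∈ L, O.singular → O.system.sol ⊆ algSing V
  regular : ∀ O ∈ L, ¬ O.singular → IsRegularJetSetIn V O.system.sol
  algSing_eq : algSing V = {ρ | ∃ O ∈ L, O.singular ∧ ρ ∈ O.system.sol}
  decomposition : IsRegularityDecomposition V
    ((L.filter fun O => decide (¬ O.singular)).map fun O => O.system.sol)

/-- The output `out` is correct: its entries correspond to the prime components of `ℐ_ℓ(S)`, and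
for each of them it provides a regularity decomposition of the variety of that component. -/
structure IsCorrectOutput {n m ℓ : ℕ} (S : DiffSystem n m)
    (lt : ExVar n m ℓ → ExVar n m ℓ → Prop) (out : Output n m ℓ) : Prop where
  components : IsPrimeDecomposition (jetIdeal S ℓ) (out.map Prod.fst)
  correct : ∀ e ∈ out, IsCorrectFor (restrictOrder lt)
    (zeroLocus ℂ (Ideal.span (e.1 : Set (JetRing n m ℓ)))) e.2

end RegDec

end

/-!
The algorithm passes through three kinds of subalgorithm calls, so it terminates as soon as
results of these calls exist. Finite generating sets and prime decompositions exist because the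
rings are Noetherian. For the Thomas decompositions, `constructible_induction` reduces the task to
a dense open part of an irreducible variety in the lower variables. Over such a part, a system in
one further variable is solved by all values, by none, or amounts to a single square-free equation
or inequation (`exists_generic_univariate`), and a linear system can be brought to echelon form
(`isDecomposable_of_linear`). Echelon forms need no inequations for the variables in which the
system is linear. The determining system is linear in the auxiliary variables `a, b, c, d`, and
this gives a decomposition of the required kind (`exists_isThomasDecomposition`).

For the correctness, let `V` be the variety of a prime component. The solutions of the determining
system over a point `ρ` of `V` form a linear space, which splits into the Vessiot space (unknowns
`a, b`) and the tangent space (unknowns `c, d`) of `V` at `ρ` (`finrank_auxSpaceFrom_eq`). As the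
systems of the Thomas decomposition have no inequations for the auxiliary variables, each of them
cuts out a closed subset of this fibre. The fibre is irreducible, so one system contains all of it
and the others none of it (`IsThomasDecomposition.fibre_subset_sol`). Hence the projections of the
systems to the jet variables are disjoint with union `V`.

It also follows that the positions of the first non-zero coordinates of the vectors in the fibre
are exactly the auxiliary variables that are not leaders of equations
(`IsThomasDecomposition.pivots_auxSpaceFrom`). Counting them block by block gives the dimensions of
the tangent, Vessiot and symbol spaces, which are therefore constant on the solution set of each
projected system. Kernels of constant dimension of a matrix of polynomials form a vector bundle
(`isVectorBundleOver_of_finrank_eq`), and the solution set of a simple system is a manifold because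
the differentials of its equations are linearly independent
(`AlgSystem.IsSimple.isComplexSubmanifold_sol`). The number of leaders among `c, d` is the
codimension of the tangent space. Since the dimension of an irreducible variety is at most that of
its tangent spaces (`ringKrullDim_quotient_le_finrank_tangentSpace`), this number is less than the
codimension of `V` exactly at the singular points (`IsThomasDecomposition.singular_outputOf_iff`).
-/

open MvPolynomial

noncomputable section

namespace RegDec

/-! ### Heights, Jacobian determinants and tangent spaces -/

/-- The easy inequality between height and dimension, valid in every ring. -/
theorem height_add_ringKrullDim_quotient_le {R : Type*} [CommRing R] (P : Ideal R)
    [hP : P.IsPrime] : (P.height : WithBot ℕ∞) + ringKrullDim (R ⧸ P) ≤ ringKrullDim R := by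
  let x : PrimeSpectrum R := ⟨P, hP⟩
  have : Nonempty (PrimeSpectrum R) := ⟨x⟩
  have h1 : P.height = Order.height x := PrimeSpectrum.height_eq_orderHeight x
  have h2 : ringKrullDim (R ⧸ P) = (Order.coheight x : WithBot ℕ∞) := by
    rw [ringKrullDim_quotient, Order.coheight_eq_krullDim_Ici]
    have : PrimeSpectrum.zeroLocus (P : Set R) = Set.Ici x := by
      ext y
      simp only [PrimeSpectrum.mem_zeroLocus, Set.mem_Ici, SetLike.coe_subset_coe]
      rfl
    rw [this]
  rw [h1, h2, ringKrullDim, Order.krullDim_eq_iSup_height_add_coheight_of_nonempty]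
  exact_mod_cast le_iSup (fun a : PrimeSpectrum R => Order.height a + Order.coheight a) x

/-- A prime ideal of a regular ring that contains `r` elements whose Jacobian determinant with
respect to some `r` derivations lies outside the prime has height at least `r`: by regularity the
localization at the prime has a maximal ideal generated by as many elements as the height says,
and expressing the given elements through these bounds the rank of the Jacobian matrix modulo
the prime. -/
theorem le_height_of_jacobian_det_notMem {R : Type*} [CommRing R] [IsRegularRing R]
    (P : Ideal R) [hP : P.IsPrime] {r : ℕ} (p : Fin r → R) (hp : ∀ i, p i ∈ P)
    (D : Fin r → R →+ R) (hD : ∀ k x y, D k (x * y) = x * D k y + y * D k x)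
    (hdet : (Matrix.of fun i k => D k (p i)).det ∉ P) : (r : ℕ∞) ≤ P.height := by
  let A := Localization.AtPrime P
  let m := IsLocalRing.maximalIdeal A
  have hreg : (m.spanFinrank : WithBot ℕ∞) = (P.height : WithBot ℕ∞) := by
    rw [← IsLocalization.AtPrime.ringKrullDim_eq_height P A]
    exact IsRegularLocalRing.spanFinrank_maximalIdeal
  have hfg : m.FG := (isNoetherianRing_iff_ideal_fg A).mp inferInstance m
  have hfin : m.generators.Finite := Submodule.FG.finite_generators hfg
  have hcard : m.generators.ncard = m.spanFinrank := Submodule.FG.generators_ncard hfg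
  have : Fintype m.generators := hfin.fintype
  have hs : Fintype.card m.generators = m.spanFinrank := by
    rw [← hcard, Set.ncard_eq_toFinset_card', Set.toFinset_card]
  -- numerators of the generators of the maximal ideal
  have hnum : ∀ a : m.generators, ∃ g : R, ∃ t : P.primeCompl,
      algebraMap R A g = a.1 * algebraMap R A t := by
    intro a
    obtain ⟨⟨g, t⟩, h⟩ := IsLocalization.surj P.primeCompl a.1
    exact ⟨g, t, h.symm⟩
  choose g t hgt using hnum
  have hgP : ∀ a, g a ∈ P := by
    intro a
    have : algebraMap R A (g a) ∈ m := by
      rw [hgt]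
      refine Ideal.mul_mem_right _ _ ?_
      have := Submodule.subset_span (R := A) a.2
      rwa [Submodule.span_generators] at this
    exact (IsLocalization.AtPrime.to_map_mem_maximal_iff A P _).mp this
  have hspan : m ≤ Ideal.map (algebraMap R A) (Ideal.span (Set.range g)) := by
    refine (Submodule.span_generators m).symm.le.trans (Submodule.span_le.mpr ?_)
    intro a ha
    have hu : IsUnit (algebraMap R A (t ⟨a, ha⟩)) := IsLocalization.map_units A (t ⟨a, ha⟩)
    have h1 : algebraMap R A (g ⟨a, ha⟩) ∈ Ideal.map (algebraMap R A) (Ideal.span (Set.range g)) :=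
      Ideal.mem_map_of_mem _ (Ideal.subset_span ⟨_, rfl⟩)
    rw [hgt] at h1
    exact (Ideal.mul_unit_mem_iff_mem _ hu).mp h1
  have hexp : ∀ i, ∃ f : R, f ∉ P ∧ ∃ c : m.generators → R, ∑ j, c j * g j = f * p i := by
    intro i
    have h1 : algebraMap R A (p i) ∈ Ideal.map (algebraMap R A) (Ideal.span (Set.range g)) :=
      hspan ((IsLocalization.AtPrime.to_map_mem_maximal_iff A P _).mpr (hp i))
    rw [IsLocalization.mem_map_algebraMap_iff P.primeCompl] at h1
    obtain ⟨⟨⟨y, hy⟩, f⟩, h⟩ := h1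
    rw [← map_mul, IsLocalization.eq_iff_exists P.primeCompl] at h
    obtain ⟨f', hf'⟩ := h
    refine ⟨f' * f, fun hmem => (hP.mem_or_mem hmem).elim f'.2 f.2, ?_⟩
    obtain ⟨c, hc⟩ := Ideal.mem_span_range_iff_exists_fun.mp hy
    refine ⟨fun j => f' * c j, ?_⟩
    simp only [mul_assoc, ← Finset.mul_sum, hc]
    simp only at hf'
    rw [← hf']
    ring
  choose f hf c hc using hexp
  -- differentiate modulo `P` and compare ranks over the residue field
  let K := FractionRing (R ⧸ P)
  let φ : R →+* K := (algebraMap (R ⧸ P) K).comp (Ideal.Quotient.mk P)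
  have hφ : ∀ x, φ x = 0 ↔ x ∈ P := by
    intro x
    simp only [φ, RingHom.comp_apply, FaithfulSMul.algebraMap_eq_zero_iff,
      Ideal.Quotient.eq_zero_iff_mem]
  have key : ∀ i k, φ (f i) * φ (D k (p i)) = ∑ j, φ (c i j) * φ (D k (g j)) := by
    intro i k
    have h := congrArg (fun x => φ (D k x)) (hc i)
    simp only [map_sum, hD, map_add, map_mul,
      (hφ _).mpr (hgP _), (hφ _).mpr (hp _), zero_mul, add_zero] at h
    exact h.symm
  have hM : Matrix.diagonal (fun i => φ (f i)) * Matrix.of (fun i k => φ (D k (p i))) =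
      Matrix.of (fun i j => φ (c i j)) * Matrix.of (fun j k => φ (D k (g j))) := by
    ext i k
    rw [Matrix.diagonal_mul, Matrix.mul_apply]
    exact key i k
  have hdet' : (Matrix.diagonal (fun i => φ (f i)) *
      Matrix.of (fun i k => φ (D k (p i)))).det ≠ 0 := by
    rw [Matrix.det_mul, Matrix.det_diagonal]
    refine mul_ne_zero (Finset.prod_ne_zero_iff.mpr fun i _ => mt (hφ _).mp (hf i)) ?_
    have : Matrix.of (fun i k => φ (D k (p i))) = φ.mapMatrix (Matrix.of fun i k => D k (p i)) := by
      ext; rfl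
    rw [this, ← RingHom.map_det]
    exact mt (hφ _).mp hdet
  have hrank := Matrix.rank_of_isUnit _ ((Matrix.isUnit_iff_isUnit_det _).mpr hdet'.isUnit)
  rw [hM, Fintype.card_fin] at hrank
  have hle := (Matrix.rank_mul_le_left (Matrix.of (fun i j => φ (c i j)))
    (Matrix.of (fun j k => φ (D k (g j))))).trans (Matrix.rank_le_card_width _)
  rw [hrank, hs] at hle
  have : ((m.spanFinrank : ℕ∞)) = P.height := by exact_mod_cast hreg
  rw [← this]
  exact_mod_cast hle

section Tangent
variable {σ : Type*} [Fintype σ]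

theorem mem_zeroLocus_iff_eval {τ : Type*} {I : Ideal (MvPolynomial τ ℂ)} {ρ : τ → ℂ} :
    ρ ∈ zeroLocus ℂ I ↔ ∀ p ∈ I, eval ρ p = 0 := by
  simp only [mem_zeroLocus_iff, aeval_eq_eval]

/-- The differential of a polynomial at a point, as a linear form in tangent vectors. -/
def differentialAt (ρ : σ → ℂ) : MvPolynomial σ ℂ →ₗ[ℂ] Module.Dual ℂ (σ → ℂ) where
  toFun p := ∑ w, eval ρ (pderiv w p) • LinearMap.proj w
  map_add' p q := by simp [add_smul, Finset.sum_add_distrib]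
  map_smul' c p := by simp [smul_eval, mul_smul, Finset.smul_sum]

theorem differentialAt_apply (ρ : σ → ℂ) (p : MvPolynomial σ ℂ) (v : σ → ℂ) :
    differentialAt ρ p v = ∑ w, eval ρ (pderiv w p) * v w := by
  simp [differentialAt]

theorem mem_tangentSpace_zeroLocus (P : Ideal (MvPolynomial σ ℂ)) [P.IsPrime] (ρ v : σ → ℂ) :
    v ∈ tangentSpace (zeroLocus ℂ P) ρ ↔ ∀ p ∈ P, differentialAt ρ p v = 0 := by
  simp only [differentialAt_apply]
  conv_rhs => rw [← IsPrime.vanishingIdeal_zeroLocus (K := ℂ) P]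
  rfl

/-- The tangent space is cut out by the differentials of generators of a prime ideal. -/
theorem mem_tangentSpace_zeroLocus_span (G : Set (MvPolynomial σ ℂ)) [(Ideal.span G).IsPrime]
    {ρ : σ → ℂ} (hρ : ρ ∈ zeroLocus ℂ (Ideal.span G)) (v : σ → ℂ) :
    v ∈ tangentSpace (zeroLocus ℂ (Ideal.span G)) ρ ↔ ∀ p ∈ G, differentialAt ρ p v = 0 := by
  rw [mem_tangentSpace_zeroLocus]
  refine ⟨fun h p hp => h p (Ideal.subset_span hp), fun h p hp => ?_⟩
  induction hp using Submodule.span_induction with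
  | mem p hp => exact h p hp
  | zero => simp
  | add p q _ _ hp hq => simp [hp, hq]
  | smul c p hpG hp =>
    have h0 : eval ρ p = 0 := mem_zeroLocus_iff_eval.mp hρ p hpG
    rw [differentialAt_apply] at hp ⊢
    simp only [smul_eq_mul, Derivation.leibniz, map_add, map_mul, h0, zero_mul, add_zero,
      mul_assoc, ← Finset.mul_sum, hp, mul_zero]

/-- The dimension of an irreducible variety is at most that of each of its tangent spaces. -/
theorem ringKrullDim_quotient_le_finrank_tangentSpace (P : Ideal (MvPolynomial σ ℂ))
    [hP : P.IsPrime] {ρ : σ → ℂ} (hρ : ρ ∈ zeroLocus ℂ P) :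
    ringKrullDim (MvPolynomial σ ℂ ⧸ P) ≤
      ((Module.finrank ℂ (tangentSpace (zeroLocus ℂ P) ρ) : ℕ) : WithBot ℕ∞) := by
  let _ := Classical.decEq σ
  let W : Submodule ℂ (Module.Dual ℂ (σ → ℂ)) :=
    (P.restrictScalars ℂ).map (differentialAt ρ)
  have hW : W.dualCoannihilator = tangentSpace (zeroLocus ℂ P) ρ := by
    ext v
    rw [mem_tangentSpace_zeroLocus, Submodule.mem_dualCoannihilator]
    simp [W]
  have hfr := Subspace.finrank_add_finrank_dualCoannihilator_eq W
  rw [hW, Module.finrank_fintype_fun_eq_card] at hfr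
  set r := Module.finrank ℂ W with hr
  let b := Module.finBasis ℂ W
  have hb : ∀ i, ∃ p ∈ P, differentialAt ρ p = (b i : Module.Dual ℂ (σ → ℂ)) := by
    intro i
    obtain ⟨p, hp, h⟩ := Submodule.mem_map.mp (b i).2
    exact ⟨p, hp, h⟩
  choose p hp hpb using hb
  -- vectors dual to the independent differentials of the `p i`
  let J : Matrix (Fin r) σ ℂ := Matrix.of fun i w => eval ρ (pderiv w (p i))
  have hli : LinearIndependent ℂ J.row := by
    have h1 : LinearIndependent ℂ fun i => ((b i : W) : Module.Dual ℂ (σ → ℂ)) :=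
      b.linearIndependent.map' W.subtype (Submodule.ker_subtype W)
    rw [Fintype.linearIndependent_iff] at h1 ⊢
    intro c hc
    refine h1 c ?_
    refine LinearMap.pi_ext' fun w => LinearMap.ext_ring ?_
    have h2 := congrFun hc w
    simp only [Finset.sum_apply, Pi.smul_apply, smul_eq_mul, Pi.zero_apply] at h2
    simp only [← hpb, LinearMap.comp_apply, LinearMap.zero_apply, LinearMap.single_apply,
      LinearMap.sum_apply, LinearMap.smul_apply, differentialAt_apply, smul_eq_mul,
      Pi.single_apply, mul_ite, mul_one, mul_zero, Finset.sum_ite_eq', Finset.mem_univ, if_true]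
    exact h2
  obtain ⟨U, hU⟩ : ∃ U : Matrix σ (Fin r) ℂ, J * U = 1 := by
    rw [← Matrix.mulVec_surjective_iff_exists_right_inverse]
    have h1 : J.rank = r := by rw [hli.rank_matrix, Fintype.card_fin]
    have h2 : LinearMap.range J.mulVecLin = ⊤ := by
      apply Submodule.eq_top_of_finrank_eq
      rw [Module.finrank_fin_fun]
      exact h1
    exact LinearMap.range_eq_top.mp h2
  let D : Fin r → MvPolynomial σ ℂ →+ MvPolynomial σ ℂ := fun k =>
    AddMonoidHom.mk' (fun q => ∑ w, C (U w k) * pderiv w q) fun p q => by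
      simp only [map_add, mul_add, Finset.sum_add_distrib]
  have hleib : ∀ k x y, D k (x * y) = x * D k y + y * D k x := by
    intro k x y
    simp only [D, AddMonoidHom.mk'_apply, Derivation.leibniz, smul_eq_mul, Finset.mul_sum,
      ← Finset.sum_add_distrib]
    exact Finset.sum_congr rfl fun w _ => by ring
  have hD : ∀ i k, eval ρ (D k (p i)) = (1 : Matrix (Fin r) (Fin r) ℂ) i k := by
    intro i k
    rw [← hU, Matrix.mul_apply]
    simp only [D, AddMonoidHom.mk'_apply, map_sum]
    refine Finset.sum_congr rfl fun w _ => ?_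
    simp [J, mul_comm]
  have hht : (r : ℕ∞) ≤ P.height := by
    refine le_height_of_jacobian_det_notMem P p hp D hleib fun hmem => ?_
    have h0 := mem_zeroLocus_iff_eval.mp hρ _ hmem
    rw [RingHom.map_det] at h0
    have h1 : (eval ρ).mapMatrix (Matrix.of fun i k => D k (p i)) = 1 := by
      ext i k
      exact hD i k
    rw [h1, Matrix.det_one] at h0
    exact one_ne_zero h0
  have hdim := height_add_ringKrullDim_quotient_le P
  rw [MvPolynomial.ringKrullDim_of_isNoetherianRing, ringKrullDim_eq_zero_of_field, zero_add,
    Nat.card_eq_fintype_card, ← hfr] at hdim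
  have h2 : ((r : ℕ) : WithBot ℕ∞) + ringKrullDim (MvPolynomial σ ℂ ⧸ P) ≤
      ((r : ℕ) : WithBot ℕ∞) +
        ((Module.finrank ℂ (tangentSpace (zeroLocus ℂ P) ρ) : ℕ) : WithBot ℕ∞) := by
    refine le_trans (add_le_add_left ?_ _) (hdim.trans ?_)
    · exact_mod_cast hht
    · push_cast
      exact le_rfl
  generalize ringKrullDim (MvPolynomial σ ℂ ⧸ P) = d at h2
  generalize Module.finrank ℂ (tangentSpace (zeroLocus ℂ P) ρ) = e at h2
  induction d using WithBot.recBotCoe with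
  | bot => exact bot_le
  | coe d =>
    have h3 : ((r : ℕ∞) + d : ℕ∞) ≤ (r : ℕ∞) + (e : ℕ∞) := by exact_mod_cast h2
    have h4 : d ≤ (e : ℕ∞) := (ENat.add_le_add_iff_left (ENat.natCast_ne_top r)).mp h3
    exact_mod_cast h4

end Tangent

/-! ### Solution spaces of linear systems as vector bundles -/

section Bundles
variable {σ : Type*} [Fintype σ]

theorem hasFDerivAt_eval (p : MvPolynomial σ ℂ) (ρ : σ → ℂ) :
    HasFDerivAt (fun x : σ → ℂ => eval x p) (differentialAt ρ p).toContinuousLinearMap ρ := by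
  induction p using MvPolynomial.induction_on with
  | C a =>
    have h : (differentialAt ρ (C a)).toContinuousLinearMap = 0 := by
      ext v; simp [differentialAt_apply]
    rw [h]
    simpa using hasFDerivAt_const a ρ
  | add p q hp hq =>
    simp only [map_add]
    exact hp.add hq
  | mul_X p i hp =>
    have h := hp.mul (hasFDerivAt_apply (𝕜 := ℂ) i ρ)
    simp only [map_mul, eval_X]
    refine h.congr_fderiv ?_
    let _ := Classical.decEq σ
    ext v
    simp only [add_apply, smul_apply, smul_eq_mul,
      ContinuousLinearMap.proj_apply, LinearMap.coe_toContinuousLinearMap', differentialAt_apply,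
      Derivation.leibniz, map_add, map_mul, eval_X, pderiv_X, add_mul, Finset.sum_add_distrib]
    congr 1
    · simp [Pi.single_apply, apply_ite, Finset.sum_ite_eq]
    · rw [Finset.mul_sum]
      exact Finset.sum_congr rfl fun w _ => by ring

theorem differentiable_eval (p : MvPolynomial σ ℂ) :
    Differentiable ℂ (fun x : σ → ℂ => eval x p) :=
  fun ρ => (hasFDerivAt_eval p ρ).differentiableAt

theorem exists_generalized_inverse {E F : Type*} [AddCommGroup E] [Module ℂ E] [AddCommGroup F]
    [Module ℂ F] (M : E →ₗ[ℂ] F) : ∃ A : F →ₗ[ℂ] E, ∀ x, M (A (M x)) = M x := by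
  obtain ⟨s, hs⟩ := M.rangeRestrict.exists_rightInverse_of_surjective M.range_rangeRestrict
  obtain ⟨A, hA⟩ := LinearMap.exists_extend s
  refine ⟨A, fun x => ?_⟩
  have h1 : A (M x) = s (M.rangeRestrict x) := LinearMap.congr_fun hA (M.rangeRestrict x)
  have h2 := LinearMap.congr_fun hs (M.rangeRestrict x)
  rw [h1]
  exact congrArg Subtype.val h2

/-- The solution spaces of a linear system with polynomial coefficients form a vector bundle over
every set on which their dimension is constant. Near a point `ρ₀` the system is compared with its
value `M₀` at `ρ₀` through the operators `1 - A M₀ + A M(ρ)`, where `A` is a generalized inverse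
of `M₀`: they carry the kernel of `M(ρ)` into the kernel of `M₀` and are invertible near `ρ₀`. -/
theorem isVectorBundleOver_of_finrank_eq {κ : Type*} [Fintype κ]
    (c : κ → σ → MvPolynomial σ ℂ) (Z : Set (σ → ℂ)) (F : (σ → ℂ) → Submodule ℂ (σ → ℂ))
    (hF : ∀ ρ ∈ Z, ∀ v, v ∈ F ρ ↔ ∀ j, ∑ w, eval ρ (c j w) * v w = 0)
    (r : ℕ) (hr : ∀ ρ ∈ Z, Module.finrank ℂ (F ρ) = r) : IsVectorBundleOver Z F := by
  let _ := Classical.decEq κ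
  refine ⟨r, fun ρ₀ hρ₀ => ?_⟩
  let M : (σ → ℂ) → (σ → ℂ) →ₗ[ℂ] (κ → ℂ) := fun ρ =>
    LinearMap.pi fun j => ∑ w, eval ρ (c j w) • LinearMap.proj w
  have hM : ∀ ρ v j, M ρ v j = ∑ w, eval ρ (c j w) * v w := by
    intro ρ v j
    simp [M]
  have hFM : ∀ ρ ∈ Z, ∀ v, v ∈ F ρ ↔ M ρ v = 0 := by
    intro ρ hρ v
    rw [hF ρ hρ, funext_iff]
    simp [hM]
  obtain ⟨A, hA⟩ := exists_generalized_inverse (M ρ₀)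
  let B : κ → σ → (σ → ℂ) →L[ℂ] (σ → ℂ) := fun j w =>
    ((LinearMap.proj w : (σ → ℂ) →ₗ[ℂ] ℂ).smulRight (A (Pi.single j 1))).toContinuousLinearMap
  let Φ : (σ → ℂ) → (σ → ℂ) →L[ℂ] (σ → ℂ) := fun ρ =>
    1 + ∑ j, ∑ w, (eval ρ (c j w) - eval ρ₀ (c j w)) • B j w
  have hΦ : ∀ ρ v, Φ ρ v = v + (A (M ρ v) - A (M ρ₀ v)) := by
    intro ρ v
    have h1 : ∀ y : κ → ℂ, A y = ∑ j, y j • A (Pi.single j 1) := by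
      intro y
      conv_lhs => rw [pi_eq_sum_univ' y]
      simp only [map_sum, map_smul]
    simp only [Φ, B, add_apply, one_apply_eq_self,
      sum_apply, smul_apply,
      LinearMap.coe_toContinuousLinearMap', LinearMap.smulRight_apply, LinearMap.proj_apply]
    congr 1
    rw [← map_sub, h1]
    refine Finset.sum_congr rfl fun j _ => ?_
    simp only [Pi.sub_apply, hM, ← Finset.sum_sub_distrib, Finset.sum_smul, smul_smul, ← sub_mul]
  have hΦd : Differentiable ℂ Φ := by
    refine (differentiable_const _).add (Differentiable.fun_sum fun j _ =>
      Differentiable.fun_sum fun w _ => ?_)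
    exact ((differentiable_eval _).sub_const _).smul_const _
  have hΦ0 : Φ ρ₀ = 1 := by
    ext v
    simp [Φ]
  let b := Module.finBasisOfFinrankEq ℂ (F ρ₀) (hr ρ₀ hρ₀)
  refine ⟨{ρ | IsUnit (Φ ρ)}, Units.isOpen.preimage hΦd.continuous, ?_,
    fun i ρ => Ring.inverse (Φ ρ) (b i : σ → ℂ), ?_, ?_⟩
  · simp [hΦ0]
  · intro i ρ hρ
    have h1 : DifferentiableAt ℂ (fun ρ => Ring.inverse (Φ ρ)) ρ :=
      (differentiableAt_inverse (𝕜 := ℂ) hρ).comp ρ (hΦd ρ)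
    exact (h1.clm_apply (differentiableAt_const _)).differentiableWithinAt
  · rintro ρ ⟨hρZ, hρU⟩
    have hl : ∀ v, Ring.inverse (Φ ρ) (Φ ρ v) = v := by
      intro v
      have := Ring.inverse_mul_cancel _ hρU
      exact congrArg (fun T : (σ → ℂ) →L[ℂ] (σ → ℂ) => T v) this
    have hrr : ∀ v, Φ ρ (Ring.inverse (Φ ρ) v) = v := by
      intro v
      have := Ring.mul_inverse_cancel _ hρU
      exact congrArg (fun T : (σ → ℂ) →L[ℂ] (σ → ℂ) => T v) this
    let P : (σ → ℂ) →ₗ[ℂ] (σ → ℂ) := (Φ ρ).toLinearMap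
    let Q : (σ → ℂ) →ₗ[ℂ] (σ → ℂ) := (Ring.inverse (Φ ρ)).toLinearMap
    have hinj : Function.Injective P := Function.LeftInverse.injective (g := Q) hl
    have hinj' : Function.Injective Q := Function.LeftInverse.injective (g := P) hrr
    have hmap : (F ρ).map P = F ρ₀ := by
      apply Submodule.eq_of_le_of_finrank_eq
      · rintro _ ⟨v, hv, rfl⟩
        have hv' := (hFM ρ hρZ v).mp hv
        rw [hFM ρ₀ hρ₀]
        change M ρ₀ (Φ ρ v) = 0
        rw [hΦ, hv']
        simp [hA]
      · rw [← (Submodule.equivMapOfInjective P hinj (F ρ)).finrank_eq, hr ρ hρZ, hr ρ₀ hρ₀]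
    constructor
    · have h1 : LinearIndependent ℂ fun i => ((b i : F ρ₀) : σ → ℂ) :=
        b.linearIndependent.map' (F ρ₀).subtype (Submodule.ker_subtype _)
      exact h1.map' Q (LinearMap.ker_eq_bot.mpr hinj')
    · have h1 : Submodule.span ℂ (Set.range fun i => ((b i : F ρ₀) : σ → ℂ)) = F ρ₀ := by
        have h2 := congrArg (Submodule.map (F ρ₀).subtype) b.span_eq
        rw [Submodule.map_span, Submodule.map_top, Submodule.range_subtype, ← Set.range_comp] at h2
        exact h2
      have h2 : (Set.range fun i => Ring.inverse (Φ ρ) (b i : σ → ℂ)) =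
          Q '' (Set.range fun i => ((b i : F ρ₀) : σ → ℂ)) := by
        rw [← Set.range_comp]
        rfl
      have h3 : Q ∘ₗ P = LinearMap.id := LinearMap.ext hl
      rw [h2, ← Submodule.map_span, h1, ← hmap, ← Submodule.map_comp, h3, Submodule.map_id]

end Bundles

/-! ### Simple systems: specialization, extension of solutions and smoothness -/

section Specialize
variable {σ : Type*}

open Classical in
/-- The univariate polynomial in `v` obtained from a polynomial by substituting the coordinates
of `a` for all the other variables. -/
def specialize (a : σ → ℂ) (v : σ) : MvPolynomial σ ℂ →ₐ[ℂ] Polynomial ℂ :=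
  aeval (Function.update (fun w => Polynomial.C (a w)) v Polynomial.X)

open Classical in
theorem eval_specialize (a : σ → ℂ) (v : σ) (t : ℂ) (p : MvPolynomial σ ℂ) :
    (specialize a v p).eval t = eval (Function.update a v t) p := by
  have h : (Polynomial.evalRingHom t).comp (specialize a v : MvPolynomial σ ℂ →+* Polynomial ℂ) =
      eval (Function.update a v t) := by
    refine MvPolynomial.ringHom_ext (fun c => ?_) fun w => ?_
    · simp [specialize]
    · by_cases hw : w = v
      · subst hw; simp [specialize]
      · simp [specialize, hw]
  exact RingHom.congr_fun h p

open Classical in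
theorem specialize_monomial (a : σ → ℂ) (v : σ) (s : σ →₀ ℕ) (c : ℂ) :
    specialize a v (monomial s c) =
      Polynomial.C (eval a (monomial (s.erase v) c)) * Polynomial.X ^ s v := by
  rw [specialize, aeval_monomial, eval_monomial, Polynomial.algebraMap_eq, map_mul, mul_assoc]
  congr 1
  have h1 : s.prod (fun w k => Function.update (fun w => Polynomial.C (a w)) v Polynomial.X w ^ k) =
      (s.erase v).prod (fun w k => Polynomial.C (a w) ^ k) * Polynomial.X ^ s v := by
    conv_lhs => rw [← Finsupp.erase_add_single v s]
    rw [Finsupp.prod_add_index' (by simp) (by intros; rw [pow_add])]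
    congr 1
    · refine Finsupp.prod_congr fun w hw => ?_
      rw [Function.update_of_ne]
      rintro rfl
      simp at hw
    · rw [Finsupp.prod_single_index (by simp)]
      simp
  rw [h1, map_finsuppProd]
  simp

theorem specialize_eq_sum (a : σ → ℂ) (v : σ) (p : MvPolynomial σ ℂ) :
    specialize a v p = ∑ s ∈ p.support,
      Polynomial.C (eval a (monomial (s.erase v) (p.coeff s))) * Polynomial.X ^ s v := by
  conv_lhs => rw [p.as_sum, map_sum]
  exact Finset.sum_congr rfl fun s _ => specialize_monomial a v s _

theorem coeff_specialize_degreeOf (a : σ → ℂ) (v : σ) (p : MvPolynomial σ ℂ) :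
    (specialize a v p).coeff (p.degreeOf v) = eval a (initialAt p v) := by
  rw [specialize_eq_sum, Polynomial.finsetSum_coeff, initialAt, map_sum, Finset.sum_filter]
  refine Finset.sum_congr rfl fun s _ => ?_
  rw [Polynomial.coeff_C_mul_X_pow]
  simp only [eq_comm]

theorem natDegree_specialize_le (a : σ → ℂ) (v : σ) (p : MvPolynomial σ ℂ) :
    (specialize a v p).natDegree ≤ p.degreeOf v := by
  rw [specialize_eq_sum]
  refine Polynomial.natDegree_sum_le_of_forall_le _ _ fun s hs => ?_
  refine (Polynomial.natDegree_C_mul_X_pow_le _ _).trans ?_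
  exact monomial_le_degreeOf v hs

theorem derivative_specialize (a : σ → ℂ) (v : σ) (p : MvPolynomial σ ℂ) :
    Polynomial.derivative (specialize a v p) = specialize a v (pderiv v p) := by
  classical
  induction p using MvPolynomial.induction_on with
  | C c => simp [specialize]
  | add p q hp hq => simp [hp, hq]
  | mul_X p w hp =>
    rw [map_mul, Polynomial.derivative_mul, hp, Derivation.leibniz, map_add]
    simp only [smul_eq_mul, map_mul, pderiv_X]
    have hX : Polynomial.derivative (specialize a v (X w)) =
        specialize a v ((Pi.single v 1 : σ → MvPolynomial σ ℂ) w) := by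
      by_cases hw : w = v
      · subst hw; simp [specialize]
      · simp [specialize, hw]
    rw [hX]
    ring

theorem degreeOf_eq_zero_of_notMem_vars {p : MvPolynomial σ ℂ} {v : σ} (hv : v ∉ p.vars) :
    p.degreeOf v = 0 := by
  classical
  refine Nat.le_zero.mp (degreeOf_le_iff.mpr fun s hs => ?_)
  by_contra hsv
  exact hv ((mem_vars_iff_mem_support v).mpr
    ⟨s, hs, Finsupp.mem_support_iff.mpr fun h0 => hsv (by simp [h0])⟩)

theorem eval_congr_of_vars {p : MvPolynomial σ ℂ} {a b : σ → ℂ} (h : ∀ w ∈ p.vars, a w = b w) :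
    eval a p = eval b p :=
  eval₂Hom_congr' rfl (fun w hw _ => h w hw) rfl

open Classical in
theorem eval_update_of_notMem_vars {p : MvPolynomial σ ℂ} {v : σ} (hv : v ∉ p.vars) (a : σ → ℂ)
    (t : ℂ) : eval (Function.update a v t) p = eval a p :=
  eval_congr_of_vars fun w hw => Function.update_of_ne (by rintro rfl; exact hv hw) _ _

end Specialize

section Simple
variable {σ : Type*} {lt : σ → σ → Prop}

theorem IsLeader.unique [IsStrictTotalOrder σ lt] {p : MvPolynomial σ ℂ} {v w : σ}
    (hv : IsLeader lt p v) (hw : IsLeader lt p w) : v = w := by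
  by_contra h
  exact asymm_of lt (hv.2 w hw.1 (Ne.symm h)) (hw.2 v hv.1 h)

theorem IsLeader.lt_or_eq {p : MvPolynomial σ ℂ} {v w : σ} (hv : IsLeader lt p v)
    (hw : w ∈ p.vars) : lt w v ∨ w = v := by
  by_cases h : w = v
  · exact Or.inr h
  · exact Or.inl (hv.2 w hw h)

theorem IsLeader.notMem_vars [IsStrictTotalOrder σ lt] {p : MvPolynomial σ ℂ} {v w : σ}
    (hv : IsLeader lt p v) (h : lt v w) : w ∉ p.vars := by
  intro hw
  rcases hv.lt_or_eq hw with h' | rfl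
  · exact asymm_of lt h h'
  · exact irrefl_of lt _ h

theorem IsLeader.degreeOf_pos {p : MvPolynomial σ ℂ} {v : σ} (hv : IsLeader lt p v) :
    0 < p.degreeOf v := by
  classical
  obtain ⟨s, hs, hsv⟩ := (mem_vars_iff_mem_support v).mp hv.1
  exact (Nat.pos_of_ne_zero (Finsupp.mem_support_iff.mp hsv)).trans_le (monomial_le_degreeOf v hs)

theorem AlgSystem.sol_subset_solBelow (T : AlgSystem σ) (v : σ) : T.sol ⊆ T.solBelow lt v :=
  fun _ ha => ⟨fun p hp _ _ _ => ha.1 p hp, fun q hq _ _ _ => ha.2 q hq⟩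

theorem AlgSystem.IsSimple.specialize_ne_zero {T : AlgSystem σ} (hT : T.IsSimple lt)
    {r : MvPolynomial σ ℂ} (hr : r ∈ T.eqs ∨ r ∈ T.ineqs) {v : σ} (hv : IsLeader lt r v)
    {a : σ → ℂ} (ha : a ∈ T.solBelow lt v) : 0 < (specialize a v r).natDegree := by
  refine hv.degreeOf_pos.trans_le (Polynomial.le_natDegree_of_ne_zero ?_)
  rw [coeff_specialize_degreeOf]
  exact hT.initial_ne_zero r hr v hv a ha

/-- A solution of the part of a simple system whose leaders lie in an initial segment `D` of the
variables extends to a solution of the whole system if all the inequations belong to that part: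
the remaining coordinates are found one after the other as roots of non-constant univariate
polynomials. -/
theorem AlgSystem.IsSimple.exists_extension [Finite σ] [IsStrictTotalOrder σ lt]
    {T : AlgSystem σ} (hT : T.IsSimple lt) (D : Set σ) (hD : ∀ v ∈ D, ∀ w, lt w v → w ∈ D)
    (hin : ∀ q ∈ T.ineqs, ∀ v, IsLeader lt q v → v ∈ D) (a : σ → ℂ)
    (ha : ∀ p ∈ T.eqs, ∀ v ∈ D, IsLeader lt p v → eval a p = 0)
    (ha' : ∀ q ∈ T.ineqs, eval a q ≠ 0) : ∃ b ∈ T.sol, ∀ w ∈ D, b w = a w := by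
  classical
  induction hn : (Dᶜ).ncard generalizing D a with
  | zero =>
    have hDu : ∀ v, v ∈ D := by
      intro v
      by_contra hv
      have := (Set.ncard_eq_zero (Set.toFinite _)).mp hn
      exact (this ▸ hv : v ∈ (∅ : Set σ))
    refine ⟨a, ⟨fun p hp => ?_, ha'⟩, fun _ _ => rfl⟩
    obtain ⟨v, hv⟩ := hT.nonconstant p (Or.inl hp)
    exact ha p hp v (hDu v) hv
  | succ k ih =>
    have hne : (Dᶜ).Nonempty := by
      rw [Set.nonempty_iff_ne_empty]
      intro h
      simp [h] at hn
    obtain ⟨v, hvD, hmin⟩ := (Finite.wellFounded_of_trans_of_irrefl lt).has_min _ hne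
    have hlow : ∀ w, lt w v → w ∈ D := fun w hw => by
      by_contra h
      exact hmin w h hw
    have hgt : ∀ w ∈ D, lt w v := by
      intro w hw
      rcases trichotomous_of lt w v with h | rfl | h
      · exact h
      · exact absurd hw hvD
      · exact absurd (hD w hw v h) hvD
    have hab : a ∈ T.solBelow lt v :=
      ⟨fun p hp w hw hwv => ha p hp w (hlow w hwv) hw, fun q hq _ _ _ => ha' q hq⟩
    -- the new coordinate solves the equation with leader `v`, if there is one
    obtain ⟨t, ht⟩ : ∃ t, ∀ p ∈ T.eqs, IsLeader lt p v → eval (Function.update a v t) p = 0 := by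
      by_cases hex : ∃ p ∈ T.eqs, IsLeader lt p v
      · obtain ⟨p, hp, hpv⟩ := hex
        have hdeg := hT.specialize_ne_zero (Or.inl hp) hpv hab
        obtain ⟨t, ht⟩ := IsAlgClosed.exists_root (specialize a v p)
          (by rw [Polynomial.degree_eq_natDegree (by rintro h; simp [h] at hdeg)]
              exact_mod_cast hdeg.ne')
        refine ⟨t, fun p' hp' hpv' => ?_⟩
        rw [hT.triangular p' p (Or.inl hp') (Or.inl hp) v hpv' hpv, ← eval_specialize]
        exact ht
      · exact ⟨0, fun p hp hpv => absurd ⟨p, hp, hpv⟩ hex⟩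
    have hold : ∀ p w, IsLeader lt p w → w ∈ D →
        eval (Function.update a v t) p = eval a p := fun p w hw hwD =>
      eval_update_of_notMem_vars (hw.notMem_vars (hgt w hwD)) a t
    obtain ⟨b, hb, hbD⟩ := ih (insert v D)
      (by
        rintro w (rfl | hw) u hu
        · exact Or.inr (hlow u hu)
        · exact Or.inr (hD w hw u hu))
      (fun q hq w hw => Or.inr (hin q hq w hw)) (Function.update a v t)
      (by
        rintro p hp w (rfl | hw) hpw
        · exact ht p hp hpw
        · rw [hold p w hpw hw]
          exact ha p hp w hw hpw)
      (by
        intro q hq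
        obtain ⟨w, hw⟩ := hT.nonconstant q (Or.inr hq)
        rw [hold q w hw (hin q hq w hw)]
        exact ha' q hq)
      (by
        have h1 : (insert v D)ᶜ = Dᶜ \ {v} := by
          ext w
          simp only [Set.mem_compl_iff, Set.mem_insert_iff, Set.mem_sdiff, Set.mem_singleton_iff]
          tauto
        rw [h1, Set.ncard_sdiff_singleton_of_mem hvD, hn]
        rfl)
    refine ⟨b, hb, fun w hw => ?_⟩
    rw [hbD w (Or.inr hw), Function.update_of_ne]
    rintro rfl
    exact hvD hw

theorem surjective_of_forall_sum_eq_zero {E : Type*} [AddCommGroup E] [Module ℂ E] {c : ℕ}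
    (f : E →ₗ[ℂ] (Fin c → ℂ)) (h : ∀ y : Fin c → ℂ, (∀ v, ∑ i, y i * f v i = 0) → y = 0) :
    Function.Surjective f := by
  rw [← LinearMap.range_eq_top]
  by_contra hne
  obtain ⟨g, hg0, hg⟩ := Submodule.exists_le_ker_of_lt_top _ (lt_top_iff_ne_top.mpr hne)
  refine hg0 ?_
  have hgy : ∀ x, g x = ∑ i, g (Pi.single i 1) * x i := by
    intro x
    conv_lhs => rw [pi_eq_sum_univ' x]
    simp [mul_comm]
  have h0 := h (fun i => g (Pi.single i 1)) fun v => by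
    rw [← hgy]
    exact hg ⟨v, rfl⟩
  refine LinearMap.ext fun x => ?_
  rw [hgy]
  simp [congrFun h0]

theorem isLocallyZariskiClosed_sol [Finite σ] [Fintype σ] (T : AlgSystem σ) :
    IsLocallyZariskiClosed T.sol := by
  refine ⟨Ideal.span T.eqs, Ideal.span {∏ q ∈ T.ineqs, q}, ?_⟩
  ext a
  simp only [zeroLocus_span, Set.mem_sdiff, Set.mem_ofPred_eq, AlgSystem.sol, aeval_eq_eval,
    Set.mem_singleton_iff, forall_eq, map_prod, Finset.prod_eq_zero_iff, not_exists, not_and,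
    Finset.mem_coe]

/-- At a solution of a simple system the differentials of the equations are linearly independent:
the Jacobian matrix of the equations with respect to their leaders is triangular, and the diagonal
entries do not vanish because the equations are square-free. -/
theorem AlgSystem.IsSimple.surjective_differentialAt [Fintype σ] [IsStrictTotalOrder σ lt]
    {T : AlgSystem σ} (hT : T.IsSimple lt) {c : ℕ} (e : Fin c ≃ T.eqs) {ρ : σ → ℂ}
    (hρ : ρ ∈ T.sol) :
    Function.Surjective (LinearMap.pi fun i => differentialAt ρ (e i).1) := by
  classical
  have hlead : ∀ i, ∃ v, IsLeader lt (e i).1 v := fun i => hT.nonconstant _ (Or.inl (e i).2)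
  choose l hl using hlead
  have hl_inj : ∀ i j, l i = l j → i = j := by
    intro i j hij
    refine e.injective (Subtype.ext ?_)
    exact hT.triangular _ _ (Or.inl (e i).2) (Or.inl (e j).2) (l i) (hl i) (hij ▸ hl j)
  refine surjective_of_forall_sum_eq_zero _ fun y hy => ?_
  by_contra hy0
  -- test against the coordinate direction of the greatest leader with non-zero coefficient
  have hne : {v | ∃ i, y i ≠ 0 ∧ l i = v}.Nonempty := by
    obtain ⟨i, hi⟩ := Function.ne_iff.mp hy0
    exact ⟨l i, i, hi, rfl⟩
  obtain ⟨_, ⟨i, hi, rfl⟩, hmax⟩ :=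
    (Finite.wellFounded_of_trans_of_irrefl (Function.swap lt)).has_min _ hne
  have h := hy (Pi.single (l i) 1)
  have hsum : ∀ j, differentialAt ρ (e j).1 (Pi.single (l i) 1) =
      eval ρ (pderiv (l i) (e j).1) := by
    intro j
    simp [differentialAt_apply, Pi.single_apply]
  simp only [LinearMap.pi_apply, hsum] at h
  rw [Finset.sum_eq_single i] at h
  · refine (mul_ne_zero hi ?_) h
    exact hT.squarefree _ (Or.inl (e i).2) (l i) (hl i) ρ (T.sol_subset_solBelow _ hρ)
      (hρ.1 _ (e i).2)
  · intro j _ hji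
    by_cases hj : y j = 0
    · simp [hj]
    · have hlt : lt (l j) (l i) := by
        rcases trichotomous_of lt (l j) (l i) with h | h | h
        · exact h
        · exact absurd (hl_inj _ _ h) hji
        · exact absurd h (hmax _ ⟨j, hj, rfl⟩)
      rw [pderiv_eq_zero_of_notMem_vars ((hl j).notMem_vars hlt)]
      simp
  · simp

theorem AlgSystem.IsSimple.isComplexSubmanifold_sol [Fintype σ] [IsStrictTotalOrder σ lt]
    {T : AlgSystem σ} (hT : T.IsSimple lt) : IsComplexSubmanifold T.sol := by
  obtain ⟨c, ⟨e⟩⟩ : ∃ c, Nonempty (Fin c ≃ T.eqs) := ⟨_, ⟨T.eqs.equivFin.symm⟩⟩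
  have hq : ∀ a, eval a (∏ q ∈ T.ineqs, q) ≠ 0 ↔ ∀ q ∈ T.ineqs, eval a q ≠ 0 := by
    intro a
    rw [map_prod, Finset.prod_ne_zero_iff]
  refine ⟨c, fun ρ hρ => ⟨{a | eval a (∏ q ∈ T.ineqs, q) ≠ 0}, ?_, (hq ρ).mpr hρ.2,
    fun a i => eval a (e i).1, ?_, ?_, ?_⟩⟩
  · exact isOpen_ne.preimage (differentiable_eval _).continuous
  · exact (differentiable_pi.mpr fun i => differentiable_eval _).differentiableOn
  · have hd : HasFDerivAt (fun (a : σ → ℂ) (i : Fin c) => eval a (e i).1)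
        (ContinuousLinearMap.pi fun i => (differentialAt ρ (e i).1).toContinuousLinearMap) ρ :=
      hasFDerivAt_pi.mpr fun i => hasFDerivAt_eval _ ρ
    rw [hd.fderiv]
    exact hT.surjective_differentialAt e hρ
  · ext a
    have h1 : (fun i => eval a (e i).1) = 0 ↔ ∀ p ∈ T.eqs, eval a p = 0 := by
      rw [funext_iff, e.forall_congr_left]
      simp
    simp only [AlgSystem.sol, Set.mem_inter_iff, Set.mem_ofPred_eq, h1, hq]
    tauto

end Simple

/-! ### Constructible induction and building up simple systems -/

/-- Noetherian induction over constructible sets: a property of sets of points that is stable under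
disjoint unions and under removing hypersurfaces holds for all closed sets if it holds for some
dense open part of each irreducible one. -/
theorem constructible_induction {A X : Type*} [CommRing A] [IsNoetherianRing A] (e : X → A →+* ℂ)
    (Φ : Set X → Prop) (h0 : Φ ∅) (hU : ∀ Z Z', Disjoint Z Z' → Φ Z → Φ Z' → Φ (Z ∪ Z'))
    (hD : ∀ Z f, Φ Z → Φ (Z ∩ {x | e x f ≠ 0}))
    (hP : ∀ P : Ideal A, P.IsPrime → ∃ f ∉ P, Φ {x | (∀ p ∈ P, e x p = 0) ∧ e x f ≠ 0})
    (I : Ideal A) : Φ {x | ∀ p ∈ I, e x p = 0} := by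
  refine IsNoetherian.induction (P := fun I : Ideal A => Φ {x | ∀ p ∈ I, e x p = 0})
    (fun I ih => ?_) I
  change Ideal A at I
  have hsup : ∀ f ∉ I, I < I ⊔ Ideal.span {f} := by
    intro f hf
    refine lt_of_le_of_ne le_sup_left fun h => hf ?_
    rw [h]
    exact Ideal.mem_sup_right (Ideal.mem_span_singleton_self f)
  have hmem : ∀ (f : A) (x : X), (∀ p ∈ I ⊔ Ideal.span {f}, e x p = 0) ↔
      (∀ p ∈ I, e x p = 0) ∧ e x f = 0 := by
    intro f x
    have h1 : ∀ J : Ideal A, (∀ p ∈ J, e x p = 0) ↔ J ≤ RingHom.ker (e x) := fun J => Iff.rfl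
    rw [h1, h1, sup_le_iff, Ideal.span_singleton_le_iff_mem, RingHom.mem_ker]
  by_cases hprime : I.IsPrime
  · obtain ⟨f, hf, hΦ⟩ := hP I hprime
    have h1 := hU _ _ ?_ hΦ (ih _ (hsup f hf))
    · convert h1 using 1
      ext x
      simp only [Set.mem_union, Set.mem_ofPred_eq, hmem]
      tauto
    · rw [Set.disjoint_left]
      simp only [Set.mem_ofPred_eq, hmem]
      tauto
  · rw [Ideal.not_isPrime_iff] at hprime
    rcases hprime with rfl | ⟨x, hx, y, hy, hxy⟩
    · convert h0
      ext x
      simp only [Set.mem_ofPred_eq, Set.mem_empty_iff_false, iff_false]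
      intro h
      simpa using h 1 trivial
    · have h1 := hU _ _ ?_ (ih _ (hsup x hx)) (hD _ x (ih _ (hsup y hy)))
      · convert h1 using 1
        ext z
        simp only [Set.mem_union, Set.mem_inter_iff, Set.mem_ofPred_eq, hmem]
        have h2 : (∀ p ∈ I, e z p = 0) → e z x * e z y = 0 := fun h => by
          rw [← map_mul]
          exact h _ hxy
        constructor
        · intro h
          rcases mul_eq_zero.mp (h2 h) with h3 | h3
          · exact Or.inl ⟨h, h3⟩
          · by_cases h4 : e z x = 0
            · exact Or.inl ⟨h, h4⟩
            · exact Or.inr ⟨⟨h, h3⟩, h4⟩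
        · tauto
      · rw [Set.disjoint_left]
        simp only [Set.mem_inter_iff, Set.mem_ofPred_eq, hmem]
        tauto

section Decomposable
variable {σ : Type*} {lt : σ → σ → Prop}

/-- `Z` is the disjoint union of the solution sets of finitely many simple systems with the
property `Q`. -/
def IsDecomposable (lt : σ → σ → Prop) (Q : AlgSystem σ → Prop) (Z : Set (σ → ℂ)) : Prop :=
  ∃ L : List (AlgSystem σ), (∀ T ∈ L, T.IsSimple lt ∧ Q T) ∧
    L.Pairwise (fun S T => Disjoint S.sol T.sol) ∧ Z = {a | ∃ T ∈ L, a ∈ T.sol}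

theorem isDecomposable_empty (Q : AlgSystem σ → Prop) : IsDecomposable lt Q ∅ :=
  ⟨[], by simp, by simp, by simp⟩

theorem AlgSystem.IsSimple.isDecomposable {Q : AlgSystem σ → Prop} {T : AlgSystem σ}
    (hT : T.IsSimple lt) (hQ : Q T) : IsDecomposable lt Q T.sol :=
  ⟨[T], by simp [hT, hQ], by simp, by ext; simp⟩

theorem IsDecomposable.union {Q : AlgSystem σ → Prop} {Z Z' : Set (σ → ℂ)} (hd : Disjoint Z Z')
    (h : IsDecomposable lt Q Z) (h' : IsDecomposable lt Q Z') : IsDecomposable lt Q (Z ∪ Z') := by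
  obtain ⟨L, hL, hp, rfl⟩ := h
  obtain ⟨L', hL', hp', rfl⟩ := h'
  refine ⟨L ++ L', ?_, ?_, ?_⟩
  · intro T hT
    rcases List.mem_append.mp hT with h | h
    · exact hL T h
    · exact hL' T h
  · rw [List.pairwise_append]
    refine ⟨hp, hp', fun S hS T hT => ?_⟩
    rw [Set.disjoint_left] at hd ⊢
    exact fun a ha ha' => hd ⟨S, hS, ha⟩ ⟨T, hT, ha'⟩
  · ext a
    simp only [List.mem_append, Set.mem_union, Set.mem_ofPred_eq, or_and_right, exists_or]

/-- To decompose `Z ∩ C` it is enough to refine each member of a decomposition of `Z`. -/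
theorem IsDecomposable.inter {Q Q' : AlgSystem σ → Prop} {Z C : Set (σ → ℂ)}
    (h : IsDecomposable lt Q Z)
    (hC : ∀ T : AlgSystem σ, T.IsSimple lt → Q T → T.sol ⊆ Z →
      IsDecomposable lt Q' (T.sol ∩ C)) : IsDecomposable lt Q' (Z ∩ C) := by
  obtain ⟨L, hL, hp, rfl⟩ := h
  induction L with
  | nil => simpa using isDecomposable_empty Q'
  | cons T L ih =>
    rw [List.pairwise_cons] at hp
    have h1 : {a | ∃ S ∈ T :: L, a ∈ S.sol} ∩ C =
        (T.sol ∩ C) ∪ ({a | ∃ S ∈ L, a ∈ S.sol} ∩ C) := by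
      ext a
      simp only [List.mem_cons, Set.mem_inter_iff, Set.mem_union, Set.mem_ofPred_eq,
        or_and_right, exists_or, exists_eq_left]
    rw [h1]
    refine IsDecomposable.union ?_ ?_ (ih (fun S hS => hL S (by simp [hS])) hp.2 ?_)
    · rw [Set.disjoint_left]
      rintro a ⟨ha, -⟩ ⟨⟨S, hS, haS⟩, -⟩
      exact Set.disjoint_left.mp (hp.1 S hS) ha haS
    · exact hC T (hL T (by simp)).1 (hL T (by simp)).2 fun a ha => ⟨T, by simp, ha⟩
    · intro S hS hQ hsub
      refine hC S hS hQ (hsub.trans ?_)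
      rintro a ⟨S', hS', ha⟩
      exact ⟨S', by simp [hS'], ha⟩

end Decomposable

section Insert
variable {σ : Type*} {lt : σ → σ → Prop}

open Classical in
/-- Adjoin an equation to a system. -/
def AlgSystem.insertEq (T : AlgSystem σ) (r : MvPolynomial σ ℂ) : AlgSystem σ where
  eqs := insert r T.eqs
  ineqs := T.ineqs

open Classical in
/-- Adjoin an inequation to a system. -/
def AlgSystem.insertIneq (T : AlgSystem σ) (r : MvPolynomial σ ℂ) : AlgSystem σ where
  eqs := T.eqs
  ineqs := insert r T.ineqs

theorem AlgSystem.sol_insertEq (T : AlgSystem σ) (r : MvPolynomial σ ℂ) :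
    (T.insertEq r).sol = T.sol ∩ {a | eval a r = 0} := by
  ext a
  simp only [sol, insertEq, Finset.mem_insert, forall_eq_or_imp, Set.mem_inter_iff,
    Set.mem_ofPred_eq]
  tauto

theorem AlgSystem.sol_insertIneq (T : AlgSystem σ) (r : MvPolynomial σ ℂ) :
    (T.insertIneq r).sol = T.sol ∩ {a | eval a r ≠ 0} := by
  ext a
  simp only [sol, insertIneq, Finset.mem_insert, forall_eq_or_imp, Set.mem_inter_iff,
    Set.mem_ofPred_eq]
  tauto

theorem AlgSystem.solBelow_insertEq_subset (T : AlgSystem σ) (r : MvPolynomial σ ℂ) (v : σ) :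
    (T.insertEq r).solBelow lt v ⊆ T.solBelow lt v := by
  classical
  exact fun a ha => ⟨fun p hp => ha.1 p (Finset.mem_insert_of_mem hp), ha.2⟩

theorem AlgSystem.solBelow_insertIneq_subset (T : AlgSystem σ) (r : MvPolynomial σ ℂ) (v : σ) :
    (T.insertIneq r).solBelow lt v ⊆ T.solBelow lt v := by
  classical
  exact fun a ha => ⟨ha.1, fun p hp => ha.2 p (Finset.mem_insert_of_mem hp)⟩

/-- Criterion for a simple system to stay simple when a polynomial `r` with a new leader `v` is
adjoined, as an equation or as an inequation. -/
theorem AlgSystem.IsSimple.of_insert [IsStrictTotalOrder σ lt] {T T' : AlgSystem σ}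
    (hT : T.IsSimple lt) {r : MvPolynomial σ ℂ} {v : σ} (hv : IsLeader lt r v)
    (hno : ∀ r', r' ∈ T.eqs ∨ r' ∈ T.ineqs → ¬ IsLeader lt r' v)
    (hmem : ∀ r', r' ∈ T'.eqs ∨ r' ∈ T'.ineqs → r' = r ∨ (r' ∈ T.eqs ∨ r' ∈ T.ineqs))
    (hsub : ∀ w, T'.solBelow lt w ⊆ T.solBelow lt w) (hdisj : Disjoint T'.eqs T'.ineqs)
    (hinit : ∀ a ∈ T'.solBelow lt v, eval a (initialAt r v) ≠ 0)
    (hsq : ∀ a ∈ T'.solBelow lt v, eval a r = 0 → eval a (pderiv v r) ≠ 0) :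
    T'.IsSimple lt where
  nonconstant r' hr' := by
    rcases hmem r' hr' with rfl | h
    · exact ⟨v, hv⟩
    · exact hT.nonconstant r' h
  disjoint := hdisj
  triangular r₁ r₂ h₁ h₂ w hw₁ hw₂ := by
    rcases hmem r₁ h₁ with rfl | h₁ <;> rcases hmem r₂ h₂ with rfl | h₂
    · rfl
    · exact absurd (hv.unique hw₁ ▸ hw₂) (hno _ h₂)
    · exact absurd (hv.unique hw₂ ▸ hw₁) (hno _ h₁)
    · exact hT.triangular r₁ r₂ h₁ h₂ w hw₁ hw₂
  initial_ne_zero r' hr' w hw a ha := by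
    rcases hmem r' hr' with rfl | h
    · obtain rfl := hv.unique hw
      exact hinit a ha
    · exact hT.initial_ne_zero r' h w hw a (hsub w ha)
  squarefree r' hr' w hw a ha h0 := by
    rcases hmem r' hr' with rfl | h
    · obtain rfl := hv.unique hw
      exact hsq a ha h0
    · exact hT.squarefree r' h w hw a (hsub w ha) h0

theorem AlgSystem.IsSimple.insertEq [IsStrictTotalOrder σ lt] {T : AlgSystem σ}
    (hT : T.IsSimple lt) {r : MvPolynomial σ ℂ} {v : σ} (hv : IsLeader lt r v)
    (hno : ∀ r', r' ∈ T.eqs ∨ r' ∈ T.ineqs → ¬ IsLeader lt r' v)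
    (hinit : ∀ a ∈ T.solBelow lt v, eval a (initialAt r v) ≠ 0)
    (hsq : ∀ a ∈ T.solBelow lt v, eval a r = 0 → eval a (pderiv v r) ≠ 0) :
    (T.insertEq r).IsSimple lt := by
  classical
  refine hT.of_insert hv hno ?_ (T.solBelow_insertEq_subset r) ?_
    (fun a ha => hinit a (T.solBelow_insertEq_subset r v ha))
    (fun a ha => hsq a (T.solBelow_insertEq_subset r v ha))
  · intro r' hr'
    simp only [AlgSystem.insertEq, Finset.mem_insert] at hr'
    tauto
  · exact Finset.disjoint_insert_left.mpr ⟨fun h => hno r (Or.inr h) hv, hT.disjoint⟩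

theorem AlgSystem.IsSimple.insertIneq [IsStrictTotalOrder σ lt] {T : AlgSystem σ}
    (hT : T.IsSimple lt) {r : MvPolynomial σ ℂ} {v : σ} (hv : IsLeader lt r v)
    (hno : ∀ r', r' ∈ T.eqs ∨ r' ∈ T.ineqs → ¬ IsLeader lt r' v)
    (hinit : ∀ a ∈ T.solBelow lt v, eval a (initialAt r v) ≠ 0)
    (hsq : ∀ a ∈ T.solBelow lt v, eval a r = 0 → eval a (pderiv v r) ≠ 0) :
    (T.insertIneq r).IsSimple lt := by
  classical
  refine hT.of_insert hv hno ?_ (T.solBelow_insertIneq_subset r) ?_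
    (fun a ha => hinit a (T.solBelow_insertIneq_subset r v ha))
    (fun a ha => hsq a (T.solBelow_insertIneq_subset r v ha))
  · intro r' hr'
    simp only [AlgSystem.insertIneq, Finset.mem_insert] at hr'
    tauto
  · exact Finset.disjoint_insert_right.mpr ⟨fun h => hno r (Or.inl h) hv, hT.disjoint⟩

end Insert

section Supported
variable {σ : Type*} {lt : σ → σ → Prop} {D : Set σ} {v : σ}

instance [Finite σ] : IsNoetherianRing (supported ℂ D) :=
  isNoetherianRing_of_ringEquiv _ (supportedEquivMvPolynomial (R := ℂ) D).symm.toRingEquiv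

/-- Evaluation at a point, on the polynomials in the variables of `D`. -/
def evalSupported (D : Set σ) (a : σ → ℂ) : supported ℂ D →+* ℂ :=
  (eval a).comp (supported ℂ D).val.toRingHom

@[simp]
theorem evalSupported_apply (a : σ → ℂ) (p : supported ℂ D) :
    evalSupported D a p = eval a (p : MvPolynomial σ ℂ) := rfl

theorem notMem_vars_of_mem_supported {p : MvPolynomial σ ℂ} (hp : p ∈ supported ℂ D) (hv : v ∉ D) :
    v ∉ p.vars := fun h => hv (mem_supported.mp hp h)

/-- The multivariate polynomial that a univariate polynomial in `v` with coefficients not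
involving `v` stands for. -/
def ofUnivariate (D : Set σ) (v : σ) :
    Polynomial (supported ℂ D) →ₐ[supported ℂ D] MvPolynomial σ ℂ :=
  Polynomial.aeval (X v)

theorem specialize_ofUnivariate (hv : v ∉ D) (a : σ → ℂ) (r : Polynomial (supported ℂ D)) :
    specialize a v (ofUnivariate D v r) = r.map (evalSupported D a) := by
  classical
  have h : ((specialize a v : MvPolynomial σ ℂ →+* Polynomial ℂ)).comp
      (ofUnivariate D v : Polynomial (supported ℂ D) →+* MvPolynomial σ ℂ) =
      Polynomial.mapRingHom (evalSupported D a) := by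
    refine Polynomial.ringHom_ext (fun c => ?_) ?_
    · simp only [ofUnivariate, RingHom.comp_apply, RingHom.coe_coe, Polynomial.aeval_C,
        Polynomial.coe_mapRingHom, Polynomial.map_C, evalSupported_apply]
      refine Polynomial.funext fun t => ?_
      rw [eval_specialize, Polynomial.eval_C]
      exact eval_update_of_notMem_vars (notMem_vars_of_mem_supported c.2 hv) a t
    · simp [ofUnivariate, specialize]
  exact RingHom.congr_fun h r

theorem eval_ofUnivariate (hv : v ∉ D) (a : σ → ℂ) (r : Polynomial (supported ℂ D)) :
    eval a (ofUnivariate D v r) = (r.map (evalSupported D a)).eval (a v) := by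
  classical
  rw [← specialize_ofUnivariate hv, eval_specialize, Function.update_eq_self]

theorem eval_pderiv_ofUnivariate (hv : v ∉ D) (a : σ → ℂ) (r : Polynomial (supported ℂ D)) :
    eval a (pderiv v (ofUnivariate D v r)) =
      (r.derivative.map (evalSupported D a)).eval (a v) := by
  classical
  rw [← Polynomial.derivative_map, ← specialize_ofUnivariate hv, derivative_specialize,
    eval_specialize, Function.update_eq_self]

theorem degreeOf_ofUnivariate_le (hv : v ∉ D) (r : Polynomial (supported ℂ D)) :
    (ofUnivariate D v r).degreeOf v ≤ r.natDegree := by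
  classical
  rw [ofUnivariate, Polynomial.aeval_eq_sum_range]
  refine (degreeOf_sum_le _ _ _).trans (Finset.sup_le fun k hk => ?_)
  rw [Algebra.smul_def]
  refine (degreeOf_mul_le _ _ _).trans ?_
  have h1 : degreeOf v ((r.coeff k : supported ℂ D) : MvPolynomial σ ℂ) = 0 :=
    degreeOf_eq_zero_of_notMem_vars (notMem_vars_of_mem_supported (r.coeff k).2 hv)
  have h2 : degreeOf v (X v ^ k : MvPolynomial σ ℂ) ≤ k := by simp
  have h3 : degreeOf v (algebraMap (supported ℂ D) (MvPolynomial σ ℂ) (r.coeff k)) = 0 := h1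
  rw [h3, zero_add]
  exact h2.trans (Nat.lt_succ_iff.mp (Finset.mem_range.mp hk))

theorem ofUnivariate_mem_supported (r : Polynomial (supported ℂ D)) :
    ofUnivariate D v r ∈ supported ℂ (insert v D) := by
  rw [ofUnivariate, Polynomial.aeval_eq_sum_range]
  refine Subalgebra.sum_mem _ fun k _ => ?_
  rw [Algebra.smul_def]
  exact Subalgebra.mul_mem _ (supported_mono (Set.subset_insert v D) (r.coeff k).2)
    (Subalgebra.pow_mem _ (X_mem_supported.mpr (Set.mem_insert v D)) k)

theorem exists_ofUnivariate_eq {p : MvPolynomial σ ℂ} (hp : p ∈ supported ℂ (insert v D)) :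
    ∃ r, ofUnivariate D v r = p := by
  have h : supported ℂ (insert v D) ≤ ((ofUnivariate D v).restrictScalars ℂ).range := by
    rw [supported_eq_adjoin_X, Algebra.adjoin_le_iff]
    rintro _ ⟨w, rfl | hw, rfl⟩
    · exact ⟨Polynomial.X, by simp [ofUnivariate]⟩
    · refine ⟨Polynomial.C ⟨X w, X_mem_supported.mpr hw⟩, ?_⟩
      change ofUnivariate D v (Polynomial.C ⟨X w, X_mem_supported.mpr hw⟩) = X w
      rw [ofUnivariate, Polynomial.aeval_C]
      rfl
  exact h hp

/-- A univariate polynomial in `v` of positive degree has the leader `v`, and its initial is its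
leading coefficient. One point where the leading coefficient does not vanish is enough to see
this. -/
theorem isLeader_ofUnivariate (hD : ∀ w ∈ D, lt w v) (hv : v ∉ D)
    {r : Polynomial (supported ℂ D)} (hr : 0 < r.natDegree) {a : σ → ℂ}
    (ha : evalSupported D a r.leadingCoeff ≠ 0) :
    IsLeader lt (ofUnivariate D v r) v ∧
      eval a (initialAt (ofUnivariate D v r) v) ≠ 0 := by
  classical
  have h1 : (r.map (evalSupported D a)).natDegree = r.natDegree :=
    Polynomial.natDegree_map_of_leadingCoeff_ne_zero _ ha
  have h2 : (ofUnivariate D v r).degreeOf v = r.natDegree := by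
    refine le_antisymm (degreeOf_ofUnivariate_le hv r) ?_
    rw [← h1, ← specialize_ofUnivariate hv]
    exact natDegree_specialize_le a v _
  refine ⟨⟨?_, fun w hw hwv => ?_⟩, ?_⟩
  · by_contra h
    have h3 := degreeOf_eq_zero_of_notMem_vars h
    omega
  · rcases mem_supported.mp (ofUnivariate_mem_supported r) hw with h | h
    · exact absurd h hwv
    · exact hD w h
  · rw [← coeff_specialize_degreeOf, h2, specialize_ofUnivariate hv, Polynomial.coeff_map]
    exact ha

end Supported

/-! ### Generic behaviour over an irreducible variety -/

section Spread
variable {A X : Type*} [CommRing A] (P : Ideal A)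

/-- The canonical map from a ring to the residue field at a prime ideal. -/
def toResidueField : A →+* FractionRing (A ⧸ P) :=
  (algebraMap (A ⧸ P) (FractionRing (A ⧸ P))).comp (Ideal.Quotient.mk P)

theorem toResidueField_eq_zero_iff {a : A} : toResidueField P a = 0 ↔ a ∈ P := by
  rw [toResidueField, RingHom.comp_apply, FaithfulSMul.algebraMap_eq_zero_iff,
    Ideal.Quotient.eq_zero_iff_mem]

variable [hP : P.IsPrime]

/-- An element of the residue field becomes the image of a ring element after clearing
denominators. -/
theorem exists_toResidueField_eq_mul (k : FractionRing (A ⧸ P)) :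
    ∃ s ∉ P, ∃ b, toResidueField P b = toResidueField P s * k := by
  obtain ⟨⟨x, y⟩, h⟩ := IsLocalization.surj (nonZeroDivisors (A ⧸ P)) k
  obtain ⟨b, rfl⟩ := Ideal.Quotient.mk_surjective x
  obtain ⟨s, hs⟩ := Ideal.Quotient.mk_surjective y.1
  refine ⟨s, fun h0 => ?_, b, ?_⟩
  · rw [Ideal.Quotient.eq_zero_iff_mem.mpr h0] at hs
    exact nonZeroDivisors.ne_zero y.2 hs.symm
  · simp only [toResidueField, RingHom.comp_apply, hs]
    rw [mul_comm]
    exact h.symm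

theorem exists_map_eq_C_mul (c : Polynomial (FractionRing (A ⧸ P))) :
    ∃ s ∉ P, ∃ b : Polynomial A,
      b.map (toResidueField P) = Polynomial.C (toResidueField P s) * c := by
  induction c using Polynomial.induction_on' with
  | add p q hp hq =>
    obtain ⟨s, hs, b, hb⟩ := hp
    obtain ⟨s', hs', b', hb'⟩ := hq
    refine ⟨s * s', fun h => (hP.mem_or_mem h).elim hs hs',
      Polynomial.C s' * b + Polynomial.C s * b', ?_⟩
    simp only [Polynomial.map_add, Polynomial.map_mul, Polynomial.map_C, hb, hb', map_mul]
    ring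
  | monomial k a =>
    obtain ⟨s, hs, b, hb⟩ := exists_toResidueField_eq_mul P a
    refine ⟨s, hs, Polynomial.monomial k b, ?_⟩
    rw [Polynomial.map_monomial, hb, Polynomial.C_mul_monomial]

theorem exists_row_eq_smul {ι : Type*} [Fintype ι] (c : ι → FractionRing (A ⧸ P)) :
    ∃ s ∉ P, ∃ b : ι → A,
      (fun i => toResidueField P (b i)) = toResidueField P s • c := by
  classical
  choose s hs b hb using fun i => exists_toResidueField_eq_mul P (c i)
  refine ⟨∏ i, s i, fun h => ?_, fun i => (∏ j ∈ Finset.univ.erase i, s j) * b i, ?_⟩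
  · obtain ⟨i, -, hi⟩ := (Ideal.IsPrime.prod_mem_iff (hp := hP)).mp h
    exact hs i hi
  · ext i
    rw [map_mul, hb, Pi.smul_apply, smul_eq_mul, ← mul_assoc, ← map_mul,
      Finset.prod_erase_mul _ _ (Finset.mem_univ i)]

variable (e : X → A →+* ℂ)

/-- Membership in an ideal over the residue field of `P` has a consequence for common zeros over
all points of some dense open part of the variety of `P`. -/
theorem exists_eval_eq_zero_of_mem_span (S : Set (Polynomial A)) (k : Polynomial A)
    (hk : k.map (toResidueField P) ∈
      Ideal.span ((fun p => Polynomial.map (toResidueField P) p) '' S)) :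
    ∃ s ∉ P, ∀ x, (∀ p ∈ P, e x p = 0) → e x s ≠ 0 → ∀ t,
      (∀ p ∈ S, (p.map (e x)).eval t = 0) → (k.map (e x)).eval t = 0 := by
  have key : ∃ s ∉ P, ∃ b : Polynomial A,
      b.map (toResidueField P) =
        Polynomial.C (toResidueField P s) * k.map (toResidueField P) ∧
      ∀ x, ∀ t, (∀ p ∈ S, (p.map (e x)).eval t = 0) → (b.map (e x)).eval t = 0 := by
    generalize k.map (toResidueField P) = k' at hk ⊢
    induction hk using Submodule.span_induction with
    | mem q hq =>
      obtain ⟨p, hp, rfl⟩ := hq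
      exact ⟨1, hP.one_notMem, p, by simp, fun x t h => h p hp⟩
    | zero => exact ⟨1, hP.one_notMem, 0, by simp, fun x t h => by simp⟩
    | add q q' _ _ hq hq' =>
      obtain ⟨s, hs, b, hb, hv⟩ := hq
      obtain ⟨s', hs', b', hb', hv'⟩ := hq'
      refine ⟨s * s', fun h => (hP.mem_or_mem h).elim hs hs',
        Polynomial.C s' * b + Polynomial.C s * b', ?_, fun x t h => ?_⟩
      · simp only [Polynomial.map_add, Polynomial.map_mul, Polynomial.map_C, hb, hb', map_mul]
        ring
      · simp [hv x t h, hv' x t h]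
    | smul c q _ hq =>
      obtain ⟨s, hs, b, hb, hv⟩ := hq
      obtain ⟨s', hs', b', hb'⟩ := exists_map_eq_C_mul P c
      refine ⟨s * s', fun h => (hP.mem_or_mem h).elim hs hs', b' * b, ?_, fun x t h => ?_⟩
      · simp only [Polynomial.map_mul, hb, hb', map_mul, smul_eq_mul]
        ring
      · simp [hv x t h]
  obtain ⟨s, hs, b, hb, hv⟩ := key
  refine ⟨s, hs, fun x hx hsx t hS => ?_⟩
  -- `b - s k` has coefficients in `P`
  have h1 : b.map (e x) = (Polynomial.C s * k).map (e x) := by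
    ext i
    rw [Polynomial.coeff_map, Polynomial.coeff_map, ← sub_eq_zero, ← map_sub]
    refine hx _ ?_
    rw [← toResidueField_eq_zero_iff P, map_sub, sub_eq_zero, ← Polynomial.coeff_map,
      ← Polynomial.coeff_map, hb, Polynomial.map_mul, Polynomial.map_C]
  have h2 := hv x t hS
  rw [h1, Polynomial.map_mul, Polynomial.map_C, Polynomial.eval_mul, Polynomial.eval_C] at h2
  exact (mul_eq_zero.mp h2).resolve_left hsx

/-- The analogue of `exists_eval_eq_zero_of_mem_span` for linear forms. -/
theorem exists_sum_eq_zero_of_mem_span {ι : Type*} [Fintype ι] (S : Set (ι → A)) (k : ι → A)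
    (hk : (fun i => toResidueField P (k i)) ∈ Submodule.span (FractionRing (A ⧸ P))
      ((fun (p : ι → A) i => toResidueField P (p i)) '' S)) :
    ∃ s ∉ P, ∀ x, (∀ p ∈ P, e x p = 0) → e x s ≠ 0 → ∀ y : ι → ℂ,
      (∀ p ∈ S, ∑ i, e x (p i) * y i = 0) → ∑ i, e x (k i) * y i = 0 := by
  have key : ∃ s ∉ P, ∃ b : ι → A,
      (fun i => toResidueField P (b i)) =
        toResidueField P s • (fun i => toResidueField P (k i)) ∧
      ∀ x, ∀ y : ι → ℂ, (∀ p ∈ S, ∑ i, e x (p i) * y i = 0) → ∑ i, e x (b i) * y i = 0 := by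
    generalize (fun i => toResidueField P (k i)) = k' at hk ⊢
    induction hk using Submodule.span_induction with
    | mem q hq =>
      obtain ⟨p, hp, rfl⟩ := hq
      exact ⟨1, hP.one_notMem, p, by simp, fun x y h => h p hp⟩
    | zero => exact ⟨1, hP.one_notMem, 0, by ext; simp, fun x y h => by simp⟩
    | add q q' _ _ hq hq' =>
      obtain ⟨s, hs, b, hb, hv⟩ := hq
      obtain ⟨s', hs', b', hb', hv'⟩ := hq'
      refine ⟨s * s', fun h => (hP.mem_or_mem h).elim hs hs',
        fun i => s' * b i + s * b' i, ?_, fun x y h => ?_⟩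
      · ext i
        have h1 := congrFun hb i
        have h2 := congrFun hb' i
        simp only [Pi.smul_apply, smul_eq_mul, map_add, map_mul, Pi.add_apply] at h1 h2 ⊢
        rw [h1, h2]
        ring
      · simp only [map_add, map_mul, add_mul, Finset.sum_add_distrib, mul_assoc,
          ← Finset.mul_sum, hv x y h, hv' x y h, mul_zero, add_zero]
    | smul c q _ hq =>
      obtain ⟨s, hs, b, hb, hv⟩ := hq
      obtain ⟨s', hs', b', hb'⟩ := exists_toResidueField_eq_mul P c
      refine ⟨s * s', fun h => (hP.mem_or_mem h).elim hs hs', fun i => b' * b i, ?_,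
        fun x y h => ?_⟩
      · ext i
        have h1 := congrFun hb i
        simp only [Pi.smul_apply, smul_eq_mul, map_mul] at h1 ⊢
        rw [h1, hb']
        ring
      · simp only [map_mul, mul_assoc, ← Finset.mul_sum, hv x y h, mul_zero]
  obtain ⟨s, hs, b, hb, hv⟩ := key
  refine ⟨s, hs, fun x hx hsx y hS => ?_⟩
  have h1 : ∀ i, e x (b i) = e x s * e x (k i) := by
    intro i
    rw [← map_mul, ← sub_eq_zero, ← map_sub]
    refine hx _ ?_
    rw [← toResidueField_eq_zero_iff P, map_sub, sub_eq_zero, map_mul]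
    exact congrFun hb i
  have h2 := hv x y hS
  simp only [h1, mul_assoc, ← Finset.mul_sum] at h2
  exact (mul_eq_zero.mp h2).resolve_left hsx

end Spread

section Univariate

/-- A generator of a radical ideal is separable. -/
theorem separable_of_isRadical_span {K : Type*} [Field K] [CharZero K] {g : Polynomial K}
    (h0 : g ≠ 0) (hg : (Ideal.span {g}).IsRadical) : g.Separable :=
  PerfectField.separable_iff_squarefree.mpr
    ((isRadical_iff_span_singleton.mpr hg).squarefree h0)

/-- The elements whose product with `q` lies in the radical of `J`; geometrically, the closure of
the set of zeros of `J` at which `q` does not vanish. -/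
def radicalColon {R : Type*} [CommRing R] (J : Ideal R) (q : R) : Ideal R :=
  Submodule.comap (LinearMap.mulLeft R q) J.radical

theorem mem_radicalColon {R : Type*} [CommRing R] {J : Ideal R} {q x : R} :
    x ∈ radicalColon J q ↔ q * x ∈ J.radical := Iff.rfl

theorem isRadical_radicalColon {R : Type*} [CommRing R] (J : Ideal R) (q : R) :
    (radicalColon J q).IsRadical := by
  rintro x ⟨k, hk⟩
  rw [mem_radicalColon] at hk ⊢
  refine (Ideal.radical_isRadical J) ⟨k + 1, ?_⟩
  have : (q * x) ^ (k + 1) = q ^ k * x * (q * x ^ k) := by ring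
  rw [this]
  exact Ideal.mul_mem_left _ _ hk

/-- A generator `g` of the radical colon ideal shares no factor with `q`: dividing `g` by its
greatest common divisor with `q` gives another member of the ideal, so this divisor is a unit. -/
theorem isCoprime_of_span_eq_radicalColon {K : Type*} [Field K] {J : Ideal (Polynomial K)}
    {q g : Polynomial K} (hg : Ideal.span {g} = radicalColon J q) (h0 : g ≠ 0) :
    IsCoprime g q := by
  classical
  rw [← EuclideanDomain.gcd_isUnit_iff]
  obtain ⟨k, hk⟩ := EuclideanDomain.gcd_dvd_left g q
  obtain ⟨m, hm⟩ := EuclideanDomain.gcd_dvd_right g q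
  set d := EuclideanDomain.gcd g q
  have h1 : k ∈ radicalColon J q := by
    refine isRadical_radicalColon J q ⟨2, ?_⟩
    rw [mem_radicalColon]
    have h2 : q * g ∈ J.radical := by
      rw [← mem_radicalColon, ← hg]
      exact Ideal.mem_span_singleton_self g
    refine Ideal.radical_isRadical J ⟨2, ?_⟩
    have h3 : (q * k ^ 2) ^ 2 = (m * k ^ 3) * (q * g) := by
      rw [hk]
      conv_lhs => rw [sq, mul_assoc]
      conv_lhs => rw [hm]
      conv_rhs => rw [hm]
      ring
    rw [h3]
    exact Ideal.mul_mem_left _ _ h2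
  rw [← hg, Ideal.mem_span_singleton] at h1
  obtain ⟨u, hu⟩ := h1
  refine IsUnit.of_mul_eq_one u ?_
  have hk0 : k ≠ 0 := by
    rintro rfl
    exact h0 (by rw [hk, mul_zero])
  refine mul_right_cancel₀ hk0 ?_
  rw [one_mul]
  conv_rhs => rw [hu, hk]
  ring

variable {A X : Type*} [CommRing A] (P : Ideal A) [hP : P.IsPrime] (e : X → A →+* ℂ)

theorem exists_span_map_eq (J : Ideal (Polynomial (FractionRing (A ⧸ P)))) :
    ∃ r : Polynomial A, Ideal.span {r.map (toResidueField P)} = J ∧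
      (r.map (toResidueField P)).natDegree = r.natDegree := by
  obtain ⟨g, hg⟩ := IsPrincipalIdealRing.principal J
  obtain ⟨s, hs, b, hb⟩ := exists_map_eq_C_mul P g
  obtain ⟨r, hr, hdeg⟩ := Polynomial.exists_degree_eq_of_mem_lifts
    ((Polynomial.mem_lifts _).mpr ⟨b, rfl⟩ : b.map (toResidueField P) ∈
      Polynomial.lifts (toResidueField P))
  refine ⟨r, ?_, ?_⟩
  · rw [hr, hb, hg]
    refine Ideal.span_singleton_mul_left_unit ?_ g
    exact Polynomial.isUnit_C.mpr (isUnit_iff_ne_zero.mpr (mt (toResidueField_eq_zero_iff P).mp hs))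
  · rw [hr]
    exact (Polynomial.natDegree_eq_of_degree_eq hdeg).symm

/-- Over some dense open part of an irreducible variety, the solutions of a system of equations and
an inequation in one further variable are all values of this variable, none, the zeros of a
square-free polynomial of positive constant degree, or the non-zeros of one. -/
theorem exists_generic_univariate [CharZero (FractionRing (A ⧸ P))] (E : Set (Polynomial A))
    (hE : E.Finite) (q : Polynomial A) : ∃ f ∉ P, ∃ r : Polynomial A,
      let good := {x | (∀ p ∈ P, e x p = 0) ∧ e x f ≠ 0}
      let Sol := fun x t => (∀ p ∈ E, (p.map (e x)).eval t = 0) ∧ (q.map (e x)).eval t ≠ 0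
      (∀ x ∈ good, ∀ t, ¬ Sol x t) ∨ (∀ x ∈ good, ∀ t, Sol x t) ∨
      (0 < r.natDegree ∧ (∀ x ∈ good, e x r.leadingCoeff ≠ 0 ∧
          ∀ t, (r.map (e x)).eval t = 0 → (r.derivative.map (e x)).eval t ≠ 0) ∧
        ((∀ x ∈ good, ∀ t, Sol x t ↔ (r.map (e x)).eval t = 0) ∨
          (∀ x ∈ good, ∀ t, Sol x t ↔ (r.map (e x)).eval t ≠ 0))) := by
  have hmul : ∀ {s s'}, s ∉ P → s' ∉ P → s * s' ∉ P := fun h h' hm =>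
    (hP.mem_or_mem hm).elim h h'
  have hmap : ∀ p : Polynomial A, p.map (toResidueField P) = 0 → ∀ x, (∀ p ∈ P, e x p = 0) →
      p.map (e x) = 0 := by
    intro p hp x hx
    ext i
    rw [Polynomial.coeff_map, Polynomial.coeff_zero]
    refine hx _ ((toResidueField_eq_zero_iff P).mp ?_)
    rw [← Polynomial.coeff_map, hp, Polynomial.coeff_zero]
  -- the degree of a polynomial with the same degree over the residue field
  have hlead : ∀ r : Polynomial A, r.map (toResidueField P) ≠ 0 →
      (r.map (toResidueField P)).natDegree = r.natDegree → r.leadingCoeff ∉ P := by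
    intro r h0 hdeg h
    have h1 := Polynomial.leadingCoeff_ne_zero.mpr h0
    rw [Polynomial.leadingCoeff, hdeg, Polynomial.coeff_map] at h1
    exact h1 ((toResidueField_eq_zero_iff P).mpr h)
  have hconst : ∀ r : Polynomial A, r.natDegree = 0 → ∀ x t,
      (r.map (e x)).eval t = e x r.leadingCoeff := by
    intro r hr x t
    rw [Polynomial.eq_C_of_natDegree_eq_zero hr]
    simp
  have hsep : ∀ r : Polynomial A, r.map (toResidueField P) ≠ 0 →
      (Ideal.span {r.map (toResidueField P)}).IsRadical →
      ∃ s ∉ P, ∀ x, (∀ p ∈ P, e x p = 0) → e x s ≠ 0 → ∀ t,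
        (r.map (e x)).eval t = 0 → (r.derivative.map (e x)).eval t ≠ 0 := by
    intro r h0 hrad
    obtain ⟨a, b, hab⟩ := separable_of_isRadical_span h0 hrad
    obtain ⟨s, hs, h⟩ := exists_eval_eq_zero_of_mem_span P e {r, r.derivative} 1 (by
      rw [Polynomial.map_one, Set.image_pair, ← Polynomial.derivative_map,
        Ideal.mem_span_pair]
      exact ⟨a, b, hab⟩)
    refine ⟨s, hs, fun x hx hsx t h1 h2 => ?_⟩
    have := h x hx hsx t (by simp [h1, h2])
    simp at this
  by_cases hEz : ∀ p ∈ E, p.map (toResidueField P) = 0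
  · -- only the inequation matters generically
    obtain ⟨r, hr, hdeg⟩ := exists_span_map_eq P (Ideal.span {q.map (toResidueField P)}).radical
    have hrad : (Ideal.span {r.map (toResidueField P)}).IsRadical :=
      hr ▸ Ideal.radical_isRadical _
    by_cases h0 : r.map (toResidueField P) = 0
    · have hq : q.map (toResidueField P) = 0 := by
        have h1 : q.map (toResidueField P) ∈ (Ideal.span {q.map (toResidueField P)}).radical :=
          Ideal.le_radical (Ideal.mem_span_singleton_self _)
        rw [← hr, h0] at h1
        simpa using h1
      refine ⟨1, hP.one_notMem, 0, Or.inl ?_⟩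
      rintro x ⟨hx, -⟩ t ⟨-, h⟩
      exact h (by rw [hmap q hq x hx, Polynomial.eval_zero])
    have hl := hlead r h0 hdeg
    obtain ⟨s₁, hs₁, h₁⟩ := hsep r h0 hrad
    obtain ⟨s₂, hs₂, h₂⟩ := exists_eval_eq_zero_of_mem_span P e {r} q (by
      rw [Set.image_singleton, hr]
      exact Ideal.le_radical (Ideal.mem_span_singleton_self _))
    obtain ⟨N, hN⟩ : ∃ N, (r.map (toResidueField P)) ^ N ∈
        Ideal.span {q.map (toResidueField P)} := by
      have : r.map (toResidueField P) ∈ (Ideal.span {q.map (toResidueField P)}).radical := by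
        rw [← hr]
        exact Ideal.mem_span_singleton_self _
      exact this
    obtain ⟨s₃, hs₃, h₃⟩ := exists_eval_eq_zero_of_mem_span P e {q} (r ^ N) (by
      rw [Set.image_singleton, Polynomial.map_pow]
      exact hN)
    have hSol : ∀ x, (∀ p ∈ P, e x p = 0) → e x s₂ ≠ 0 → e x s₃ ≠ 0 → ∀ t,
        (((∀ p ∈ E, (p.map (e x)).eval t = 0) ∧ (q.map (e x)).eval t ≠ 0) ↔
          (r.map (e x)).eval t ≠ 0) := by
      intro x hx hx₂ hx₃ t
      have hq : (q.map (e x)).eval t = 0 ↔ (r.map (e x)).eval t = 0 := by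
        constructor
        · intro h
          have := h₃ x hx hx₃ t (by simpa using h)
          rw [Polynomial.map_pow, Polynomial.eval_pow] at this
          exact eq_zero_of_pow_eq_zero this
        · intro h
          exact h₂ x hx hx₂ t (by simpa using h)
      rw [Ne, hq]
      refine and_iff_right fun p hp => ?_
      rw [hmap p (hEz p hp) x hx, Polynomial.eval_zero]
    refine ⟨r.leadingCoeff * (s₁ * (s₂ * s₃)), hmul hl (hmul hs₁ (hmul hs₂ hs₃)), r, ?_⟩
    simp only [Set.mem_ofPred_eq, map_mul, mul_ne_zero_iff]
    refine Or.inr ?_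
    rcases Nat.eq_zero_or_pos r.natDegree with hd | hd
    · refine Or.inl fun x hx t => (hSol x hx.1 hx.2.2.2.1 hx.2.2.2.2 t).mpr ?_
      rw [hconst r hd]
      exact hx.2.1
    · exact Or.inr ⟨hd, fun x hx => ⟨hx.2.1, h₁ x hx.1 hx.2.2.1⟩,
        Or.inr fun x hx t => hSol x hx.1 hx.2.2.2.1 hx.2.2.2.2 t⟩
  · push Not at hEz
    obtain ⟨p₀, hp₀, hp₀0⟩ := hEz
    set J := Ideal.span ((fun p => Polynomial.map (toResidueField P) p) '' E) with hJ
    obtain ⟨r, hr, hdeg⟩ := exists_span_map_eq P (radicalColon J (q.map (toResidueField P)))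
    have hrad : (Ideal.span {r.map (toResidueField P)}).IsRadical :=
      hr ▸ isRadical_radicalColon _ _
    have hmem : ∀ p ∈ E, p.map (toResidueField P) ∈ Ideal.span {r.map (toResidueField P)} := by
      intro p hp
      rw [hr, mem_radicalColon]
      exact Ideal.mul_mem_left _ _ (Ideal.le_radical (Ideal.subset_span ⟨p, hp, rfl⟩))
    have h0 : r.map (toResidueField P) ≠ 0 := by
      intro h
      have := hmem p₀ hp₀
      rw [h] at this
      exact hp₀0 (by simpa using this)
    have hl := hlead r h0 hdeg
    obtain ⟨s₁, hs₁, h₁⟩ := hsep r h0 hrad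
    obtain ⟨s₂, hs₂, h₂⟩ : ∃ s ∉ P, ∀ x, (∀ p ∈ P, e x p = 0) → e x s ≠ 0 → ∀ t,
        (r.map (e x)).eval t = 0 → ∀ p ∈ E, (p.map (e x)).eval t = 0 := by
      have h1 := fun p : E => exists_eval_eq_zero_of_mem_span P e {r} p.1 (by
        rw [Set.image_singleton]
        exact hmem p.1 p.2)
      choose s hs h using h1
      have := hE.fintype
      refine ⟨∏ p, s p, fun hm => ?_, fun x hx hsx t h2 p hp => ?_⟩
      · obtain ⟨p, -, hp⟩ := (Ideal.IsPrime.prod_mem_iff (hp := hP)).mp hm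
        exact hs p hp
      · rw [map_prod, Finset.prod_ne_zero_iff] at hsx
        exact h ⟨p, hp⟩ x hx (hsx _ (Finset.mem_univ _)) t (by simpa using h2)
    obtain ⟨s₃, hs₃, h₃⟩ := exists_eval_eq_zero_of_mem_span P e {r, q} 1 (by
      rw [Polynomial.map_one, Set.image_pair, Ideal.mem_span_pair]
      exact isCoprime_of_span_eq_radicalColon hr h0)
    obtain ⟨N, hN⟩ : ∃ N, (q.map (toResidueField P) * r.map (toResidueField P)) ^ N ∈ J := by
      have h1 : r.map (toResidueField P) ∈ radicalColon J (q.map (toResidueField P)) := by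
        rw [← hr]
        exact Ideal.mem_span_singleton_self _
      exact mem_radicalColon.mp h1
    obtain ⟨s₄, hs₄, h₄⟩ := exists_eval_eq_zero_of_mem_span P e E ((q * r) ^ N) (by
      rw [Polynomial.map_pow, Polynomial.map_mul]
      exact hN)
    have hSol : ∀ x, (∀ p ∈ P, e x p = 0) → e x s₂ ≠ 0 → e x s₃ ≠ 0 → e x s₄ ≠ 0 → ∀ t,
        (((∀ p ∈ E, (p.map (e x)).eval t = 0) ∧ (q.map (e x)).eval t ≠ 0) ↔
          (r.map (e x)).eval t = 0) := by
      intro x hx hx₂ hx₃ hx₄ t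
      constructor
      · rintro ⟨h5, h6⟩
        have := h₄ x hx hx₄ t h5
        rw [Polynomial.map_pow, Polynomial.map_mul, Polynomial.eval_pow,
          Polynomial.eval_mul] at this
        exact (mul_eq_zero.mp (eq_zero_of_pow_eq_zero this)).resolve_left h6
      · intro h5
        refine ⟨h₂ x hx hx₂ t h5, fun h6 => ?_⟩
        have := h₃ x hx hx₃ t (by simp [h5, h6])
        simp at this
    refine ⟨r.leadingCoeff * (s₁ * (s₂ * (s₃ * s₄))),
      hmul hl (hmul hs₁ (hmul hs₂ (hmul hs₃ hs₄))), r, ?_⟩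
    simp only [Set.mem_ofPred_eq, map_mul, mul_ne_zero_iff]
    rcases Nat.eq_zero_or_pos r.natDegree with hd | hd
    · refine Or.inl fun x hx t h => ?_
      have := (hSol x hx.1 hx.2.2.2.1 hx.2.2.2.2.1 hx.2.2.2.2.2 t).mp h
      rw [hconst r hd] at this
      exact hx.2.1 this
    · exact Or.inr (Or.inr ⟨hd, fun x hx => ⟨hx.2.1, h₁ x hx.1 hx.2.2.1⟩,
        Or.inl fun x hx t => hSol x hx.1 hx.2.2.2.1 hx.2.2.2.2.1 hx.2.2.2.2.2 t⟩)

end Univariate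

/-! ### Existence of Thomas decompositions -/

section Existence
variable {σ : Type*} {lt : σ → σ → Prop}

/-- All members of the system are polynomials in the variables of `D`. -/
def AlgSystem.SupportedIn (D : Set σ) (T : AlgSystem σ) : Prop :=
  ∀ r, r ∈ T.eqs ∨ r ∈ T.ineqs → r ∈ supported ℂ D

theorem AlgSystem.SupportedIn.mono {D D' : Set σ} (h : D ⊆ D') {T : AlgSystem σ}
    (hT : T.SupportedIn D) : T.SupportedIn D' := fun r hr => supported_mono h (hT r hr)

theorem AlgSystem.IsSimple.solBelow_subset_sol {D : Set σ} {v : σ} {T : AlgSystem σ}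
    (hT : T.IsSimple lt) (hTD : T.SupportedIn D) (hD : ∀ w ∈ D, lt w v) :
    T.solBelow lt v ⊆ T.sol := by
  intro a ha
  refine ⟨fun p hp => ?_, fun q hq => ?_⟩
  · obtain ⟨w, hw⟩ := hT.nonconstant p (Or.inl hp)
    exact ha.1 p hp w hw (hD w (mem_supported.mp (hTD p (Or.inl hp)) hw.1))
  · obtain ⟨w, hw⟩ := hT.nonconstant q (Or.inr hq)
    exact ha.2 q hq w hw (hD w (mem_supported.mp (hTD q (Or.inr hq)) hw.1))

variable [IsStrictTotalOrder σ lt]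

/-- A simple system in the variables of `D` can be extended by an equation, or by an inequation,
in one further variable `v`. -/
theorem AlgSystem.IsSimple.isDecomposable_inter_ofUnivariate {D : Set σ} {v : σ}
    {T : AlgSystem σ} (hT : T.IsSimple lt) (hTD : T.SupportedIn D) (hD : ∀ w ∈ D, lt w v)
    (hv : v ∉ D) {r : Polynomial (supported ℂ D)} (hr : 0 < r.natDegree)
    (hgood : ∀ a ∈ T.sol, evalSupported D a r.leadingCoeff ≠ 0 ∧
      ∀ t, (r.map (evalSupported D a)).eval t = 0 →
        (r.derivative.map (evalSupported D a)).eval t ≠ 0) :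
    IsDecomposable lt (AlgSystem.SupportedIn (insert v D))
      (T.sol ∩ {a | eval a (ofUnivariate D v r) = 0}) ∧
    IsDecomposable lt (AlgSystem.SupportedIn (insert v D))
      (T.sol ∩ {a | eval a (ofUnivariate D v r) ≠ 0}) := by
  classical
  by_cases hne : T.sol.Nonempty
  · obtain ⟨a₀, ha₀⟩ := hne
    have hlead := (isLeader_ofUnivariate hD hv hr (hgood a₀ ha₀).1).1
    have hbelow := hT.solBelow_subset_sol hTD hD
    have hno : ∀ r', r' ∈ T.eqs ∨ r' ∈ T.ineqs → ¬ IsLeader lt r' v := fun r' hr' h =>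
      hv (mem_supported.mp (hTD r' hr') h.1)
    have hinit : ∀ a ∈ T.solBelow lt v, eval a (initialAt (ofUnivariate D v r) v) ≠ 0 :=
      fun a ha => (isLeader_ofUnivariate hD hv hr (hgood a (hbelow ha)).1).2
    have hsq : ∀ a ∈ T.solBelow lt v, eval a (ofUnivariate D v r) = 0 →
        eval a (pderiv v (ofUnivariate D v r)) ≠ 0 := by
      intro a ha h0
      rw [eval_ofUnivariate hv] at h0
      rw [eval_pderiv_ofUnivariate hv]
      exact (hgood a (hbelow ha)).2 _ h0
    have hmem := ofUnivariate_mem_supported (v := v) r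
    have hTD' := hTD.mono (Set.subset_insert v D)
    constructor
    · rw [← AlgSystem.sol_insertEq]
      refine (hT.insertEq hlead hno hinit hsq).isDecomposable fun r' hr' => ?_
      simp only [AlgSystem.insertEq, Finset.mem_insert] at hr'
      rcases hr' with (rfl | h) | h
      exacts [hmem, hTD' r' (Or.inl h), hTD' r' (Or.inr h)]
    · rw [← AlgSystem.sol_insertIneq]
      refine (hT.insertIneq hlead hno hinit hsq).isDecomposable fun r' hr' => ?_
      simp only [AlgSystem.insertIneq, Finset.mem_insert] at hr'
      rcases hr' with h | rfl | h
      exacts [hTD' r' (Or.inl h), hmem, hTD' r' (Or.inr h)]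
  · rw [Set.not_nonempty_iff_eq_empty] at hne
    rw [hne, Set.empty_inter, Set.empty_inter]
    exact ⟨isDecomposable_empty _, isDecomposable_empty _⟩

/-- A basic constructible set is the solution set of finitely many equations and inequations. -/
theorem setOf_ideal_eq_zero_and_ne_zero {D : Set σ} [Finite σ] (P : Ideal (supported ℂ D))
    (f : supported ℂ D) : ∃ E Q : Finset (MvPolynomial σ ℂ),
      (∀ p ∈ E, p ∈ supported ℂ D) ∧ (∀ q ∈ Q, q ∈ supported ℂ D) ∧
      {a | (∀ p ∈ E, eval a p = 0) ∧ ∀ q ∈ Q, eval a q ≠ 0} =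
        {a | (∀ p ∈ P, evalSupported D a p = 0) ∧ evalSupported D a f ≠ 0} := by
  classical
  obtain ⟨G, hG⟩ := (isNoetherianRing_iff_ideal_fg _).mp inferInstance P
  refine ⟨G.image Subtype.val, {f.1}, ?_, ?_, ?_⟩
  · intro p hp
    obtain ⟨g, -, rfl⟩ := Finset.mem_image.mp hp
    exact g.2
  · intro q hq
    rw [Finset.mem_singleton.mp hq]
    exact f.2
  · ext a
    have h1 : (∀ p ∈ P, evalSupported D a p = 0) ↔ ∀ p ∈ G, evalSupported D a p = 0 := by
      have h2 : (∀ p ∈ P, evalSupported D a p = 0) ↔ P ≤ RingHom.ker (evalSupported D a) :=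
        Iff.rfl
      rw [h2, ← hG]
      exact Ideal.span_le
    simp only [Set.mem_ofPred_eq, h1, Finset.forall_mem_image, Finset.mem_singleton, forall_eq]
    rfl

/-- Every system in the variables of an initial segment has a Thomas decomposition into systems in
these variables. The variables are treated from the greatest to the least; over a dense open part
of each irreducible constructible set of the lower coordinates, the system amounts to a single
square-free equation or inequation in the greatest variable. -/
theorem isDecomposable_of_supported [Finite σ] (D : Finset σ)
    (hD : ∀ v ∈ D, ∀ w, lt w v → w ∈ D) (E Q : Finset (MvPolynomial σ ℂ))
    (hE : ∀ p ∈ E, p ∈ supported ℂ (D : Set σ)) (hQ : ∀ q ∈ Q, q ∈ supported ℂ (D : Set σ)) :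
    IsDecomposable lt (AlgSystem.SupportedIn (D : Set σ))
      {a | (∀ p ∈ E, eval a p = 0) ∧ ∀ q ∈ Q, eval a q ≠ 0} := by
  classical
  induction hn : D.card generalizing D E Q with
  | zero =>
    rw [Finset.card_eq_zero] at hn
    subst hn
    have hconst : ∀ p ∈ supported ℂ ((∅ : Finset σ) : Set σ), ∀ a b, eval a p = eval b p := by
      intro p hp a b
      refine eval_congr_of_vars fun w hw => ?_
      simpa using mem_supported.mp hp hw
    by_cases h : (∀ p ∈ E, eval 0 p = 0) ∧ ∀ q ∈ Q, eval 0 q ≠ 0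
    · have h1 : {a | (∀ p ∈ E, eval a p = 0) ∧ ∀ q ∈ Q, eval a q ≠ 0} =
          (⟨∅, ∅⟩ : AlgSystem σ).sol := by
        ext a
        simp only [Set.mem_ofPred_eq, AlgSystem.sol, Finset.notMem_empty, false_imp_iff,
          implies_true, and_self, iff_true]
        exact ⟨fun p hp => (hconst p (hE p hp) a 0).trans (h.1 p hp),
          fun q hq => by rw [hconst q (hQ q hq) a 0]; exact h.2 q hq⟩
      rw [h1]
      refine AlgSystem.IsSimple.isDecomposable ⟨?_, ?_, ?_, ?_, ?_⟩ ?_ <;>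
        simp [AlgSystem.SupportedIn]
    · have h1 : {a | (∀ p ∈ E, eval a p = 0) ∧ ∀ q ∈ Q, eval a q ≠ 0} = ∅ := by
        ext a
        simp only [Set.mem_ofPred_eq, Set.mem_empty_iff_false, iff_false]
        rintro ⟨h1, h2⟩
        exact h ⟨fun p hp => (hconst p (hE p hp) 0 a).trans (h1 p hp),
          fun q hq => by rw [hconst q (hQ q hq) 0 a]; exact h2 q hq⟩
      rw [h1]
      exact isDecomposable_empty _
  | succ k ih =>
    have hne : (D : Set σ).Nonempty := by
      rw [Finset.coe_nonempty, ← Finset.card_pos]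
      omega
    obtain ⟨v, hvD, hmax⟩ :=
      (Finite.wellFounded_of_trans_of_irrefl (Function.swap lt)).has_min _ hne
    let D' : Finset σ := D.erase v
    have hlt : ∀ w ∈ (D' : Set σ), lt w v := by
      intro w hw
      have hw' := Finset.mem_erase.mp hw
      rcases trichotomous_of lt w v with h | h | h
      · exact h
      · exact absurd h hw'.1
      · exact absurd h (hmax w hw'.2)
    have hvD' : v ∉ (D' : Set σ) := fun h => (Finset.mem_erase.mp h).1 rfl
    have hins : insert v (D' : Set σ) = (D : Set σ) := by
      rw [← Finset.coe_insert, Finset.insert_erase hvD]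
    have ih' := ih D' (fun w hw u hu => Finset.mem_erase.mpr
      ⟨by rintro rfl; exact asymm_of lt hu (hlt w hw), hD w (Finset.mem_of_mem_erase hw) u hu⟩)
    have hcard : D'.card = k := by
      rw [Finset.card_erase_of_mem hvD, hn]
      rfl
    let A := supported ℂ (D' : Set σ)
    rw [← hins] at hE hQ ⊢
    have hlift : ∀ p : MvPolynomial σ ℂ, ∃ r : Polynomial A,
        p ∈ supported ℂ (insert v (D' : Set σ)) → ofUnivariate (D' : Set σ) v r = p := by
      intro p
      by_cases hp : p ∈ supported ℂ (insert v (D' : Set σ))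
      · obtain ⟨r, hr⟩ := exists_ofUnivariate_eq hp
        exact ⟨r, fun _ => hr⟩
      · exact ⟨0, fun h => absurd h hp⟩
    choose g hg using hlift
    set C : Set (σ → ℂ) := {a | (∀ p ∈ E, eval a p = 0) ∧ ∀ q ∈ Q, eval a q ≠ 0} with hC
    have hgen := constructible_induction (A := A) (evalSupported (D' : Set σ))
      (fun Z => ∀ x : A, IsDecomposable lt (AlgSystem.SupportedIn (insert v (D' : Set σ)))
        ((Z ∩ {a | evalSupported (D' : Set σ) a x ≠ 0}) ∩ C))
      (fun x => by
        rw [Set.empty_inter, Set.empty_inter]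
        exact isDecomposable_empty _)
      (fun Z Z' hZ h h' x => by
        rw [Set.union_inter_distrib_right, Set.union_inter_distrib_right]
        refine (h x).union ?_ (h' x)
        exact hZ.mono (Set.inter_subset_left.trans Set.inter_subset_left)
          (Set.inter_subset_left.trans Set.inter_subset_left))
      (fun Z f h x => by
        convert h (f * x) using 2
        ext a
        simp only [Set.mem_inter_iff, Set.mem_ofPred_eq, map_mul, mul_ne_zero_iff]
        tauto)
      (fun P hP => by
        have : CharZero (FractionRing (A ⧸ P)) :=
          charZero_of_injective_algebraMap (algebraMap ℂ (FractionRing (A ⧸ P))).injective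
        obtain ⟨f, hf, r, hr⟩ := exists_generic_univariate P (evalSupported (D' : Set σ))
          (g '' (E : Set (MvPolynomial σ ℂ))) (E.finite_toSet.image g) (∏ q ∈ Q, g q)
        have hSol : ∀ a, a ∈ C ↔ (∀ p ∈ g '' (E : Set (MvPolynomial σ ℂ)),
            (p.map (evalSupported (D' : Set σ) a)).eval (a v) = 0) ∧
            ((∏ q ∈ Q, g q).map (evalSupported (D' : Set σ) a)).eval (a v) ≠ 0 := by
          intro a
          rw [Set.forall_mem_image, Polynomial.map_prod, Polynomial.eval_prod,
            Finset.prod_ne_zero_iff]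
          refine and_congr (forall₂_congr fun p hp => ?_) (forall₂_congr fun q hq => ?_)
          · rw [← eval_ofUnivariate hvD', hg p (hE p hp)]
          · rw [← eval_ofUnivariate hvD', hg q (hQ q hq)]
        refine ⟨f, hf, fun x => ?_⟩
        obtain ⟨E', Q', hE', hQ', hEQ⟩ := setOf_ideal_eq_zero_and_ne_zero P (f * x)
        have hbase := ih' E' Q' hE' hQ' hcard
        rw [hEQ] at hbase
        have hset : {a | (∀ p ∈ P, evalSupported (D' : Set σ) a p = 0) ∧
              evalSupported (D' : Set σ) a f ≠ 0} ∩ {a | evalSupported (D' : Set σ) a x ≠ 0} =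
            {a | (∀ p ∈ P, evalSupported (D' : Set σ) a p = 0) ∧
              evalSupported (D' : Set σ) a (f * x) ≠ 0} := by
          ext a
          simp only [Set.mem_inter_iff, Set.mem_ofPred_eq, map_mul, mul_ne_zero_iff]
          tauto
        rw [hset]
        refine hbase.inter fun T hT hTD hTs => ?_
        have hTgood : ∀ a ∈ T.sol, a ∈ {a | (∀ p ∈ P, evalSupported (D' : Set σ) a p = 0) ∧
            evalSupported (D' : Set σ) a f ≠ 0} := by
          intro a ha
          have := hTs ha
          simp only [Set.mem_ofPred_eq, map_mul, mul_ne_zero_iff] at this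
          exact ⟨this.1, this.2.1⟩
        rcases hr with hr | hr | ⟨hdeg, hgood, hr | hr⟩
        · have h1 : T.sol ∩ C = ∅ := by
            ext a
            simp only [Set.mem_inter_iff, Set.mem_empty_iff_false, iff_false, not_and]
            exact fun ha h => hr a (hTgood a ha) (a v) ((hSol a).mp h)
          rw [h1]
          exact isDecomposable_empty _
        · have h1 : T.sol ∩ C = T.sol :=
            Set.inter_eq_left.mpr fun a ha => (hSol a).mpr (hr a (hTgood a ha) (a v))
          rw [h1]
          exact hT.isDecomposable (hTD.mono (Set.subset_insert _ _))
        · have h1 : T.sol ∩ C = T.sol ∩ {a | eval a (ofUnivariate (D' : Set σ) v r) = 0} := by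
            ext a
            refine and_congr_right fun ha =>
              (hSol a).trans ((hr a (hTgood a ha) (a v)).trans ?_)
            rw [Set.mem_ofPred_eq, eval_ofUnivariate hvD']
          rw [h1]
          exact (hT.isDecomposable_inter_ofUnivariate hTD hlt hvD' hdeg
            fun a ha => hgood a (hTgood a ha)).1
        · have h1 : T.sol ∩ C = T.sol ∩ {a | eval a (ofUnivariate (D' : Set σ) v r) ≠ 0} := by
            ext a
            refine and_congr_right fun ha =>
              (hSol a).trans ((hr a (hTgood a ha) (a v)).trans ?_)
            rw [Set.mem_ofPred_eq, eval_ofUnivariate hvD']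
          rw [h1]
          exact (hT.isDecomposable_inter_ofUnivariate hTD hlt hvD' hdeg
            fun a ha => hgood a (hTgood a ha)).2)
      ⊥ 1
    convert hgen using 1
    ext a
    simp

end Existence

/-! ### Echelon forms and linear systems -/

section Echelon
variable {K ι : Type*} [Field K] {lt : ι → ι → Prop} [IsStrictTotalOrder ι lt]

/-- The pivots of a space of vectors: the indices of the last non-zero coordinates of its
members. -/
def pivots (lt : ι → ι → Prop) (W : Submodule K (ι → K)) : Set ι :=
  {v | ∃ w ∈ W, w v ≠ 0 ∧ ∀ u, lt v u → w u = 0}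

theorem exists_last_ne_zero [Finite ι] {x : ι → K} (hx : x ≠ 0) :
    ∃ v, x v ≠ 0 ∧ ∀ u, lt v u → x u = 0 := by
  obtain ⟨v₀, hv₀⟩ := Function.ne_iff.mp hx
  obtain ⟨v, hv, hmax⟩ := (Finite.wellFounded_of_trans_of_irrefl (Function.swap lt)).has_min
    {v | x v ≠ 0} ⟨v₀, hv₀⟩
  refine ⟨v, hv, fun u hu => ?_⟩
  by_contra h
  exact hmax u h hu

/-- Vectors of `W` in echelon form, one for each pivot, span `W`. -/
theorem le_span_pivots [Finite ι] (W : Submodule K (ι → K)) (w : ι → ι → K)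
    (hw : ∀ v ∈ pivots lt W, w v ∈ W ∧ w v v ≠ 0 ∧ ∀ u, lt v u → w v u = 0) :
    W ≤ Submodule.span K (w '' pivots lt W) := by
  have key : ∀ v, ∀ x ∈ W, (∀ u, lt v u → x u = 0) → x ∈ Submodule.span K (w '' pivots lt W) := by
    intro v
    induction v using (Finite.wellFounded_of_trans_of_irrefl lt).induction with
    | _ v ih =>
    have hzero : ∀ x ∈ W, (∀ u, lt v u → x u = 0) → x v = 0 →
        x ∈ Submodule.span K (w '' pivots lt W) := by
      intro x hx hxv hx0
      by_cases h0 : x = 0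
      · rw [h0]
        exact Submodule.zero_mem _
      · obtain ⟨u, hu, hlast⟩ := exists_last_ne_zero (lt := lt) h0
        refine ih u ?_ x hx hlast
        rcases trichotomous_of lt u v with h | rfl | h
        · exact h
        · exact absurd hx0 hu
        · exact absurd (hxv u h) hu
    intro x hx hxv
    by_cases hx0 : x v = 0
    · exact hzero x hx hxv hx0
    · have hv : v ∈ pivots lt W := ⟨x, hx, hx0, hxv⟩
      obtain ⟨h1, h2, h3⟩ := hw v hv
      have h4 := hzero (x - (x v / w v v) • w v) (W.sub_mem hx (W.smul_mem _ h1))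
        (fun u hu => by simp [hxv u hu, h3 u hu]) (by simp [h2])
      have h5 := Submodule.add_mem _ h4
        (Submodule.smul_mem _ (x v / w v v) (Submodule.subset_span ⟨v, hv, rfl⟩))
      rwa [sub_add_cancel] at h5
  intro x hx
  by_cases h0 : x = 0
  · rw [h0]
    exact Submodule.zero_mem _
  · obtain ⟨v, -, hv⟩ := exists_last_ne_zero (lt := lt) h0
    exact key v x hx hv

/-- Gaussian elimination: vectors in echelon form, one for each pivot, are a basis. -/
theorem finrank_eq_ncard_pivots [Finite ι] (W : Submodule K (ι → K)) :
    Module.finrank K W = (pivots lt W).ncard := by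
  classical
  have h : ∀ v, ∃ w : ι → K, v ∈ pivots lt W → w ∈ W ∧ w v ≠ 0 ∧ ∀ u, lt v u → w u = 0 := by
    intro v
    by_cases hv : v ∈ pivots lt W
    · obtain ⟨w, h1, h2, h3⟩ := hv
      exact ⟨w, fun _ => ⟨h1, h2, h3⟩⟩
    · exact ⟨0, fun h => absurd h hv⟩
  choose w hw using h
  have hspan : W = Submodule.span K (Set.range fun v : pivots lt W => w v) := by
    apply le_antisymm
    · rw [← Set.image_eq_range]
      exact le_span_pivots W w hw
    · rw [Submodule.span_le]
      rintro _ ⟨v, rfl⟩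
      exact (hw v v.2).1
  have := Fintype.ofFinite (pivots lt W)
  have hli : LinearIndependent K fun v : pivots lt W => w v := by
    rw [Fintype.linearIndependent_iff]
    intro c hc
    by_contra hne
    have hne' : {v : ι | ∃ h : v ∈ pivots lt W, c ⟨v, h⟩ ≠ 0}.Nonempty := by
      push Not at hne
      obtain ⟨v, hv⟩ := hne
      exact ⟨v, v.2, hv⟩
    obtain ⟨v, ⟨hv, hcv⟩, hmax⟩ :=
      (Finite.wellFounded_of_trans_of_irrefl (Function.swap lt)).has_min _ hne'
    have h1 := congrFun hc v
    rw [Finset.sum_apply, Finset.sum_eq_single ⟨v, hv⟩] at h1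
    · exact mul_ne_zero hcv (hw v hv).2.1 h1
    · rintro ⟨u, hu⟩ _ huv
      by_cases hcu : c ⟨u, hu⟩ = 0
      · simp [hcu]
      · rcases trichotomous_of lt u v with h | h | h
        · simp [(hw u hu).2.2 v h]
        · exact absurd (Subtype.ext h) huv
        · exact absurd h (hmax u ⟨hu, hcu⟩)
    · exact fun h => absurd (Finset.mem_univ _) h
  rw [hspan, finrank_span_eq_card hli, ← hspan, Set.ncard_eq_toFinset_card', Set.toFinset_card]

end Echelon

section Linear
variable {σ : Type*} [Fintype σ] {lt : σ → σ → Prop}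

/-- The linear form with the given coefficients in the variables. -/
def linearForm (b : σ → MvPolynomial σ ℂ) : MvPolynomial σ ℂ := ∑ u, X u * b u

theorem eval_linearForm (b : σ → MvPolynomial σ ℂ) (a : σ → ℂ) :
    eval a (linearForm b) = ∑ u, eval a (b u) * a u := by
  simp [linearForm, mul_comm]

theorem exists_ofUnivariate_eq_linearForm {v : σ} {b : σ → MvPolynomial σ ℂ}
    (hb : ∀ u, b u ∈ supported ℂ {w | lt w v}) (hlast : ∀ u, u ≠ v → ¬ lt u v → b u = 0) :
    ∃ c : supported ℂ {w | lt w v}, ofUnivariate {w | lt w v} v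
      (Polynomial.C ⟨b v, hb v⟩ * Polynomial.X + Polynomial.C c) = linearForm b := by
  classical
  refine ⟨⟨∑ u ∈ Finset.univ.erase v, X u * b u, Subalgebra.sum_mem _ fun u hu => ?_⟩, ?_⟩
  · by_cases h : lt u v
    · exact Subalgebra.mul_mem _ (X_mem_supported.mpr h) (hb u)
    · rw [hlast u (Finset.ne_of_mem_erase hu) h, mul_zero]
      exact Subalgebra.zero_mem _
  · rw [linearForm, ← Finset.add_sum_erase _ _ (Finset.mem_univ v), ofUnivariate, map_add,
      map_mul, Polynomial.aeval_C, Polynomial.aeval_C, Polynomial.aeval_X, mul_comm (X v)]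
    rfl

variable [IsStrictTotalOrder σ lt]

/-- Linear equations with pivots outside of `D`, whose leading coefficients do not vanish at the
solutions of a simple system in the variables of `D`, extend this system to a simple one. -/
theorem AlgSystem.IsSimple.exists_insert_linearForms {D : Set σ} {T : AlgSystem σ}
    (hT : T.IsSimple lt) (hTD : T.SupportedIn D) (hD : ∀ v ∈ D, ∀ w, lt w v → w ∈ D)
    (hne : T.sol.Nonempty) (V : Finset σ) (b : σ → σ → MvPolynomial σ ℂ)
    (hV : ∀ v ∈ V, v ∉ D) (hb : ∀ v ∈ V, ∀ u, b v u ∈ supported ℂ D)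
    (hlast : ∀ v ∈ V, ∀ u, lt v u → b v u = 0)
    (hpiv : ∀ v ∈ V, ∀ a ∈ T.sol, eval a (b v v) ≠ 0) :
    ∃ T' : AlgSystem σ, T'.IsSimple lt ∧ T'.ineqs = T.ineqs ∧ T.eqs ⊆ T'.eqs ∧
      (∀ r ∈ T'.eqs, r ∈ T.eqs ∨ ∃ v ∈ V, IsLeader lt r v) ∧
      T'.sol = T.sol ∩ {a | ∀ v ∈ V, eval a (linearForm (b v)) = 0} := by
  classical
  induction V using Finset.induction_on with
  | empty => exact ⟨T, hT, rfl, subset_rfl, fun r hr => Or.inl hr, by simp⟩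
  | insert v V hvV ih =>
    obtain ⟨T', hT', hineqs, hsub, heqs, hsol⟩ := ih (fun u hu => hV u (by simp [hu]))
      (fun u hu => hb u (by simp [hu])) (fun u hu => hlast u (by simp [hu]))
      (fun u hu => hpiv u (by simp [hu]))
    have hvD := hV v (by simp)
    have hDv : ∀ w ∈ D, lt w v := by
      intro w hw
      rcases trichotomous_of lt w v with h | rfl | h
      · exact h
      · exact absurd hw hvD
      · exact absurd (hD w hw v h) hvD
    have hvv : v ∉ {w | lt w v} := irrefl_of lt v
    have hb' : ∀ u, b v u ∈ supported ℂ {w | lt w v} := fun u =>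
      supported_mono hDv (hb v (by simp) u)
    obtain ⟨c, hc⟩ := exists_ofUnivariate_eq_linearForm hb' (fun u huv hlt => by
      rcases trichotomous_of lt u v with h | h | h
      · exact absurd h hlt
      · exact absurd h huv
      · exact hlast v (by simp) u h)
    have hbelow : ∀ a ∈ T'.solBelow lt v, a ∈ T.sol := by
      intro a ha
      refine hT.solBelow_subset_sol hTD hDv ⟨fun p hp => ha.1 p (hsub hp), ?_⟩
      exact fun q hq => ha.2 q (hineqs ▸ hq)
    set r := Polynomial.C (⟨b v v, hb' v⟩ : supported ℂ {w | lt w v}) * Polynomial.X +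
      Polynomial.C c with hr
    have hne0 : (⟨b v v, hb' v⟩ : supported ℂ {w | lt w v}) ≠ 0 := by
      obtain ⟨a, ha⟩ := hne
      intro h
      have h1 := hpiv v (by simp) a ha
      rw [show b v v = 0 from congrArg Subtype.val h, map_zero] at h1
      exact h1 rfl
    have hdeg : r.natDegree = 1 := Polynomial.natDegree_linear hne0
    have hlc : r.leadingCoeff = ⟨b v v, hb' v⟩ := Polynomial.leadingCoeff_linear hne0
    have hlead : ∀ a ∈ T.sol, IsLeader lt (ofUnivariate {w | lt w v} v r) v ∧
        eval a (initialAt (ofUnivariate {w | lt w v} v r) v) ≠ 0 := fun a ha =>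
      isLeader_ofUnivariate (fun w hw => hw) hvv (by omega) (by
        rw [hlc]
        exact hpiv v (by simp) a ha)
    obtain ⟨a₀, ha₀⟩ := hne
    have hno : ∀ r', r' ∈ T'.eqs ∨ r' ∈ T'.ineqs → ¬ IsLeader lt r' v := by
      have hT0 : ∀ r', r' ∈ T.eqs ∨ r' ∈ T.ineqs → ¬ IsLeader lt r' v := fun r' hr' h =>
        hvD (mem_supported.mp (hTD r' hr') h.1)
      rintro r' (h | h) hl
      · rcases heqs r' h with h | ⟨u, hu, hul⟩
        · exact hT0 r' (Or.inl h) hl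
        · exact hvV (hl.unique hul ▸ hu)
      · exact hT0 r' (Or.inr (hineqs ▸ h)) hl
    have hsimple := hT'.insertEq (hlead a₀ ha₀).1 hno
      (fun a ha => (hlead a (hbelow a ha)).2) (fun a ha _ => by
        rw [eval_pderiv_ofUnivariate hvv, hr]
        simpa using hpiv v (by simp) a (hbelow a ha))
    refine ⟨_, hsimple, hineqs, hsub.trans (Finset.subset_insert _ _), ?_, ?_⟩
    · intro r' hr'
      rcases Finset.mem_insert.mp hr' with rfl | h
      · exact Or.inr ⟨v, by simp, (hlead a₀ ha₀).1⟩
      · rcases heqs r' h with h | ⟨u, hu, hul⟩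
        · exact Or.inl h
        · exact Or.inr ⟨u, by simp [hu], hul⟩
    · rw [AlgSystem.sol_insertEq, hsol, hc]
      ext a
      simp only [Set.mem_inter_iff, Set.mem_ofPred_eq, Finset.mem_insert, forall_eq_or_imp]
      tauto

/-- A system that consists of equations in the variables of the initial segment `D` and of
equations that are linear in the other variables has a Thomas decomposition without inequations
in the other variables: over a dense open part of each irreducible constructible set in the
coordinates of `D`, the linear equations can be brought to echelon form. -/
theorem isDecomposable_of_linear {D : Finset σ} (hD : ∀ v ∈ D, ∀ w, lt w v → w ∈ D)
    (I : Ideal (supported ℂ (D : Set σ))) (S : Finset (σ → supported ℂ (D : Set σ)))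
    (hS : ∀ s ∈ S, ∀ v ∈ D, s v = 0) :
    IsDecomposable lt (fun T => ∀ q ∈ T.ineqs, q ∈ supported ℂ (D : Set σ))
      ({a | ∀ p ∈ I, evalSupported (D : Set σ) a p = 0} ∩
        {a | ∀ s ∈ S, ∑ u, evalSupported (D : Set σ) a (s u) * a u = 0}) := by
  classical
  set C : Set (σ → ℂ) := {a | ∀ s ∈ S, ∑ u, evalSupported (D : Set σ) a (s u) * a u = 0} with hC
  let e := evalSupported (D : Set σ)
  have hgen := constructible_induction e
    (fun Z => ∀ x, IsDecomposable lt (fun T => ∀ q ∈ T.ineqs, q ∈ supported ℂ (D : Set σ))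
      ((Z ∩ {a | e a x ≠ 0}) ∩ C))
    (fun x => by
      rw [Set.empty_inter, Set.empty_inter]
      exact isDecomposable_empty _)
    (fun Z Z' hZ h h' x => by
      rw [Set.union_inter_distrib_right, Set.union_inter_distrib_right]
      refine (h x).union ?_ (h' x)
      exact hZ.mono (Set.inter_subset_left.trans Set.inter_subset_left)
        (Set.inter_subset_left.trans Set.inter_subset_left))
    (fun Z f h x => by
      convert h (f * x) using 2
      ext a
      simp only [Set.mem_inter_iff, Set.mem_ofPred_eq, map_mul, mul_ne_zero_iff]
      tauto)
    (fun P hP => ?_) I 1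
  · convert hgen using 2
    ext a
    simp [e]
  -- echelon form over the residue field
  have hmul : ∀ {s s'}, s ∉ P → s' ∉ P → s * s' ∉ P := fun h h' hm =>
    (hP.mem_or_mem hm).elim h h'
  let φ := toResidueField P
  let W : Submodule (FractionRing (supported ℂ (D : Set σ) ⧸ P))
      (σ → FractionRing (supported ℂ (D : Set σ) ⧸ P)) :=
    Submodule.span _ ((fun s i => φ (s i)) '' (S : Set (σ → supported ℂ (D : Set σ))))
  have hWD : ∀ w ∈ W, ∀ v ∈ D, w v = 0 := by
    intro w hw v hv
    induction hw using Submodule.span_induction with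
    | mem w hw =>
      obtain ⟨s, hs, rfl⟩ := hw
      simp [hS s hs v hv]
    | zero => rfl
    | add w w' _ _ h h' => simp [h, h']
    | smul c w _ h => simp [h]
  let V : Finset σ := Finset.univ.filter (· ∈ pivots lt W)
  have hVmem : ∀ v, v ∈ V ↔ v ∈ pivots lt W := by simp [V]
  have hrow : ∀ v, ∃ b : σ → supported ℂ (D : Set σ), v ∈ pivots lt W →
      (fun i => φ (b i)) ∈ W ∧ φ (b v) ≠ 0 ∧ ∀ u, lt v u → b u = 0 := by
    intro v
    by_cases hv : v ∈ pivots lt W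
    · obtain ⟨w, h1, h2, h3⟩ := hv
      obtain ⟨s, hs, b, hb⟩ := exists_row_eq_smul P w
      have hs' : φ s ≠ 0 := mt (toResidueField_eq_zero_iff P).mp hs
      have hbφ : ∀ i, φ (b i) = φ s * w i := congrFun hb
      have hb' : ∀ i, φ (if lt v i then 0 else b i) = φ s * w i := by
        intro i
        split_ifs with h
        · rw [h3 i h, map_zero, mul_zero]
        · exact hbφ i
      refine ⟨fun i => if lt v i then 0 else b i, fun _ => ⟨?_, ?_, ?_⟩⟩
      · simp only [hb']
        exact W.smul_mem (φ s) h1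
      · rw [hb']
        exact mul_ne_zero hs' h2
      · intro u hu
        simp [hu]
    · exact ⟨0, fun h => absurd h hv⟩
  choose b hb using hrow
  have hspan : W ≤ Submodule.span _ ((fun v i => φ (b v i)) '' pivots lt W) :=
    le_span_pivots W (fun v i => φ (b v i)) fun v hv =>
      ⟨(hb v hv).1, (hb v hv).2.1, fun u hu => by simp [(hb v hv).2.2 u hu]⟩
  -- the echelon form is equivalent to the given equations over a dense open part
  obtain ⟨s₁, hs₁, h₁⟩ : ∃ s ∉ P, ∀ a, (∀ p ∈ P, e a p = 0) → e a s ≠ 0 →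
      a ∈ C → ∀ v ∈ V, ∑ u, e a (b v u) * a u = 0 := by
    have h := fun v : V => exists_sum_eq_zero_of_mem_span P e
      (S : Set (σ → supported ℂ (D : Set σ))) (b v) (hb v ((hVmem v).mp v.2)).1
    choose s hs h using h
    refine ⟨∏ v, s v, fun hm => ?_, fun a ha hsa haC v hv => ?_⟩
    · obtain ⟨v, -, hv⟩ := (Ideal.IsPrime.prod_mem_iff (hp := hP)).mp hm
      exact hs v hv
    · rw [map_prod, Finset.prod_ne_zero_iff] at hsa
      exact h ⟨v, hv⟩ a ha (hsa _ (Finset.mem_univ _)) a haC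
  obtain ⟨s₂, hs₂, h₂⟩ : ∃ s ∉ P, ∀ a, (∀ p ∈ P, e a p = 0) → e a s ≠ 0 →
      (∀ v ∈ V, ∑ u, e a (b v u) * a u = 0) → a ∈ C := by
    have h := fun s : S => exists_sum_eq_zero_of_mem_span P e (b '' pivots lt W) s.1 (by
      rw [Set.image_image]
      exact hspan (Submodule.subset_span ⟨s.1, s.2, rfl⟩))
    choose t ht h using h
    refine ⟨∏ s, t s, fun hm => ?_, fun a ha hsa haV s hs => ?_⟩
    · obtain ⟨s, -, hs⟩ := (Ideal.IsPrime.prod_mem_iff (hp := hP)).mp hm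
      exact ht s hs
    · rw [map_prod, Finset.prod_ne_zero_iff] at hsa
      refine h ⟨s, hs⟩ a ha (hsa _ (Finset.mem_univ _)) a ?_
      rintro _ ⟨v, hv, rfl⟩
      exact haV v ((hVmem v).mpr hv)
  have hprod : ∏ v ∈ V, b v v ∉ P := by
    intro hm
    obtain ⟨v, hv, h⟩ := (Ideal.IsPrime.prod_mem_iff (hp := hP)).mp hm
    exact (hb v ((hVmem v).mp hv)).2.1 ((toResidueField_eq_zero_iff P).mpr h)
  refine ⟨(∏ v ∈ V, b v v) * (s₁ * s₂), hmul hprod (hmul hs₁ hs₂), fun x => ?_⟩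
  obtain ⟨E, Q, hE, hQ, hEQ⟩ :=
    setOf_ideal_eq_zero_and_ne_zero P ((∏ v ∈ V, b v v) * (s₁ * s₂) * x)
  have hbase := isDecomposable_of_supported D hD E Q hE hQ
  rw [hEQ] at hbase
  have hset : {a | (∀ p ∈ P, e a p = 0) ∧ e a ((∏ v ∈ V, b v v) * (s₁ * s₂)) ≠ 0} ∩
      {a | e a x ≠ 0} =
      {a | (∀ p ∈ P, e a p = 0) ∧ e a ((∏ v ∈ V, b v v) * (s₁ * s₂) * x) ≠ 0} := by
    ext a
    simp only [Set.mem_inter_iff, Set.mem_ofPred_eq, map_mul, mul_ne_zero_iff]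
    tauto
  rw [hset]
  refine hbase.inter fun T hT hTD hTs => ?_
  by_cases hne : T.sol.Nonempty
  · have hTgood : ∀ a ∈ T.sol, (∀ p ∈ P, e a p = 0) ∧ (∀ v ∈ V, e a (b v v) ≠ 0) ∧
        e a s₁ ≠ 0 ∧ e a s₂ ≠ 0 := by
      intro a ha
      have h := hTs ha
      simp only [Set.mem_ofPred_eq] at h
      rw [map_mul, map_mul, map_mul, map_prod] at h
      simp only [mul_ne_zero_iff, Finset.prod_ne_zero_iff] at h
      exact ⟨h.1, h.2.1.1, h.2.1.2.1, h.2.1.2.2⟩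
    obtain ⟨T', hT', hineqs, -, -, hsol⟩ := hT.exists_insert_linearForms hTD
      (fun v hv w hw => hD v hv w hw) hne V (fun v u => (b v u : MvPolynomial σ ℂ))
      (fun v hv hvD => by
        obtain ⟨w, h1, h2, -⟩ := (hVmem v).mp hv
        exact h2 (hWD w h1 v hvD))
      (fun v _ u => (b v u).2)
      (fun v hv u hu => by
        rw [(hb v ((hVmem v).mp hv)).2.2 u hu]
        rfl)
      (fun v hv a ha => (hTgood a ha).2.1 v hv)
    have h3 : T.sol ∩ C = T'.sol := by
      rw [hsol]
      ext a
      refine and_congr_right fun ha => ?_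
      obtain ⟨h4, -, h5, h6⟩ := hTgood a ha
      simp only [Set.mem_ofPred_eq, eval_linearForm]
      exact ⟨fun h => h₁ a h4 h5 h, fun h => h₂ a h4 h6 h⟩
    rw [h3]
    refine hT'.isDecomposable fun q hq => ?_
    exact hTD q (Or.inr (hineqs ▸ hq))
  · rw [Set.not_nonempty_iff_eq_empty] at hne
    rw [hne, Set.empty_inter]
    exact isDecomposable_empty _

end Linear

/-! ### The determining system and termination -/

section ExVars
variable {n m ℓ : ℕ}

/-- The variables of the extended ring, sorted by their blocks. -/
def exVarEquiv (n m ℓ : ℕ) : ExVar n m ℓ ≃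
    JetVar n m ℓ ⊕ Fin n ⊕ (TopIdx n ℓ × Fin m) ⊕ (MultiIdx n ℓ × Fin m) ⊕ Fin n where
  toFun
    | .jet v => .inl v
    | .a i => .inr (.inl i)
    | .b α μ => .inr (.inr (.inl (μ, α)))
    | .c α μ => .inr (.inr (.inr (.inl (μ, α))))
    | .d i => .inr (.inr (.inr (.inr i)))
  invFun
    | .inl v => .jet v
    | .inr (.inl i) => .a i
    | .inr (.inr (.inl (μ, α))) => .b α μ
    | .inr (.inr (.inr (.inl (μ, α)))) => .c α μ
    | .inr (.inr (.inr (.inr i))) => .d i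
  left_inv v := by cases v <;> rfl
  right_inv v := by rcases v with v | i | ⟨μ, α⟩ | ⟨μ, α⟩ | i <;> rfl

instance : Fintype (ExVar n m ℓ) := Fintype.ofEquiv _ (exVarEquiv n m ℓ).symm

theorem sum_exVar {M : Type*} [AddCommMonoid M] (f : ExVar n m ℓ → M) :
    ∑ v, f v = ∑ v, f (.jet v) + (∑ i, f (.a i) + (∑ μ, ∑ α, f (.b α μ) +
      (∑ μ, ∑ α, f (.c α μ) + ∑ i, f (.d i)))) := by
  rw [← (exVarEquiv n m ℓ).symm.sum_comp]
  simp only [Fintype.sum_sum_type, Fintype.sum_prod_type]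
  rfl

/-- The coefficients of `V(p)` as a linear form in the auxiliary variables. -/
def vessiotRow (p : JetRing n m ℓ) : ExVar n m ℓ → JetRing n m ℓ
  | .a i => contactDeriv i p
  | .b α μ => pderiv (Sum.inr (α, μ.1)) p
  | _ => 0

/-- The coefficients of `J(p)` as a linear form in the auxiliary variables. -/
def jacobianRow (p : JetRing n m ℓ) : ExVar n m ℓ → JetRing n m ℓ
  | .c α μ => pderiv (Sum.inr (α, μ)) p
  | .d i => pderiv (Sum.inl i) p
  | _ => 0

theorem vessiotForm_eq (p : JetRing n m ℓ) :
    vessiotForm p = linearForm fun v => toEx (vessiotRow p v) := by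
  simp [vessiotForm, linearForm, sum_exVar, vessiotRow]

theorem jacobianForm_eq (p : JetRing n m ℓ) :
    jacobianForm p = linearForm fun v => toEx (jacobianRow p v) := by
  simp [jacobianForm, linearForm, sum_exVar, jacobianRow]

theorem eval_toEx (a : ExVar n m ℓ → ℂ) (p : JetRing n m ℓ) :
    eval a (toEx p) = eval (fun v => a (.jet v)) p := by
  rw [toEx, eval_rename]
  rfl

theorem block_le_one_iff {v : ExVar n m ℓ} : v.block ≤ 1 ↔ ∃ w, v = .jet w := by
  constructor
  · intro h
    cases v with
    | jet w => exact ⟨w, rfl⟩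
    | _ => simp [ExVar.block] at h
  · rintro ⟨w | w, rfl⟩ <;> simp [ExVar.block]

/-- The jet variables among the variables of the extended ring. -/
def jetVars (n m ℓ : ℕ) : Finset (ExVar n m ℓ) := Finset.univ.filter fun v => v.block ≤ 1

theorem mem_jetVars {v : ExVar n m ℓ} : v ∈ jetVars n m ℓ ↔ ∃ w, v = .jet w := by
  rw [jetVars, Finset.mem_filter, ← block_le_one_iff]
  simp

theorem coe_jetVars : (jetVars n m ℓ : Set (ExVar n m ℓ)) = Set.range ExVar.jet := by
  ext v
  simp only [Finset.mem_coe, mem_jetVars, Set.mem_range, eq_comm]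

theorem mem_supported_jetVars_iff {p : ExRing n m ℓ} :
    p ∈ supported ℂ (jetVars n m ℓ : Set (ExVar n m ℓ)) ↔ ∃ q, toEx q = p := by
  classical
  rw [coe_jetVars]
  constructor
  · intro h
    rw [mem_supported] at h
    obtain ⟨q, hq⟩ :=
      exists_rename_eq_of_vars_subset_range p ExVar.jet (ExVar.jet_injective n m ℓ) h
    exact ⟨q, hq⟩
  · rintro ⟨q, rfl⟩
    rw [mem_supported]
    intro v hv
    have h := vars_rename ExVar.jet q hv
    obtain ⟨w, -, hw⟩ := Finset.mem_image.mp h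
    exact ⟨w, hw⟩

variable {lt : ExVar n m ℓ → ExVar n m ℓ → Prop}

theorem IsAdmissibleOrder.block_le (hlt : IsAdmissibleOrder lt) {v w : ExVar n m ℓ}
    (h : lt v w) : v.block ≤ w.block := by
  have := hlt.total
  by_contra hne
  exact asymm_of lt h (hlt.blocks w v (not_le.mp hne))

/-- A solution of the determining system of generators of an ideal is a point of the variety of
this ideal together with a solution of a linear system at this point. -/
theorem mem_sol_determiningSystem {G : Finset (JetRing n m ℓ)} {a : ExVar n m ℓ → ℂ} :
    a ∈ (determiningSystem G).sol ↔ ∀ p ∈ G, eval (fun v => a (.jet v)) p = 0 ∧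
      ∑ u, eval (fun v => a (.jet v)) (vessiotRow p u) * a u = 0 ∧
      ∑ u, eval (fun v => a (.jet v)) (jacobianRow p u) * a u = 0 := by
  have h : a ∈ (determiningSystem G).sol ↔ ∀ p ∈ G, eval a (toEx p) = 0 ∧
      eval a (vessiotForm p) = 0 ∧ eval a (jacobianForm p) = 0 := by
    simp only [AlgSystem.sol, determiningSystem, Set.mem_ofPred_eq, Finset.mem_union,
      Finset.mem_image, Finset.notMem_empty, false_imp_iff, implies_true, and_true]
    constructor
    · intro h p hp
      exact ⟨h _ (Or.inr ⟨p, hp, rfl⟩), h _ (Or.inl (Or.inr ⟨p, hp, rfl⟩)),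
        h _ (Or.inl (Or.inl ⟨p, hp, rfl⟩))⟩
    · rintro h _ ((⟨p, hp, rfl⟩ | ⟨p, hp, rfl⟩) | ⟨p, hp, rfl⟩)
      exacts [(h p hp).2.2, (h p hp).2.1, (h p hp).1]
  simp only [h, vessiotForm_eq, jacobianForm_eq, eval_linearForm, eval_toEx]

/-- The determining system has a Thomas decomposition without inequations for the auxiliary
variables, because it is linear in them. -/
theorem exists_isThomasDecomposition (hlt : IsAdmissibleOrder lt) (G : Finset (JetRing n m ℓ)) :
    ∃ L, IsThomasDecomposition lt (determiningSystem G) L ∧ ∀ T ∈ L, NoAuxInequations lt T := by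
  classical
  have := hlt.total
  let D := jetVars n m ℓ
  let ι : JetRing n m ℓ →+* supported ℂ (D : Set (ExVar n m ℓ)) :=
    (toEx : JetRing n m ℓ →ₐ[ℂ] ExRing n m ℓ).toRingHom.codRestrict
      (supported ℂ (D : Set (ExVar n m ℓ))) fun p => mem_supported_jetVars_iff.mpr ⟨p, rfl⟩
  have hι : ∀ a p, evalSupported (D : Set (ExVar n m ℓ)) a (ι p) =
      eval (fun v => a (.jet v)) p := fun a p => eval_toEx a p
  have hD : ∀ v ∈ D, ∀ w, lt w v → w ∈ D := by
    intro v hv w hw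
    rw [mem_jetVars, ← block_le_one_iff] at hv ⊢
    exact (hlt.block_le hw).trans hv
  obtain ⟨L, hL, hdisj, hsol⟩ := isDecomposable_of_linear hD
    (Ideal.span (ι '' (G : Set (JetRing n m ℓ))))
    (G.image (fun p v => ι (vessiotRow p v)) ∪ G.image (fun p v => ι (jacobianRow p v))) (by
      intro s hs v hv
      obtain ⟨w, rfl⟩ := mem_jetVars.mp hv
      rcases Finset.mem_union.mp hs with hs | hs <;>
        obtain ⟨p, -, rfl⟩ := Finset.mem_image.mp hs
      · exact map_zero ι
      · exact map_zero ι)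
  refine ⟨L, ⟨fun T hT => (hL T hT).1, hdisj, ?_⟩, fun T hT q hq v hv => ?_⟩
  · rw [← hsol]
    ext a
    rw [mem_sol_determiningSystem]
    have h1 : (∀ p ∈ Ideal.span (ι '' (G : Set (JetRing n m ℓ))),
        evalSupported (D : Set (ExVar n m ℓ)) a p = 0) ↔
        ∀ p ∈ G, eval (fun v => a (.jet v)) p = 0 := by
      have h2 : (∀ p ∈ Ideal.span (ι '' (G : Set (JetRing n m ℓ))),
          evalSupported (D : Set (ExVar n m ℓ)) a p = 0) ↔
          Ideal.span (ι '' (G : Set (JetRing n m ℓ))) ≤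
            RingHom.ker (evalSupported (D : Set (ExVar n m ℓ)) a) := Iff.rfl
      rw [h2, Ideal.span_le, Set.image_subset_iff]
      refine forall₂_congr fun p _ => ?_
      rw [Set.mem_preimage, SetLike.mem_coe, RingHom.mem_ker, hι]
    simp only [Set.mem_inter_iff, Set.mem_ofPred_eq, h1, Finset.mem_union, or_imp,
      forall_and, Finset.forall_mem_image, hι]
  · obtain ⟨p, rfl⟩ := mem_supported_jetVars_iff.mp ((hL T hT).2 q hq)
    have h := mem_supported.mp ((hL T hT).2 _ hq) hv.1
    exact block_le_one_iff.mpr (mem_jetVars.mp h)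

end ExVars

section Termination
variable {n m ℓ : ℕ}

theorem exists_isPrimeDecomposition {R : Type*} [CommRing R] [IsNoetherianRing R] (I : Ideal R) :
    ∃ Gs, IsPrimeDecomposition I Gs := by
  have hfg : ∀ P : Ideal R, ∃ G : Finset R, Ideal.span (G : Set R) = P := fun P =>
    (isNoetherianRing_iff_ideal_fg R).mp inferInstance P
  choose g hg using hfg
  have hfin := Ideal.finite_minimalPrimes_of_isNoetherianRing R I
  refine ⟨hfin.toFinset.toList.map g, ?_, fun P => ?_⟩
  -- the coercions in `IsPrimeDecomposition` are elaborated as a bind in the list monad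
  · have h : ∀ l : List (Finset R), (l >>= fun G => pure (G : Set R)) =
        List.map (SetLike.coe : Finset R → Set R) l := fun l => by
      rw [bind_pure_comp]; rfl
    change (List.map _ ((hfin.toFinset.toList.map g) >>= fun G => pure (G : Set R))).Nodup
    rw [h, List.map_map, List.map_map]
    have hid : ((fun G : Set R => Ideal.span G) ∘ SetLike.coe) ∘ g = id := funext hg
    rw [hid, List.map_id]
    exact Finset.nodup_toList _
  · simp only [List.mem_map, Finset.mem_toList, Set.Finite.mem_toFinset, exists_exists_and_eq_and,
      hg, exists_eq_right]

/-- What an execution has established about its state: every state of the loop is the result of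
distributing the entries of a prime decomposition over those already treated and those still to be
treated, and the former come with a Thomas decomposition. -/
def State.Invariant (S : DiffSystem n m) (lt : ExVar n m ℓ → ExVar n m ℓ → Prop) :
    State n m ℓ → Prop
  | .start => True
  | .generated G => Ideal.span (G : Set (JetRing n m ℓ)) = jetIdeal S ℓ
  | .loop todo done => IsPrimeDecomposition (jetIdeal S ℓ) (done.map Prod.fst ++ todo) ∧
      ∀ e ∈ done, IsThomasDecomposition lt (determiningSystem e.1) e.2 ∧
        ∀ T ∈ e.2, NoAuxInequations lt T
  | .returned out => ∃ done : List (Finset (JetRing n m ℓ) × List (AlgSystem (ExVar n m ℓ))),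
      IsPrimeDecomposition (jetIdeal S ℓ) (done.map Prod.fst) ∧
      (∀ e ∈ done, IsThomasDecomposition lt (determiningSystem e.1) e.2 ∧
        ∀ T ∈ e.2, NoAuxInequations lt T) ∧
      out = done.map fun e => (e.1, e.2.map (outputOf lt e.1))

theorem Reachable.invariant {S : DiffSystem n m} {lt : ExVar n m ℓ → ExVar n m ℓ → Prop}
    {s : State n m ℓ} (h : Reachable S lt s) : s.Invariant S lt := by
  induction h with
  | refl => trivial
  | tail _ hstep ih =>
    cases hstep with
    | generators G hG => exact hG
    | primes G Gs hGs =>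
      refine ⟨?_, by simp⟩
      rw [State.Invariant] at ih
      rw [ih] at hGs
      simpa using hGs
    | thomas G todo done L hL hgood =>
      obtain ⟨h1, h2⟩ := ih
      refine ⟨by simpa using h1, fun e he => ?_⟩
      rcases List.mem_append.mp he with he | he
      · exact h2 e he
      · rw [List.mem_singleton.mp he]
        exact ⟨hL, hgood⟩
    | output done =>
      obtain ⟨h1, h2⟩ := ih
      exact ⟨done, by simpa using h1, h2, rfl⟩

/-- Every execution makes one call for the generators, one for the primes, and one Thomas
decomposition for each prime; none of these calls can fail. -/
theorem terminates {lt : ExVar n m ℓ → ExVar n m ℓ → Prop} (hlt : IsAdmissibleOrder lt)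
    (S : DiffSystem n m) : Terminates S lt := by
  constructor
  · rintro ⟨f, h0, hf⟩
    obtain ⟨G, h1⟩ : ∃ G, f 1 = .generated G := by
      have h := hf 0
      rw [h0] at h
      generalize hs : f (0 + 1) = s at h
      cases h with
      | generators G hG => exact ⟨G, rfl⟩
    obtain ⟨todo, done, h2⟩ : ∃ todo done, f 2 = .loop todo done := by
      have h := hf 1
      rw [h1] at h
      generalize hs : f (1 + 1) = s at h
      cases h with
      | primes G Gs hGs => exact ⟨Gs, [], rfl⟩
    have key : ∀ (todo : List (Finset (JetRing n m ℓ))) done k, f k ≠ .loop todo done := by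
      intro todo
      induction todo with
      | nil =>
        intro done k hk
        have h := hf k
        rw [hk] at h
        generalize hs : f (k + 1) = s at h
        cases h with
        | output done =>
          have h' := hf (k + 1)
          rw [hs] at h'
          nomatch h'
      | cons G todo ih =>
        intro done k hk
        have h := hf k
        rw [hk] at h
        generalize hs : f (k + 1) = s at h
        cases h with
        | thomas G todo done L hL hgood => exact ih _ _ hs
    exact key _ _ _ h2
  · intro s hs
    cases s with
    | start =>
      obtain ⟨G, hG⟩ := (isNoetherianRing_iff_ideal_fg _).mp inferInstance (jetIdeal S ℓ)
      exact Or.inr ⟨_, .generators G hG⟩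
    | generated G =>
      obtain ⟨Gs, hGs⟩ := exists_isPrimeDecomposition (Ideal.span (G : Set (JetRing n m ℓ)))
      exact Or.inr ⟨_, .primes G Gs hGs⟩
    | loop todo done =>
      cases todo with
      | nil => exact Or.inr ⟨_, .output done⟩
      | cons G todo =>
        obtain ⟨L, hL, hgood⟩ := exists_isThomasDecomposition hlt G
        exact Or.inr ⟨_, .thomas G todo done L hL hgood⟩
    | returned out => exact Or.inl ⟨out, rfl⟩

end Termination

/-! ### Projection to the jet variables and the fibres of the projection -/

section Projection
variable {n m ℓ : ℕ} {lt : ExVar n m ℓ → ExVar n m ℓ → Prop}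

theorem IsAdmissibleOrder.isStrictTotalOrder_restrictOrder (hlt : IsAdmissibleOrder lt) :
    IsStrictTotalOrder (JetVar n m ℓ) (restrictOrder lt) :=
  have := hlt.total
  RelEmbedding.isStrictTotalOrder
    (⟨⟨ExVar.jet, ExVar.jet_injective n m ℓ⟩, Iff.rfl⟩ : restrictOrder lt ↪r lt)

theorem mem_vars_iff_degreeOf_ne_zero {σ : Type*} {p : MvPolynomial σ ℂ} {v : σ} :
    v ∈ p.vars ↔ p.degreeOf v ≠ 0 := by
  classical
  rw [vars_def, Multiset.mem_toFinset, degreeOf_def, Multiset.count_ne_zero]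

theorem jet_mem_vars_toEx {p : JetRing n m ℓ} {w : JetVar n m ℓ} :
    ExVar.jet w ∈ (toEx p).vars ↔ w ∈ p.vars := by
  rw [mem_vars_iff_degreeOf_ne_zero, mem_vars_iff_degreeOf_ne_zero, toEx,
    degreeOf_rename_of_injective (ExVar.jet_injective n m ℓ)]

theorem mem_projectSystem_eqs {T : AlgSystem (ExVar n m ℓ)} {p : JetRing n m ℓ} :
    p ∈ (projectSystem T).eqs ↔ toEx p ∈ T.eqs :=
  Finset.mem_preimage (hf := (toEx_injective n m ℓ).injOn)

theorem mem_projectSystem_ineqs {T : AlgSystem (ExVar n m ℓ)} {p : JetRing n m ℓ} :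
    p ∈ (projectSystem T).ineqs ↔ toEx p ∈ T.ineqs :=
  Finset.mem_preimage (hf := (toEx_injective n m ℓ).injOn)

theorem exists_toEx_eq (hlt : IsAdmissibleOrder lt) {p : ExRing n m ℓ} {v : ExVar n m ℓ}
    (hp : IsLeader lt p v) (hv : v.block ≤ 1) : ∃ q, toEx q = p := by
  refine mem_supported_jetVars_iff.mp (mem_supported.mpr fun w hw => ?_)
  have hw1 : w.block ≤ 1 := by
    rcases hp.lt_or_eq hw with h | rfl
    · exact (hlt.block_le h).trans hv
    · exact hv
  exact mem_jetVars.mpr (block_le_one_iff.mp hw1)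

theorem isLeader_toEx_iff {p : JetRing n m ℓ} {v : ExVar n m ℓ} :
    IsLeader lt (toEx p) v ↔ ∃ w, v = .jet w ∧ IsLeader (restrictOrder lt) p w := by
  have hjet : ∀ u ∈ (toEx p).vars, ∃ w, u = .jet w := fun u hu =>
    mem_jetVars.mp (mem_supported.mp (mem_supported_jetVars_iff.mpr ⟨p, rfl⟩) hu)
  constructor
  · intro h
    obtain ⟨w, rfl⟩ := hjet v h.1
    refine ⟨w, rfl, jet_mem_vars_toEx.mp h.1, fun u hu huw => ?_⟩
    exact h.2 _ (jet_mem_vars_toEx.mpr hu) fun h' => huw (ExVar.jet_injective n m ℓ h')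
  · rintro ⟨w, rfl, h⟩
    refine ⟨jet_mem_vars_toEx.mpr h.1, fun u hu huw => ?_⟩
    obtain ⟨u, rfl⟩ := hjet u hu
    exact h.2 u (jet_mem_vars_toEx.mp hu) fun h' => huw (congrArg _ h')

theorem specialize_toEx (a : ExVar n m ℓ → ℂ) (v : JetVar n m ℓ) (p : JetRing n m ℓ) :
    specialize a (.jet v) (toEx p) = specialize (fun w => a (.jet w)) v p := by
  classical
  have h : (specialize a (.jet v)).comp toEx = specialize (fun w => a (.jet w)) v := by
    refine MvPolynomial.algHom_ext fun w => ?_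
    by_cases hw : w = v
    · subst hw
      simp [specialize, toEx]
    · have : ExVar.jet w ≠ ExVar.jet v := fun h => hw (ExVar.jet_injective n m ℓ h)
      simp [specialize, toEx, hw, this]
  exact AlgHom.congr_fun h p

theorem eval_initialAt_toEx (a : ExVar n m ℓ → ℂ) (v : JetVar n m ℓ) (p : JetRing n m ℓ) :
    eval a (initialAt (toEx p) (.jet v)) = eval (fun w => a (.jet w)) (initialAt p v) := by
  rw [← coeff_specialize_degreeOf, ← coeff_specialize_degreeOf, specialize_toEx, toEx,
    degreeOf_rename_of_injective (ExVar.jet_injective n m ℓ)]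

/-- The point of the extended affine space over the point `ρ` of the jet bundle all of whose
auxiliary coordinates vanish. -/
def jetPoint (ρ : JetSpace n m ℓ) : ExVar n m ℓ → ℂ
  | .jet w => ρ w
  | _ => 0

theorem jetPoint_eq_zero (ρ : JetSpace n m ℓ) {v : ExVar n m ℓ} (hv : 2 ≤ v.block) :
    jetPoint ρ v = 0 := by
  cases v with
  | jet w => rcases w with w | w <;> simp [ExVar.block] at hv
  | _ => rfl

/-- The members of `T` with leader below a jet variable involve only jet variables. -/
theorem AlgSystem.mem_solBelow_of_projectSystem (hlt : IsAdmissibleOrder lt)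
    (T : AlgSystem (ExVar n m ℓ)) {a : ExVar n m ℓ → ℂ} {v : JetVar n m ℓ}
    (ha : (fun w => a (.jet w)) ∈ (projectSystem T).solBelow (restrictOrder lt) v) :
    a ∈ T.solBelow lt (.jet v) := by
  have key : ∀ p w, IsLeader lt p w → lt w (.jet v) → ∃ q u, toEx q = p ∧
      IsLeader (restrictOrder lt) q u ∧ restrictOrder lt u v := by
    intro p w hw hwv
    obtain ⟨q, rfl⟩ := exists_toEx_eq hlt hw
      ((hlt.block_le hwv).trans (block_le_one_iff.mpr ⟨v, rfl⟩))
    obtain ⟨u, rfl, hu⟩ := isLeader_toEx_iff.mp hw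
    exact ⟨q, u, rfl, hu, hwv⟩
  constructor
  · intro p hp w hw hwv
    obtain ⟨q, u, rfl, hq, hu⟩ := key p w hw hwv
    rw [eval_toEx]
    exact ha.1 q (mem_projectSystem_eqs.mpr hp) u hq hu
  · intro p hp w hw hwv
    obtain ⟨q, u, rfl, hq, hu⟩ := key p w hw hwv
    rw [eval_toEx]
    exact ha.2 q (mem_projectSystem_ineqs.mpr hp) u hq hu

/-- The jet variables form an initial segment of the variables, so the members of a simple system
that involve no auxiliary variables form a simple system. -/
theorem AlgSystem.IsSimple.projectSystem (hlt : IsAdmissibleOrder lt)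
    {T : AlgSystem (ExVar n m ℓ)} (hT : T.IsSimple lt) :
    (projectSystem T).IsSimple (restrictOrder lt) := by
  have hmem : ∀ r, r ∈ (RegDec.projectSystem T).eqs ∨ r ∈ (RegDec.projectSystem T).ineqs →
      toEx r ∈ T.eqs ∨ toEx r ∈ T.ineqs := fun r hr =>
    hr.imp mem_projectSystem_eqs.mp mem_projectSystem_ineqs.mp
  have hpt : ∀ ρ : JetSpace n m ℓ, (fun w => jetPoint ρ (.jet w)) = ρ := fun ρ => rfl
  refine ⟨fun r hr => ?_, ?_, fun r r' hr hr' v hv hv' => ?_, fun r hr v hv ρ hρ => ?_,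
    fun r hr v hv ρ hρ h0 => ?_⟩
  · obtain ⟨v, hv⟩ := hT.nonconstant _ (hmem r hr)
    obtain ⟨w, -, hw⟩ := isLeader_toEx_iff.mp hv
    exact ⟨w, hw⟩
  · rw [Finset.disjoint_left]
    exact fun r hr hr' => Finset.disjoint_left.mp hT.disjoint (mem_projectSystem_eqs.mp hr)
      (mem_projectSystem_ineqs.mp hr')
  · exact toEx_injective n m ℓ (hT.triangular _ _ (hmem r hr) (hmem r' hr') (.jet v)
      (isLeader_toEx_iff.mpr ⟨v, rfl, hv⟩) (isLeader_toEx_iff.mpr ⟨v, rfl, hv'⟩))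
  · have h := hT.initial_ne_zero _ (hmem r hr) _ (isLeader_toEx_iff.mpr ⟨v, rfl, hv⟩) (jetPoint ρ)
      (T.mem_solBelow_of_projectSystem hlt hρ)
    rwa [eval_initialAt_toEx] at h
  · have h := hT.squarefree _ (hmem r hr) _ (isLeader_toEx_iff.mpr ⟨v, rfl, hv⟩) (jetPoint ρ)
      (T.mem_solBelow_of_projectSystem hlt hρ) (by rwa [eval_toEx])
    rwa [toEx, pderiv_rename (ExVar.jet_injective n m ℓ), ← toEx, eval_toEx] at h

/-- The solutions of the projected system are the projections of the solutions. -/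
theorem mem_sol_projectSystem_iff (hlt : IsAdmissibleOrder lt)
    {T : AlgSystem (ExVar n m ℓ)} (hT : T.IsSimple lt) (haux : NoAuxInequations lt T)
    {ρ : JetSpace n m ℓ} :
    ρ ∈ (projectSystem T).sol ↔ ∃ a ∈ T.sol, ∀ w, a (.jet w) = ρ w := by
  have := hlt.total
  constructor
  · intro hρ
    obtain ⟨b, hb, hbD⟩ := hT.exists_extension {v | v.block ≤ 1}
      (fun v hv w hw => (hlt.block_le hw).trans hv) haux (jetPoint ρ)
      (fun p hp v hvD hv => by
        obtain ⟨q, rfl⟩ := exists_toEx_eq hlt hv hvD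
        rw [eval_toEx]
        exact hρ.1 q (mem_projectSystem_eqs.mpr hp))
      (fun p hp => by
        obtain ⟨v, hv⟩ := hT.nonconstant p (Or.inr hp)
        obtain ⟨q, rfl⟩ := exists_toEx_eq hlt hv (haux p hp v hv)
        rw [eval_toEx]
        exact hρ.2 q (mem_projectSystem_ineqs.mpr hp))
    exact ⟨b, hb, fun w => hbD _ (block_le_one_iff.mpr ⟨w, rfl⟩)⟩
  · rintro ⟨a, ha, haρ⟩
    obtain rfl : (fun w => a (.jet w)) = ρ := funext haρ
    exact ⟨fun q hq => by rw [← eval_toEx]; exact ha.1 _ (mem_projectSystem_eqs.mp hq),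
      fun q hq => by rw [← eval_toEx]; exact ha.2 _ (mem_projectSystem_ineqs.mp hq)⟩

end Projection

section Fibre
variable {n m ℓ : ℕ} {lt : ExVar n m ℓ → ExVar n m ℓ → Prop}

/-- An affine space is irreducible: finitely many polynomials none of which vanishes identically
on it have a common non-zero. -/
theorem exists_forall_eval_ne_zero {σ ι : Type*} [Fintype σ] (W : Submodule ℂ (σ → ℂ)) (a : σ → ℂ)
    (s : Finset ι) (f : ι → MvPolynomial σ ℂ) (hf : ∀ i ∈ s, ∃ y ∈ W, eval (a + y) (f i) ≠ 0) :
    ∃ y ∈ W, ∀ i ∈ s, eval (a + y) (f i) ≠ 0 := by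
  classical
  obtain ⟨W', hW'⟩ := W.exists_isCompl
  let π : (σ → ℂ) →ₗ[ℂ] (σ → ℂ) := W.subtype ∘ₗ W.projectionOnto W' hW'
  have hπ : ∀ x, π x ∈ W := fun x => (W.projectionOnto W' hW' x).2
  have hπW : ∀ x ∈ W, π x = x := fun x hx => by
    have := W.projectionOnto_apply_left hW' ⟨x, hx⟩
    exact congrArg Subtype.val this
  -- pull the polynomials back along the parametrisation of the affine space
  let φ : MvPolynomial σ ℂ →ₐ[ℂ] MvPolynomial σ ℂ :=
    aeval fun v => C (a v) + ∑ u, X u * C (π (Pi.single u 1) v)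
  have hφ : ∀ x p, eval x (φ p) = eval (a + π x) p := by
    intro x p
    have h : (eval x).comp (φ : MvPolynomial σ ℂ →+* MvPolynomial σ ℂ) = eval (a + π x) := by
      refine MvPolynomial.ringHom_ext (fun c => by simp [φ]) fun v => ?_
      have hx : π x = ∑ u, x u • π (Pi.single u 1) := by
        conv_lhs => rw [pi_eq_sum_univ' x]
        rw [map_sum]
        exact Finset.sum_congr rfl fun u _ => map_smul _ _ _
      simp [φ, hx, Finset.sum_apply]
    exact RingHom.congr_fun h p
  have hne : ∏ i ∈ s, φ (f i) ≠ 0 := by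
    refine Finset.prod_ne_zero_iff.mpr fun i hi h0 => ?_
    obtain ⟨y, hy, hne⟩ := hf i hi
    apply hne
    rw [← hπW y hy, ← hφ, h0, map_zero]
  obtain ⟨x, hx⟩ : ∃ x, eval x (∏ i ∈ s, φ (f i)) ≠ 0 := by
    by_contra! h
    exact hne (MvPolynomial.funext fun x => by rw [h x, map_zero])
  rw [map_prod, Finset.prod_ne_zero_iff] at hx
  exact ⟨π x, hπ x, fun i hi => by rw [← hφ]; exact hx i hi⟩

/-- The solutions of the linear system for the auxiliary variables that the determining system
imposes over the point `ρ`. -/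
def auxSpace (G : Finset (JetRing n m ℓ)) (ρ : JetSpace n m ℓ) :
    Submodule ℂ (ExVar n m ℓ → ℂ) where
  carrier := {y | (∀ w, y (.jet w) = 0) ∧ ∀ p ∈ G, ∑ u, eval ρ (vessiotRow p u) * y u = 0 ∧
    ∑ u, eval ρ (jacobianRow p u) * y u = 0}
  zero_mem' := by simp
  add_mem' := by
    rintro y z ⟨hy, hy'⟩ ⟨hz, hz'⟩
    refine ⟨fun w => by simp [hy, hz], fun p hp => ?_⟩
    simp [mul_add, Finset.sum_add_distrib, hy' p hp, hz' p hp]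
  smul_mem' := by
    rintro c y ⟨hy, hy'⟩
    refine ⟨fun w => by simp [hy], fun p hp => ?_⟩
    simp only [Pi.smul_apply, smul_eq_mul, mul_left_comm _ c, ← Finset.mul_sum, hy' p hp, mul_zero,
      and_self]

theorem mem_auxSpace {G : Finset (JetRing n m ℓ)} {ρ : JetSpace n m ℓ} {y : ExVar n m ℓ → ℂ} :
    y ∈ auxSpace G ρ ↔ (∀ w, y (.jet w) = 0) ∧
      ∀ p ∈ G, ∑ u, eval ρ (vessiotRow p u) * y u = 0 ∧
        ∑ u, eval ρ (jacobianRow p u) * y u = 0 := Iff.rfl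

theorem mem_sol_determiningSystem_iff_exists {G : Finset (JetRing n m ℓ)}
    {a : ExVar n m ℓ → ℂ} {ρ : JetSpace n m ℓ} (ha : ∀ w, a (.jet w) = ρ w) :
    a ∈ (determiningSystem G).sol ↔
      ρ ∈ zeroLocus ℂ (Ideal.span (G : Set (JetRing n m ℓ))) ∧ a - jetPoint ρ ∈ auxSpace G ρ := by
  obtain rfl : (fun w => a (.jet w)) = ρ := funext ha
  have h1 : ∀ p u, eval (fun w => a (.jet w)) (vessiotRow p u) *
      (a - jetPoint fun w => a (.jet w)) u = eval (fun w => a (.jet w)) (vessiotRow p u) * a u := by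
    intro p u
    cases u <;> simp [vessiotRow, jetPoint]
  have h2 : ∀ p u, eval (fun w => a (.jet w)) (jacobianRow p u) *
      (a - jetPoint fun w => a (.jet w)) u =
        eval (fun w => a (.jet w)) (jacobianRow p u) * a u := by
    intro p u
    cases u <;> simp [jacobianRow, jetPoint]
  rw [mem_sol_determiningSystem, mem_auxSpace, zeroLocus_span]
  simp only [h1, h2, Set.mem_ofPred_eq, aeval_eq_eval, Finset.mem_coe]
  simp only [Pi.sub_apply, jetPoint, sub_self, implies_true, true_and, forall_and]

/-- Over each point of its projection a member of a Thomas decomposition of the determining system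
contains the whole fibre. Since it has no inequations for the auxiliary variables, the fibre is a
union of finitely many closed sets, one for each member of the decomposition. It is an affine space
and therefore irreducible, so one of them is the whole fibre; being disjoint, the others are
empty. -/
theorem IsThomasDecomposition.fibre_subset_sol (hlt : IsAdmissibleOrder lt)
    {G : Finset (JetRing n m ℓ)} {L : List (AlgSystem (ExVar n m ℓ))}
    (hL : IsThomasDecomposition lt (determiningSystem G) L)
    (haux : ∀ T ∈ L, NoAuxInequations lt T) {T : AlgSystem (ExVar n m ℓ)} (hT : T ∈ L)
    {ρ : JetSpace n m ℓ} (hρ : ρ ∈ (projectSystem T).sol) {y : ExVar n m ℓ → ℂ}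
    (hy : y ∈ auxSpace G ρ) : jetPoint ρ + y ∈ T.sol := by
  classical
  obtain ⟨hsimple, hdisj, hsol⟩ := hL
  obtain ⟨a, haT, ha⟩ := (mem_sol_projectSystem_iff hlt (hsimple T hT) (haux T hT)).mp hρ
  have haG : a ∈ (determiningSystem G).sol := by
    rw [hsol]
    exact ⟨T, hT, haT⟩
  rw [mem_sol_determiningSystem_iff_exists ha] at haG
  have hfib : ∀ y ∈ auxSpace G ρ, ∃ T ∈ L, jetPoint ρ + y ∈ T.sol := by
    intro y hy
    have h : jetPoint ρ + y ∈ (determiningSystem G).sol := by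
      rw [mem_sol_determiningSystem_iff_exists (ρ := ρ) fun w => by simp [jetPoint, hy.1 w]]
      exact ⟨haG.1, by rwa [add_sub_cancel_left]⟩
    rwa [hsol] at h
  have hex : ∃ T₀ ∈ L, ∀ y ∈ auxSpace G ρ, jetPoint ρ + y ∈ T₀.sol := by
    by_contra! hcon
    have hpoly : ∀ T' : AlgSystem (ExVar n m ℓ), ∃ p, T' ∈ L →
        (∃ y ∈ auxSpace G ρ, eval (jetPoint ρ + y) p ≠ 0) ∧
          ∀ y ∈ auxSpace G ρ, jetPoint ρ + y ∈ T'.sol → eval (jetPoint ρ + y) p = 0 := by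
      intro T'
      by_cases hT' : T' ∈ L
      · obtain ⟨y₀, hy₀, hne⟩ := hcon T' hT'
        by_cases hineq : ∀ y ∈ auxSpace G ρ, jetPoint ρ + y ∉ T'.sol
        · exact ⟨1, fun _ => ⟨⟨y₀, hy₀, by simp⟩, fun y hy h => absurd h (hineq y hy)⟩⟩
        · push Not at hineq
          obtain ⟨y₁, hy₁, hmem⟩ := hineq
          obtain ⟨p, hp, hpne⟩ : ∃ p ∈ T'.eqs, eval (jetPoint ρ + y₀) p ≠ 0 := by
            by_contra! h
            refine hne ⟨h, fun q hq => ?_⟩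
            obtain ⟨v, hv⟩ := (hsimple T' hT').nonconstant q (Or.inr hq)
            obtain ⟨q, rfl⟩ := exists_toEx_eq hlt hv (haux T' hT' q hq v hv)
            have h1 := hmem.2 _ hq
            rw [eval_toEx] at h1 ⊢
            simpa [hy₀.1, hy₁.1] using h1
          exact ⟨p, fun _ => ⟨⟨y₀, hy₀, hpne⟩, fun y _ h => h.1 p hp⟩⟩
      · exact ⟨0, fun h => absurd h hT'⟩
    choose p hp using hpoly
    obtain ⟨y, hy, hyne⟩ := exists_forall_eval_ne_zero (auxSpace G ρ) (jetPoint ρ) L.toFinset p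
      fun T' hT' => (hp T' (List.mem_toFinset.mp hT')).1
    obtain ⟨T', hT', hmem⟩ := hfib y hy
    exact hyne T' (List.mem_toFinset.mpr hT') ((hp T' hT').2 y hy hmem)
  obtain ⟨T₀, hT₀, hall⟩ := hex
  have haT₀ : a ∈ T₀.sol := by
    have h := hall _ haG.2
    rwa [add_sub_cancel] at h
  by_cases hne : T = T₀
  · rw [hne]
    exact hall y hy
  · have : Std.Symm fun A B : AlgSystem (ExVar n m ℓ) => Disjoint A.sol B.sol :=
      ⟨fun _ _ h => h.symm⟩
    have h := hdisj.forall hT hT₀ hne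
    exact absurd haT₀ (Set.disjoint_left.mp h haT)

end Fibre

/-! ### Free variables and the dimensions of the fibres -/

section FreeVariables
variable {n m ℓ : ℕ} {lt : ExVar n m ℓ → ExVar n m ℓ → Prop}

/-- The auxiliary vectors over `ρ` whose coordinates in the blocks before `t` vanish. -/
def auxSpaceFrom (G : Finset (JetRing n m ℓ)) (ρ : JetSpace n m ℓ) (t : ℕ) :
    Submodule ℂ (ExVar n m ℓ → ℂ) where
  carrier := {y | y ∈ auxSpace G ρ ∧ ∀ v, v.block < t → y v = 0}
  zero_mem' := ⟨Submodule.zero_mem _, by simp⟩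
  add_mem' := fun hy hz => ⟨Submodule.add_mem _ hy.1 hz.1, fun v hv => by
    simp [hy.2 v hv, hz.2 v hv]⟩
  smul_mem' := fun c _ hy => ⟨Submodule.smul_mem _ c hy.1, fun v hv => by simp [hy.2 v hv]⟩

/-- The variables from block `t` on that are not the leader of an equation of `T`. -/
def freeVars (lt : ExVar n m ℓ → ExVar n m ℓ → Prop) (T : AlgSystem (ExVar n m ℓ)) (t : ℕ) :
    Set (ExVar n m ℓ) :=
  {v | t ≤ v.block ∧ ∀ p ∈ T.eqs, ¬ IsLeader lt p v}

/-- The fibres of the solution set of a member of a Thomas decomposition are linear spaces, and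
their first non-zero coordinates occur exactly at the free variables: the coordinate of a leader is
a root of a non-zero univariate polynomial and hence cannot be scaled, whereas the coordinate of a
free variable can be prescribed. -/
theorem IsThomasDecomposition.pivots_auxSpaceFrom (hlt : IsAdmissibleOrder lt)
    {G : Finset (JetRing n m ℓ)} {L : List (AlgSystem (ExVar n m ℓ))}
    (hL : IsThomasDecomposition lt (determiningSystem G) L)
    (haux : ∀ T ∈ L, NoAuxInequations lt T) {T : AlgSystem (ExVar n m ℓ)} (hT : T ∈ L)
    {ρ : JetSpace n m ℓ} (hρ : ρ ∈ (projectSystem T).sol) {t : ℕ} (ht : 2 ≤ t) :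
    pivots (Function.swap lt) (auxSpaceFrom G ρ t) = freeVars lt T t := by
  classical
  have := hlt.total
  have hsimple := hL.1 T hT
  have hall : ∀ y ∈ auxSpace G ρ, jetPoint ρ + y ∈ T.sol := fun y hy =>
    hL.fibre_subset_sol hlt haux hT hρ hy
  have h0 : jetPoint ρ ∈ T.sol := by
    simpa using hall 0 (Submodule.zero_mem _)
  ext v
  constructor
  · rintro ⟨y, hy, hyv, hlow⟩
    have hv : t ≤ v.block := by
      by_contra h
      exact hyv (hy.2 v (not_le.mp h))
    refine ⟨hv, fun p hp hpv => ?_⟩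
    have hdeg := hsimple.specialize_ne_zero (Or.inl hp) hpv
      (T.sol_subset_solBelow (lt := lt) v h0)
    have hzero : specialize (jetPoint ρ) v p = 0 := by
      refine Polynomial.funext fun s => ?_
      rw [eval_specialize, Polynomial.eval_zero]
      rw [← (hall _ (Submodule.smul_mem _ (s / y v) hy.1)).1 p hp]
      refine eval_congr_of_vars fun w hw => ?_
      rcases hpv.lt_or_eq hw with h | rfl
      · have hne : w ≠ v := by
          rintro rfl
          exact irrefl_of lt _ h
        simp [hne, hlow w h]
      · simp [jetPoint_eq_zero ρ (ht.trans hv), hyv]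
    simp [hzero] at hdeg
  · rintro ⟨hv, hfree⟩
    have hagree : ∀ p w, IsLeader lt p w → lt w v →
        eval (Function.update (jetPoint ρ) v 1) p = eval (jetPoint ρ) p := fun p w hw hwv =>
      eval_update_of_notMem_vars (hw.notMem_vars hwv) _ _
    obtain ⟨b, hb, hbD⟩ := hsimple.exists_extension {w | ¬ lt v w}
      (fun w hw u hu h => hw (trans_of lt h hu))
      (fun q hq w hw h => by
        have h1 := hlt.block_le h
        have h2 := haux T hT q hq w hw
        omega)
      (Function.update (jetPoint ρ) v 1)
      (fun p hp w hwD hw => by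
        rcases trichotomous_of lt w v with h | rfl | h
        · rw [hagree p w hw h]
          exact h0.1 p hp
        · exact absurd hw (hfree p hp)
        · exact absurd h hwD)
      (fun q hq => by
        obtain ⟨w, hw⟩ := hsimple.nonconstant q (Or.inr hq)
        rw [hagree q w hw (hlt.blocks _ _ (by have := haux T hT q hq w hw; omega))]
        exact h0.2 q hq)
    have hbelow : ∀ w, lt w v → b w = jetPoint ρ w := fun w hw => by
      rw [hbD w (fun h => asymm_of lt h hw), Function.update_of_ne]
      rintro rfl
      exact irrefl_of lt _ hw
    have hbv : b v = 1 := by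
      rw [hbD v (irrefl_of lt v), Function.update_self]
    have hjet : ∀ w, b (.jet w) = ρ w := fun w =>
      hbelow _ (hlt.blocks _ _ (by have := block_le_one_iff.mpr ⟨w, rfl⟩; omega))
    have hbG : b ∈ (determiningSystem G).sol := by
      rw [hL.2.2]
      exact ⟨T, hT, hb⟩
    rw [mem_sol_determiningSystem_iff_exists hjet] at hbG
    refine ⟨b - jetPoint ρ, ⟨hbG.2, fun w hw => ?_⟩, ?_, fun w hw => ?_⟩
    · simp [hbelow w (hlt.blocks _ _ (hw.trans_le hv))]
    · simp [hbv, jetPoint_eq_zero ρ (ht.trans hv)]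
    · simp [hbelow w hw]

theorem IsThomasDecomposition.finrank_auxSpaceFrom (hlt : IsAdmissibleOrder lt)
    {G : Finset (JetRing n m ℓ)} {L : List (AlgSystem (ExVar n m ℓ))}
    (hL : IsThomasDecomposition lt (determiningSystem G) L)
    (haux : ∀ T ∈ L, NoAuxInequations lt T) {T : AlgSystem (ExVar n m ℓ)} (hT : T ∈ L)
    {ρ : JetSpace n m ℓ} (hρ : ρ ∈ (projectSystem T).sol) {t : ℕ} (ht : 2 ≤ t) :
    Module.finrank ℂ (auxSpaceFrom G ρ t) = (freeVars lt T t).ncard := by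
  have := hlt.total
  rw [finrank_eq_ncard_pivots (lt := Function.swap lt),
    hL.pivots_auxSpaceFrom hlt haux hT hρ ht]

theorem ncard_block_ge_four :
    {v : ExVar n m ℓ | 4 ≤ v.block}.ncard = Fintype.card (JetVar n m ℓ) := by
  let f : JetVar n m ℓ → ExVar n m ℓ := Sum.elim ExVar.d fun k => ExVar.c k.1 k.2
  have hf : Function.Injective f := by
    rintro (i | ⟨α, μ⟩) (j | ⟨β, ν⟩) h <;> simp_all [f]
  have hr : {v : ExVar n m ℓ | 4 ≤ v.block} = f '' Set.univ := by
    ext v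
    simp only [Set.mem_ofPred_eq, Set.image_univ, Set.mem_range]
    constructor
    · intro hv
      cases v with
      | c α μ => exact ⟨Sum.inr (α, μ), rfl⟩
      | d i => exact ⟨Sum.inl i, rfl⟩
      | jet w => rcases w with w | w <;> simp [ExVar.block] at hv
      | _ => simp [ExVar.block] at hv
    · rintro ⟨i | k, rfl⟩ <;> simp [f, ExVar.block]
  rw [hr, Set.ncard_image_of_injective _ hf, Set.ncard_univ, Nat.card_eq_fintype_card]

/-- The Jacobian rank counts the leaders among the variables `c` and `d`, which are the ones that
are not free. -/
theorem ncard_freeVars_add_jacobianRank (hlt : IsAdmissibleOrder lt)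
    {T : AlgSystem (ExVar n m ℓ)} (hT : T.IsSimple lt) :
    (freeVars lt T 4).ncard + jacobianRank lt T = Fintype.card (JetVar n m ℓ) := by
  have := hlt.total
  have h : jacobianRank lt T =
      ({v : ExVar n m ℓ | 4 ≤ v.block} \ freeVars lt T 4).ncard := by
    have hlead : ∀ p ∈ T.eqs, ∃ v, IsLeader lt p v := fun p hp => hT.nonconstant p (Or.inl hp)
    choose l hl using hlead
    refine Set.ncard_congr (fun p hp => l p hp.1) (fun p hp => ?_) (fun p q hp hq hpq => ?_)
      fun v hv => ?_
    · obtain ⟨hp, v, hv, hb⟩ := hp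
      exact ⟨by rwa [Set.mem_ofPred_eq, (hl p hp).unique hv], fun h => h.2 p hp (hl p hp)⟩
    · exact hT.triangular p q (Or.inl hp.1) (Or.inl hq.1) _ (hl p hp.1) (hpq ▸ hl q hq.1)
    · obtain ⟨hb, hnot⟩ := hv
      have hex : ∃ p ∈ T.eqs, IsLeader lt p v := by
        by_contra! h
        exact hnot ⟨hb, h⟩
      obtain ⟨p, hp, hpv⟩ := hex
      exact ⟨p, ⟨hp, v, hpv, hb⟩, (hl p hp).unique hpv⟩
  rw [h, add_comm, Set.ncard_sdiff_add_ncard_of_subset (fun v hv => hv.1), ncard_block_ge_four]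

end FreeVariables

/-! ### The fibres in terms of Vessiot, symbol and tangent spaces -/

section Spaces
variable {n m ℓ : ℕ}

/-- The contact distribution in terms of the contact forms `du^α_μ - ∑_i u^α_{μ + 1_i} dx^i`. -/
theorem mem_contactSpace_iff {ρ u : JetSpace n m ℓ} :
    u ∈ contactSpace ρ ↔ ∀ α (μ : MultiIdx n ℓ), ∑ j, μ.1 j < ℓ →
      u (Sum.inr (α, μ)) = ∑ i, u (Sum.inl i) * eval ρ (contactCoeff i (Sum.inr (α, μ))) := by
  constructor
  · intro hu α μ hμ
    induction hu using Submodule.span_induction with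
    | mem x hx =>
      rcases hx with ⟨i, rfl⟩ | ⟨⟨β, ν⟩, rfl⟩
      · simp [contactCoeff, apply_ite, ite_mul]
      · have hne : (Sum.inr (α, μ) : JetVar n m ℓ) ≠ Sum.inr (β, ν.1) := by
          intro h
          obtain ⟨-, rfl⟩ := Prod.mk.inj (Sum.inr_injective h)
          exact hμ.ne ν.2
        simp [hne]
    | zero => simp
    | add x y _ _ hx hy => simp [hx, hy, add_mul, Finset.sum_add_distrib]
    | smul c x _ hx => simp [hx, Finset.mul_sum, mul_assoc]
  · intro hu
    have h1 : ∑ i, u (Sum.inl i) • (fun w : JetVar n m ℓ => eval ρ (contactCoeff i w)) ∈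
        contactSpace ρ :=
      Submodule.sum_mem _ fun i _ =>
        Submodule.smul_mem _ _ (Submodule.subset_span (Or.inl ⟨i, rfl⟩))
    rw [← Submodule.sub_mem_iff_left _ h1]
    set x := u - ∑ i, u (Sum.inl i) • (fun w : JetVar n m ℓ => eval ρ (contactCoeff i w)) with hx
    -- what is left is supported on the coordinates of order `ℓ`
    rw [pi_eq_sum_univ' x]
    refine Submodule.sum_mem _ fun w _ => ?_
    rcases w with i | ⟨α, μ⟩
    · have h0 : x (Sum.inl i) = 0 := by
        simp [hx, contactCoeff, apply_ite, Finset.sum_apply]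
      rw [h0, zero_smul]
      exact Submodule.zero_mem _
    · by_cases hμ : ∑ j, μ.1 j < ℓ
      · have h0 : x (Sum.inr (α, μ)) = 0 := by
          simp [hx, hu α μ hμ, Finset.sum_apply]
        rw [h0, zero_smul]
        exact Submodule.zero_mem _
      · exact Submodule.smul_mem _ _ (Submodule.subset_span
          (Or.inr ⟨(α, ⟨μ, le_antisymm μ.2 (not_lt.mp hμ)⟩), rfl⟩))

theorem contactDeriv_eq_sum (i : Fin n) (p : JetRing n m ℓ) :
    contactDeriv i p = ∑ w, pderiv w p * contactCoeff i w := by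
  classical
  have hs : ∀ q : JetRing n m ℓ, (∑ w, contactCoeff i w • pderiv w : Derivation ℂ _ _) q =
      ∑ w, pderiv w q * contactCoeff i w := by
    intro q
    have h := congrFun (map_sum Derivation.coeFnAddMonoidHom
      (fun w => contactCoeff i w • pderiv (R := ℂ) w) (Finset.univ : Finset (JetVar n m ℓ))) q
    rw [Finset.sum_apply] at h
    exact h.trans (Finset.sum_congr rfl fun w _ => mul_comm _ _)
  rw [← hs]
  refine DFunLike.congr_fun (MvPolynomial.derivation_ext fun v => ?_) p
  rw [contactDeriv, mkDerivation_X, hs]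
  simp [pderiv_X, Pi.single_apply]

/-- The auxiliary coordinates that encode a contact vector `u` by the unknowns `a, b` and an
arbitrary vector `v` by the unknowns `c, d`. -/
def auxVector (n m ℓ : ℕ) : JetSpace n m ℓ × JetSpace n m ℓ →ₗ[ℂ] (ExVar n m ℓ → ℂ) where
  toFun x
    | .jet _ => 0
    | .a i => x.1 (Sum.inl i)
    | .b α μ => x.1 (Sum.inr (α, μ.1))
    | .c α μ => x.2 (Sum.inr (α, μ))
    | .d i => x.2 (Sum.inl i)
  map_add' x y := by
    funext w
    cases w <;> simp
  map_smul' c x := by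
    funext w
    cases w <;> simp

theorem sum_jacobianRow_mul_auxVector (ρ : JetSpace n m ℓ) (p : JetRing n m ℓ)
    (x : JetSpace n m ℓ × JetSpace n m ℓ) :
    ∑ w, eval ρ (jacobianRow p w) * auxVector n m ℓ x w = differentialAt ρ p x.2 := by
  have h : ∑ w, eval ρ (jacobianRow p w) * auxVector n m ℓ x w =
      ∑ μ, ∑ α, eval ρ (pderiv (Sum.inr (α, μ)) p) * x.2 (Sum.inr (α, μ)) +
        ∑ i, eval ρ (pderiv (Sum.inl i) p) * x.2 (Sum.inl i) := by
    simp [sum_exVar, jacobianRow, auxVector]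
  rw [h, differentialAt_apply, Fintype.sum_sum_type, Fintype.sum_prod_type, Finset.sum_comm,
    add_comm]

/-- The form `V(p)`, evaluated at the coordinates `a, b` of a contact vector, is the derivative of
`p` along this vector. -/
theorem sum_vessiotRow_mul_auxVector (ρ : JetSpace n m ℓ) (p : JetRing n m ℓ)
    (x : JetSpace n m ℓ × JetSpace n m ℓ) (hx : x.1 ∈ contactSpace ρ) :
    ∑ w, eval ρ (vessiotRow p w) * auxVector n m ℓ x w = differentialAt ρ p x.1 := by
  obtain ⟨u, v⟩ := x
  rw [mem_contactSpace_iff] at hx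
  -- the part of `u` that is spanned by the vertical fields of order `ℓ`
  let top : JetSpace n m ℓ := Sum.elim 0 fun k => if ∑ j, k.2.1 j = ℓ then u (Sum.inr k) else 0
  have hu : ∀ w, u w = ∑ i, u (Sum.inl i) * eval ρ (contactCoeff i w) + top w := by
    rintro (i | ⟨α, μ⟩)
    · simp [top, contactCoeff, apply_ite]
    · by_cases hμ : ∑ j, μ.1 j < ℓ
      · simp only [top, Sum.elim_inr, if_neg hμ.ne, add_zero]
        exact hx α μ hμ
      · have h2 : ∑ j, μ.1 j = ℓ := le_antisymm μ.2 (not_lt.mp hμ)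
        simp [top, h2, contactCoeff]
  have htop : ∑ w, eval ρ (pderiv w p) * top w =
      ∑ μ : TopIdx n ℓ, ∑ α, eval ρ (pderiv (Sum.inr (α, μ.1)) p) * u (Sum.inr (α, μ.1)) := by
    rw [Fintype.sum_sum_type, Fintype.sum_prod_type, Finset.sum_comm]
    simp only [top, Sum.elim_inl, Sum.elim_inr, Pi.zero_apply, mul_zero, Finset.sum_const_zero,
      zero_add, mul_ite]
    rw [← Finset.sum_subtype (Finset.univ.filter fun μ : MultiIdx n ℓ => ∑ j, μ.1 j = ℓ)
      (fun μ => by simp)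
      (fun μ => ∑ α, eval ρ (pderiv (Sum.inr (α, μ)) p) * u (Sum.inr (α, μ))),
      Finset.sum_filter]
    refine Finset.sum_congr rfl fun μ _ => ?_
    split_ifs <;> simp
  have hsplit : ∀ w, eval ρ (pderiv w p) * u w =
      eval ρ (pderiv w p) * ∑ i, u (Sum.inl i) * eval ρ (contactCoeff i w) +
        eval ρ (pderiv w p) * top w := fun w => by
    conv_lhs => rw [hu w]
    exact mul_add _ _ _
  rw [differentialAt_apply, Finset.sum_congr rfl fun w _ => hsplit w, Finset.sum_add_distrib, htop]
  simp only [sum_exVar, vessiotRow, auxVector, LinearMap.coe_mk, AddHom.coe_mk, map_zero, zero_mul,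
    Finset.sum_const_zero, zero_add, add_zero]
  congr 1
  simp only [contactDeriv_eq_sum, map_sum, map_mul, Finset.sum_mul, Finset.mul_sum]
  rw [Finset.sum_comm]
  exact Finset.sum_congr rfl fun w _ => Finset.sum_congr rfl fun i _ => by ring

theorem eq_zero_of_auxVector_eq_zero {ρ : JetSpace n m ℓ} {x : JetSpace n m ℓ × JetSpace n m ℓ}
    (hx : x.1 ∈ contactSpace ρ) (h : auxVector n m ℓ x = 0) : x = 0 := by
  rw [mem_contactSpace_iff] at hx
  have ha : ∀ i, x.1 (Sum.inl i) = 0 := fun i => congrFun h (.a i)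
  refine Prod.ext (funext ?_) (funext ?_)
  · rintro (i | ⟨α, μ⟩)
    · exact ha i
    · by_cases hμ : ∑ j, μ.1 j < ℓ
      · rw [hx α μ hμ]
        simp [ha]
      · exact congrFun h (.b α ⟨μ, le_antisymm μ.2 (not_lt.mp hμ)⟩)
  · rintro (i | ⟨α, μ⟩)
    · exact congrFun h (.d i)
    · exact congrFun h (.c α μ)

/-- The unknowns `a, b` can take arbitrary values: they are coordinates on the contact space. -/
theorem exists_auxVector_eq (ρ : JetSpace n m ℓ) {y : ExVar n m ℓ → ℂ}
    (hy : ∀ w, y (.jet w) = 0) : ∃ x, x.1 ∈ contactSpace ρ ∧ auxVector n m ℓ x = y := by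
  refine ⟨(Sum.elim (fun i => y (.a i)) fun k => if h : ∑ j, k.2.1 j = ℓ then y (.b k.1 ⟨k.2, h⟩)
    else ∑ i, y (.a i) * eval ρ (contactCoeff i (Sum.inr k)),
    Sum.elim (fun i => y (.d i)) fun k => y (.c k.1 k.2)), ?_, ?_⟩
  · rw [mem_contactSpace_iff]
    intro α μ hμ
    simp [hμ.ne]
  · funext w
    cases w with
    | jet w => exact (hy w).symm
    | b α μ => simp [auxVector, μ.2]
    | _ => rfl

/-- The solution space of the determining system over `ρ` splits into a part of the Vessiot space,
which depends on how many blocks of coordinates are required to vanish, and the tangent space. -/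
theorem finrank_auxSpaceFrom_eq {G : Finset (JetRing n m ℓ)}
    [(Ideal.span (G : Set (JetRing n m ℓ))).IsPrime] {ρ : JetSpace n m ℓ}
    (hρ : ρ ∈ zeroLocus ℂ (Ideal.span (G : Set (JetRing n m ℓ)))) {t : ℕ} (ht : t ≤ 4)
    (F : Submodule ℂ (JetSpace n m ℓ))
    (hF : ∀ u, u ∈ F ↔ u ∈ vessiotSpace (zeroLocus ℂ (Ideal.span (G : Set (JetRing n m ℓ)))) ρ ∧
      ∀ v : ExVar n m ℓ, v.block < t → auxVector n m ℓ (u, 0) v = 0) :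
    Module.finrank ℂ (auxSpaceFrom G ρ t) = Module.finrank ℂ F +
      Module.finrank ℂ (tangentSpace (zeroLocus ℂ (Ideal.span (G : Set (JetRing n m ℓ)))) ρ) := by
  set V := zeroLocus ℂ (Ideal.span (G : Set (JetRing n m ℓ))) with hV
  have hT : ∀ v, v ∈ tangentSpace V ρ ↔ ∀ p ∈ G, differentialAt ρ p v = 0 := fun v =>
    mem_tangentSpace_zeroLocus_span (G : Set (JetRing n m ℓ)) hρ v
  have hblock : ∀ (x : JetSpace n m ℓ × JetSpace n m ℓ) (v : ExVar n m ℓ), v.block < t →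
      auxVector n m ℓ x v = auxVector n m ℓ (x.1, 0) v := by
    intro x v hv
    have := hv.trans_le ht
    cases v <;> first | rfl | simp [ExVar.block] at this
  have hmap : (F.prod (tangentSpace V ρ)).map (auxVector n m ℓ) = auxSpaceFrom G ρ t := by
    ext y
    constructor
    · rintro ⟨x, ⟨hx1, hx2⟩, rfl⟩
      obtain ⟨⟨hu, hc⟩, hb⟩ := (hF _).mp hx1
      refine ⟨⟨fun w => rfl, fun p hp => ⟨?_, ?_⟩⟩, fun v hv => ?_⟩
      · rw [sum_vessiotRow_mul_auxVector ρ p x hc]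
        exact (hT _).mp hu p hp
      · rw [sum_jacobianRow_mul_auxVector]
        exact (hT _).mp hx2 p hp
      · rw [hblock x v hv]
        exact hb v hv
    · rintro ⟨⟨hjet, hrows⟩, hb⟩
      obtain ⟨x, hc, rfl⟩ := exists_auxVector_eq ρ hjet
      refine ⟨x, ⟨(hF _).mpr ⟨⟨(hT _).mpr fun p hp => ?_, hc⟩, fun v hv => ?_⟩,
        (hT _).mpr fun p hp => ?_⟩, rfl⟩
      · rw [← sum_vessiotRow_mul_auxVector ρ p x hc]
        exact (hrows p hp).1
      · rw [← hblock x v hv]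
        exact hb v hv
      · rw [← sum_jacobianRow_mul_auxVector]
        exact (hrows p hp).2
  let f := auxVector n m ℓ ∘ₗ F.subtype.prodMap (tangentSpace V ρ).subtype
  have hf : LinearMap.range f = auxSpaceFrom G ρ t := by
    rw [LinearMap.range_comp, LinearMap.range_prodMap, Submodule.range_subtype,
      Submodule.range_subtype, hmap]
  have hinj : Function.Injective f := by
    rw [← LinearMap.ker_eq_bot, LinearMap.ker_eq_bot']
    intro x h0
    have h := eq_zero_of_auxVector_eq_zero ((hF _).mp x.1.2).1.2 h0
    exact Prod.ext (Subtype.ext (congrArg Prod.fst h)) (Subtype.ext (congrArg Prod.snd h))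
  rw [← hf, LinearMap.finrank_range_of_inj hinj, Module.finrank_prod]

end Spaces

/-! ### Correctness of the output -/

section Geometry
variable {σ : Type*} [Fintype σ]

theorem localDim_zeroLocus (P : Ideal (MvPolynomial σ ℂ)) [P.IsPrime] {ρ : σ → ℂ}
    (hρ : ρ ∈ zeroLocus ℂ P) :
    localDim (zeroLocus ℂ P) ρ = ringKrullDim (MvPolynomial σ ℂ ⧸ P) := by
  have h : {Q ∈ (vanishingIdeal ℂ (zeroLocus ℂ P)).minimalPrimes | ρ ∈ zeroLocus ℂ Q} = {P} := by
    rw [MvPolynomial.IsPrime.vanishingIdeal_zeroLocus, Ideal.minimalPrimes_eq_subsingleton_self]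
    ext Q
    simp only [Set.mem_ofPred_eq, Set.mem_singleton_iff, and_iff_left_iff_imp]
    rintro rfl
    exact hρ
  rw [localDim, h, iSup_singleton]

/-- A point of an irreducible variety is singular if and only if the tangent space there has a
dimension greater than the variety. -/
theorem mem_algSing_zeroLocus_iff (P : Ideal (MvPolynomial σ ℂ)) [P.IsPrime] {ρ : σ → ℂ}
    (hρ : ρ ∈ zeroLocus ℂ P) : ρ ∈ algSing (zeroLocus ℂ P) ↔
      ringKrullDim (MvPolynomial σ ℂ ⧸ P) <
        ((Module.finrank ℂ (tangentSpace (zeroLocus ℂ P) ρ) : ℕ) : WithBot ℕ∞) := by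
  have hle := ringKrullDim_quotient_le_finrank_tangentSpace P hρ
  simp only [algSing, IsSmoothPoint, Set.mem_ofPred_eq, hρ, true_and, localDim_zeroLocus P hρ]
  exact ⟨fun h => lt_of_le_of_ne hle fun h' => h h'.symm, fun h h' => h.ne' h'⟩

end Geometry

section Bundles
variable {n m ℓ : ℕ}

/-- The equation of the contact distribution for the coordinate `u^α_μ` with `|μ| < ℓ`, and the
zero equation for `|μ| = ℓ`. -/
def contactRow (k : Fin m × MultiIdx n ℓ) : JetVar n m ℓ → JetRing n m ℓ :=
  open Classical in
  if ∑ j, k.2.1 j < ℓ then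
    Pi.single (Sum.inr k) 1 - Sum.elim (fun i => contactCoeff i (Sum.inr k)) 0
  else 0

theorem mem_contactSpace_iff_contactRow {ρ u : JetSpace n m ℓ} :
    u ∈ contactSpace ρ ↔ ∀ k, ∑ w, eval ρ (contactRow k w) * u w = 0 := by
  classical
  rw [mem_contactSpace_iff, Prod.forall]
  refine forall₂_congr fun α μ => ?_
  by_cases h : ∑ j, μ.1 j < ℓ
  · have h1 : ∑ w, eval ρ (contactRow (α, μ) w) * u w = u (Sum.inr (α, μ)) -
        ∑ i, u (Sum.inl i) * eval ρ (contactCoeff i (Sum.inr (α, μ))) := by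
      simp only [contactRow, if_pos h, Pi.sub_apply, map_sub, sub_mul, Finset.sum_sub_distrib]
      congr 1
      · simp [Pi.single_apply, apply_ite]
      · simp [mul_comm]
    simp only [h, forall_const, h1, sub_eq_zero]
  · simp [contactRow, h]

/-- A contact vector is vertical over the jet bundle of lower order as soon as it is vertical
over the base. -/
theorem mem_verticalSpace_iff_of_mem_contactSpace {ρ u : JetSpace n m ℓ}
    (hu : u ∈ contactSpace ρ) : u ∈ verticalSpace n m ℓ ↔ ∀ i, u (Sum.inl i) = 0 := by
  rw [mem_contactSpace_iff] at hu
  refine ⟨fun h => h.1, fun h => ⟨h, fun α μ hμ => ?_⟩⟩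
  rw [hu α μ hμ]
  simp [h]

end Bundles

section Correctness
variable {n m ℓ : ℕ} {lt : ExVar n m ℓ → ExVar n m ℓ → Prop}

theorem IsThomasDecomposition.projectSystem_sol_subset (hlt : IsAdmissibleOrder lt)
    {G : Finset (JetRing n m ℓ)} {L : List (AlgSystem (ExVar n m ℓ))}
    (hL : IsThomasDecomposition lt (determiningSystem G) L)
    (haux : ∀ T ∈ L, NoAuxInequations lt T) {T : AlgSystem (ExVar n m ℓ)} (hT : T ∈ L) :
    (projectSystem T).sol ⊆ zeroLocus ℂ (Ideal.span (G : Set (JetRing n m ℓ))) := by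
  intro ρ hρ
  obtain ⟨a, haT, ha⟩ := (mem_sol_projectSystem_iff hlt (hL.1 T hT) (haux T hT)).mp hρ
  have haG : a ∈ (determiningSystem G).sol := by
    rw [hL.2.2]
    exact ⟨T, hT, haT⟩
  exact ((mem_sol_determiningSystem_iff_exists ha).mp haG).1

theorem IsThomasDecomposition.exists_mem_projectSystem_sol (hlt : IsAdmissibleOrder lt)
    {G : Finset (JetRing n m ℓ)} {L : List (AlgSystem (ExVar n m ℓ))}
    (hL : IsThomasDecomposition lt (determiningSystem G) L)
    (haux : ∀ T ∈ L, NoAuxInequations lt T) {ρ : JetSpace n m ℓ}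
    (hρ : ρ ∈ zeroLocus ℂ (Ideal.span (G : Set (JetRing n m ℓ)))) :
    ∃ T ∈ L, ρ ∈ (projectSystem T).sol := by
  have h : jetPoint ρ ∈ (determiningSystem G).sol :=
    (mem_sol_determiningSystem_iff_exists (ρ := ρ) fun w => rfl).mpr
      ⟨hρ, by rw [sub_self]; exact Submodule.zero_mem _⟩
  rw [hL.2.2] at h
  obtain ⟨T, hT, hmem⟩ := h
  exact ⟨T, hT, (mem_sol_projectSystem_iff hlt (hL.1 T hT) (haux T hT)).mpr
    ⟨_, hmem, fun w => rfl⟩⟩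

theorem IsThomasDecomposition.pairwise_disjoint_projectSystem (hlt : IsAdmissibleOrder lt)
    {G : Finset (JetRing n m ℓ)} {L : List (AlgSystem (ExVar n m ℓ))}
    (hL : IsThomasDecomposition lt (determiningSystem G) L)
    (haux : ∀ T ∈ L, NoAuxInequations lt T) :
    L.Pairwise fun A B => Disjoint (projectSystem A).sol (projectSystem B).sol := by
  refine hL.2.1.imp_of_mem fun {A B} hA hB hAB => Set.disjoint_left.mpr fun ρ hρA hρB => ?_
  exact Set.disjoint_left.mp hAB
    (hL.fibre_subset_sol hlt haux hA hρA (Submodule.zero_mem (auxSpace G ρ)))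
    (hL.fibre_subset_sol hlt haux hB hρB (Submodule.zero_mem (auxSpace G ρ)))

section Component
variable {G : Finset (JetRing n m ℓ)} [(Ideal.span (G : Set (JetRing n m ℓ))).IsPrime]
  {L : List (AlgSystem (ExVar n m ℓ))} {T : AlgSystem (ExVar n m ℓ)} {ρ : JetSpace n m ℓ}

theorem IsThomasDecomposition.finrank_tangentSpace (hlt : IsAdmissibleOrder lt)
    (hL : IsThomasDecomposition lt (determiningSystem G) L)
    (haux : ∀ T ∈ L, NoAuxInequations lt T) (hT : T ∈ L) (hρ : ρ ∈ (projectSystem T).sol) :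
    Module.finrank ℂ (tangentSpace (zeroLocus ℂ (Ideal.span (G : Set (JetRing n m ℓ)))) ρ) =
      (freeVars lt T 4).ncard := by
  have hρV := hL.projectSystem_sol_subset hlt haux hT hρ
  rw [← hL.finrank_auxSpaceFrom hlt haux hT hρ (t := 4) (by norm_num),
    finrank_auxSpaceFrom_eq hρV le_rfl ⊥ fun u => ?_, finrank_bot, zero_add]
  rw [Submodule.mem_bot]
  constructor
  · rintro rfl
    refine ⟨Submodule.zero_mem _, fun v _ => ?_⟩
    have h : auxVector n m ℓ (0, 0) = 0 := map_zero (auxVector n m ℓ)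
    rw [h]
    rfl
  · rintro ⟨hu, h⟩
    refine congrArg Prod.fst (eq_zero_of_auxVector_eq_zero (x := (u, 0)) hu.2 (funext fun v => ?_))
    by_cases hv : v.block < 4
    · exact h v hv
    · cases v with
      | jet w => rfl
      | _ => first | rfl | simp [ExVar.block] at hv

theorem IsThomasDecomposition.finrank_vessiotSpace (hlt : IsAdmissibleOrder lt)
    (hL : IsThomasDecomposition lt (determiningSystem G) L)
    (haux : ∀ T ∈ L, NoAuxInequations lt T) (hT : T ∈ L) (hρ : ρ ∈ (projectSystem T).sol) :
    Module.finrank ℂ (vessiotSpace (zeroLocus ℂ (Ideal.span (G : Set (JetRing n m ℓ)))) ρ) =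
      (freeVars lt T 2).ncard - (freeVars lt T 4).ncard := by
  have hρV := hL.projectSystem_sol_subset hlt haux hT hρ
  rw [← hL.finrank_auxSpaceFrom hlt haux hT hρ le_rfl, ← hL.finrank_tangentSpace hlt haux hT hρ,
    finrank_auxSpaceFrom_eq hρV (by norm_num) _ fun u => ?_, Nat.add_sub_cancel]
  refine ⟨fun hu => ⟨hu, fun v hv => ?_⟩, fun h => h.1⟩
  cases v with
  | jet w => rfl
  | _ => simp [ExVar.block] at hv

theorem IsThomasDecomposition.finrank_symbolSpace (hlt : IsAdmissibleOrder lt)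
    (hL : IsThomasDecomposition lt (determiningSystem G) L)
    (haux : ∀ T ∈ L, NoAuxInequations lt T) (hT : T ∈ L) (hρ : ρ ∈ (projectSystem T).sol) :
    Module.finrank ℂ (symbolSpace (zeroLocus ℂ (Ideal.span (G : Set (JetRing n m ℓ)))) ρ) =
      (freeVars lt T 3).ncard - (freeVars lt T 4).ncard := by
  have hρV := hL.projectSystem_sol_subset hlt haux hT hρ
  rw [← hL.finrank_auxSpaceFrom hlt haux hT hρ (t := 3) (by norm_num),
    ← hL.finrank_tangentSpace hlt haux hT hρ,
    finrank_auxSpaceFrom_eq hρV (by norm_num) _ fun u => ?_, Nat.add_sub_cancel]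
  rw [symbolSpace, Submodule.mem_inf]
  refine and_congr_right fun hu => ?_
  rw [mem_verticalSpace_iff_of_mem_contactSpace hu.2]
  constructor
  · intro h v hv
    cases v with
    | jet w => rfl
    | a i => exact h i
    | _ => simp [ExVar.block] at hv
  · exact fun h i => h (.a i) (by simp [ExVar.block])

theorem IsThomasDecomposition.isVectorBundleOver_vessiotSpace (hlt : IsAdmissibleOrder lt)
    (hL : IsThomasDecomposition lt (determiningSystem G) L)
    (haux : ∀ T ∈ L, NoAuxInequations lt T) (hT : T ∈ L) :
    IsVectorBundleOver (projectSystem T).sol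
      (vessiotSpace (zeroLocus ℂ (Ideal.span (G : Set (JetRing n m ℓ))))) := by
  refine isVectorBundleOver_of_finrank_eq (κ := G ⊕ (Fin m × MultiIdx n ℓ))
    (Sum.elim (fun p w => pderiv w p.1) contactRow) _ _ (fun ρ hρ v => ?_) _
    fun ρ hρ => hL.finrank_vessiotSpace hlt haux hT hρ
  have hρV := hL.projectSystem_sol_subset hlt haux hT hρ
  rw [vessiotSpace, Submodule.mem_inf, mem_contactSpace_iff_contactRow, Sum.forall,
    mem_tangentSpace_zeroLocus_span _ hρV]
  simp only [Sum.elim_inl, Sum.elim_inr, differentialAt_apply, Subtype.forall, Finset.mem_coe]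

theorem IsThomasDecomposition.isVectorBundleOver_symbolSpace (hlt : IsAdmissibleOrder lt)
    (hL : IsThomasDecomposition lt (determiningSystem G) L)
    (haux : ∀ T ∈ L, NoAuxInequations lt T) (hT : T ∈ L) :
    IsVectorBundleOver (projectSystem T).sol
      (symbolSpace (zeroLocus ℂ (Ideal.span (G : Set (JetRing n m ℓ))))) := by
  classical
  refine isVectorBundleOver_of_finrank_eq (κ := (G ⊕ (Fin m × MultiIdx n ℓ)) ⊕ Fin n)
    (Sum.elim (Sum.elim (fun p w => pderiv w p.1) contactRow) fun i => Pi.single (Sum.inl i) 1)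
    _ _ (fun ρ hρ v => ?_) _ fun ρ hρ => hL.finrank_symbolSpace hlt haux hT hρ
  have hρV := hL.projectSystem_sol_subset hlt haux hT hρ
  have hsingle : ∀ i : Fin n, ∑ w, eval ρ ((Pi.single (Sum.inl i) 1 :
      JetVar n m ℓ → JetRing n m ℓ) w) * v w = v (Sum.inl i) := fun i => by
    simp [Pi.single_apply, apply_ite]
  have hvert : v ∈ symbolSpace (zeroLocus ℂ (Ideal.span (G : Set (JetRing n m ℓ)))) ρ ↔
      v ∈ vessiotSpace (zeroLocus ℂ (Ideal.span (G : Set (JetRing n m ℓ)))) ρ ∧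
        ∀ i, v (Sum.inl i) = 0 := by
    rw [symbolSpace, Submodule.mem_inf]
    exact and_congr_right fun hv => mem_verticalSpace_iff_of_mem_contactSpace hv.2
  rw [hvert, vessiotSpace, Submodule.mem_inf, mem_contactSpace_iff_contactRow, Sum.forall,
    Sum.forall, mem_tangentSpace_zeroLocus_span _ hρV]
  simp only [Sum.elim_inl, Sum.elim_inr, differentialAt_apply, Subtype.forall, Finset.mem_coe,
    hsingle]

/-- The mark of a system in the output tells whether its solutions are singular points: the Jacobian
rank is the codimension of the tangent spaces. -/
theorem IsThomasDecomposition.singular_outputOf_iff (hlt : IsAdmissibleOrder lt)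
    (hL : IsThomasDecomposition lt (determiningSystem G) L)
    (haux : ∀ T ∈ L, NoAuxInequations lt T) (hT : T ∈ L) (hρ : ρ ∈ (projectSystem T).sol) :
    (outputOf lt G T).singular ↔
      ρ ∈ algSing (zeroLocus ℂ (Ideal.span (G : Set (JetRing n m ℓ)))) := by
  have hρV := hL.projectSystem_sol_subset hlt haux hT hρ
  have hle := ringKrullDim_quotient_le_finrank_tangentSpace _ hρV
  rw [mem_algSing_zeroLocus_iff _ hρV, outputOf, ← ncard_freeVars_add_jacobianRank hlt (hL.1 T hT),
    hL.finrank_tangentSpace hlt haux hT hρ]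
  rw [hL.finrank_tangentSpace hlt haux hT hρ] at hle
  generalize ringKrullDim (JetRing n m ℓ ⧸ Ideal.span (G : Set (JetRing n m ℓ))) = d at hle ⊢
  generalize (freeVars lt T 4).ncard = f at hle ⊢
  generalize jacobianRank lt T = j
  rw [Nat.cast_add, add_comm (f : WithBot ℕ∞)]
  induction d with
  | bot => simp
  | coe d =>
    have hd : d ≤ (f : ℕ∞) := by exact_mod_cast hle
    lift d to ℕ using ne_top_of_le_ne_top (ENat.natCast_ne_top f) hd
    norm_cast
    omega

theorem IsThomasDecomposition.isRegularJetSetIn (hlt : IsAdmissibleOrder lt)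
    (hL : IsThomasDecomposition lt (determiningSystem G) L)
    (haux : ∀ T ∈ L, NoAuxInequations lt T) (hT : T ∈ L) (hreg : ¬ (outputOf lt G T).singular) :
    IsRegularJetSetIn (zeroLocus ℂ (Ideal.span (G : Set (JetRing n m ℓ))))
      (projectSystem T).sol where
  subset := hL.projectSystem_sol_subset hlt haux hT
  locallyClosed := isLocallyZariskiClosed_sol _
  smoothPoints ρ hρ := by
    rw [hL.singular_outputOf_iff hlt haux hT hρ] at hreg
    by_contra h
    exact hreg ⟨hL.projectSystem_sol_subset hlt haux hT hρ, h⟩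
  manifold :=
    have := hlt.isStrictTotalOrder_restrictOrder
    ((hL.1 T hT).projectSystem hlt).isComplexSubmanifold_sol
  vessiotBundle := hL.isVectorBundleOver_vessiotSpace hlt haux hT
  symbolBundle := hL.isVectorBundleOver_symbolSpace hlt haux hT

theorem IsThomasDecomposition.isCorrectFor (hlt : IsAdmissibleOrder lt)
    (hL : IsThomasDecomposition lt (determiningSystem G) L)
    (haux : ∀ T ∈ L, NoAuxInequations lt T) :
    IsCorrectFor (restrictOrder lt) (zeroLocus ℂ (Ideal.span (G : Set (JetRing n m ℓ))))
      (L.map (outputOf lt G)) := by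
  classical
  set V := zeroLocus ℂ (Ideal.span (G : Set (JetRing n m ℓ))) with hV
  have hdisj : (L.map (outputOf lt G)).Pairwise fun O O' =>
      Disjoint O.system.sol O'.system.sol :=
    List.pairwise_map.mpr (hL.pairwise_disjoint_projectSystem hlt haux)
  have hunion : V = {ρ | ∃ O ∈ L.map (outputOf lt G), ρ ∈ O.system.sol} := by
    ext ρ
    simp only [Set.mem_ofPred_eq, List.mem_map, exists_exists_and_eq_and]
    exact ⟨fun h => hL.exists_mem_projectSystem_sol hlt haux h,
      fun ⟨T, hT, h⟩ => hL.projectSystem_sol_subset hlt haux hT h⟩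
  have hsing : ∀ O ∈ L.map (outputOf lt G), ∀ ρ ∈ O.system.sol, O.singular ↔ ρ ∈ algSing V := by
    intro O hO ρ hρ
    obtain ⟨T, hT, rfl⟩ := List.mem_map.mp hO
    exact hL.singular_outputOf_iff hlt haux hT hρ
  have hreg : ∀ O ∈ L.map (outputOf lt G), ¬ O.singular → IsRegularJetSetIn V O.system.sol := by
    intro O hO hns
    obtain ⟨T, hT, rfl⟩ := List.mem_map.mp hO
    exact hL.isRegularJetSetIn hlt haux hT hns
  have hmem : ∀ Z, Z ∈ (((L.map (outputOf lt G)).filter fun O => decide (¬ O.singular)).map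
      fun O => O.system.sol) ↔ ∃ O ∈ L.map (outputOf lt G), ¬ O.singular ∧ O.system.sol = Z := by
    intro Z
    simp only [List.mem_map (l := List.filter _ _), List.mem_filter, decide_eq_true_eq, and_assoc]
  refine ⟨?_, hdisj, hunion, fun O hO hs ρ hρ => (hsing O hO ρ hρ).mp hs, hreg, ?_, ?_⟩
  · intro O hO
    obtain ⟨T, hT, rfl⟩ := List.mem_map.mp hO
    exact (hL.1 T hT).projectSystem hlt
  · ext ρ
    constructor
    · intro h
      have hρ : ρ ∈ V := h.1
      rw [hunion] at hρ
      obtain ⟨O, hO, hρO⟩ := hρ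
      exact ⟨O, hO, (hsing O hO ρ hρO).mpr h, hρO⟩
    · rintro ⟨O, hO, hs, hρ⟩
      exact (hsing O hO ρ hρ).mp hs
  · refine ⟨fun Z hZ => ?_, ?_, fun Z hZ => ?_, ?_⟩
    · obtain ⟨O, hO, hns, rfl⟩ := (hmem Z).mp hZ
      exact hreg O hO hns
    · exact List.pairwise_map.mpr (hdisj.filter _)
    · obtain ⟨O, hO, hns, rfl⟩ := (hmem Z).mp hZ
      exact Set.disjoint_left.mpr fun ρ hρ h => hns ((hsing O hO ρ hρ).mpr h)
    · ext ρ
      constructor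
      · intro hρ
        by_cases hs : ρ ∈ algSing V
        · exact Or.inr hs
        · have hρ' := hρ
          rw [hunion] at hρ'
          obtain ⟨O, hO, hρO⟩ := hρ'
          exact Or.inl ⟨_, (hmem _).mpr ⟨O, hO, fun h => hs ((hsing O hO ρ hρO).mp h), rfl⟩, hρO⟩
      · rintro (⟨Z, hZ, hρ⟩ | h)
        · obtain ⟨O, hO, hns, rfl⟩ := (hmem Z).mp hZ
          exact (hreg O hO hns).subset hρ
        · exact h.1

end Component

theorem isCorrectOutput (hlt : IsAdmissibleOrder lt) (S : DiffSystem n m) {out : Output n m ℓ}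
    (h : Reachable S lt (.returned out)) : IsCorrectOutput S lt out := by
  obtain ⟨done, hprime, hdone, rfl⟩ := h.invariant
  have hfst : (done.map fun e => (e.1, e.2.map (outputOf lt e.1))).map Prod.fst =
      done.map Prod.fst := by
    rw [List.map_map]
    rfl
  refine ⟨by rw [hfst]; exact hprime, fun e he => ?_⟩
  obtain ⟨⟨G, L⟩, hmem, rfl⟩ := List.mem_map.mp he
  have hP : (Ideal.span (G : Set (JetRing n m ℓ))).IsPrime :=
    ((hprime.2 _).mpr ⟨G, List.mem_map.mpr ⟨_, hmem, rfl⟩, rfl⟩).1.1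
  exact (hdone _ hmem).1.isCorrectFor hlt (hdone _ hmem).2

end Correctness

end RegDec

end

theorem mainTheorem2 (n m ℓ : ℕ) (hℓ : 1 ≤ ℓ) (S : RegDec.DiffSystem n m)
    (lt : RegDec.ExVar n m ℓ → RegDec.ExVar n m ℓ → Prop) (hlt : RegDec.IsAdmissibleOrder lt) :
    RegDec.Terminates S lt ∧
      ∀ out : RegDec.Output n m ℓ, RegDec.Reachable S lt (.returned out) →
        RegDec.IsCorrectOutput S lt out :=
  ⟨RegDec.terminates hlt S, fun _ h => RegDec.isCorrectOutput hlt S h⟩
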